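/- Let $\mathbb{T}^1=\mathbb{R}/\mathbb{Z}$ and let $m$ be Lebesgue measure on $\mathbb{T}^1$, normalized so that $m(\mathbb{T}^1)=1$. Let $\mathcal{E}^1_0$ be the set of all $C^1$ maps $f:\mathbb{T}^1\to\mathbb{T}^1$ such that $f(0)=0$ and, for some $\lambda>1$, $$|(f^n)'(x)|>\lambda^n\quad\text{for all } x\in\mathbb{T}^1 \text{ and all integers } n\ge 1,$$ endowed with the $C^1$ topology (uniform convergence of the maps and of their derivatives). An aci$\sigma$ for $f$ is a nonzero $\sigma$-finite Borel measure $\mu$ on $\mathbb{T}^1$ that is absolutely continuous with respect to $m$ and $f$-invariant, i.e. $\mu(f^{-1}(B))=\mu(B)$ for every Borel set $B$. Then there exists a residual set $\mathcal{R}_0\subset\mathcal{E}^1_0$ (a set containing a countable intersection of open dense subsets of $\mathcal{E}^1_0$) such that no $f\in\mathcal{R}_0$ has an aci$\sigma$. -/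

import Mathlib

open MeasureTheory

/-- A `C¹` map of the circle `ℝ / ℤ` to itself: a map that lifts to a `C¹` map of the line. -/
structure C1CircleMap where
  /-- The underlying map of the circle. -/
  toFun : UnitAddCircle → UnitAddCircle
  exists_lift : ∃ F : ℝ → ℝ, ContDiff ℝ 1 F ∧ ∀ x : ℝ, toFun (x : UnitAddCircle) = (F x : UnitAddCircle)

namespace C1CircleMap

instance : CoeFun C1CircleMap (fun _ => UnitAddCircle → UnitAddCircle) := ⟨C1CircleMap.toFun⟩

/-- `F : ℝ → ℝ` is a lift of `f`. -/
def IsLift (f : C1CircleMap) (F : ℝ → ℝ) : Prop :=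
  ∀ x : ℝ, f (x : UnitAddCircle) = (F x : UnitAddCircle)

/-- Some `C¹` lift of `f`; any two differ by a constant integer. -/
noncomputable def lift (f : C1CircleMap) : ℝ → ℝ := f.exists_lift.choose

theorem contDiff_lift (f : C1CircleMap) : ContDiff ℝ 1 f.lift := f.exists_lift.choose_spec.1

theorem isLift_lift (f : C1CircleMap) : f.IsLift f.lift := f.exists_lift.choose_spec.2

theorem IsLift.deriv_eq {f : C1CircleMap} {F G : ℝ → ℝ} (hF : f.IsLift F) (hG : f.IsLift G)
    (cF : Continuous F) (cG : Continuous G) : deriv F = deriv G := by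
  have h : ∀ x : ℝ, ∃ k : ℤ, (k : ℝ) = F x - G x := fun x => by
    have h1 : ((F x - G x : ℝ) : UnitAddCircle) = 0 := by
      rw [AddCircle.coe_sub, ← hF x, ← hG x, sub_self]
    obtain ⟨k, hk⟩ := (AddCircle.coe_eq_zero_iff (1 : ℝ)).1 h1
    exact ⟨k, by simpa using hk⟩
  choose k hk using h
  have ck : Continuous k := by
    rw [Int.isClosedEmbedding_coe_real.isInducing.continuous_iff]
    have : ((↑) : ℤ → ℝ) ∘ k = fun x => F x - G x := funext hk
    rw [this]
    exact cF.sub cG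
  have hFG : F = fun x => G x + (k 0 : ℝ) := by
    funext x
    have h0 : k x = k 0 := PreconnectedSpace.constant inferInstance ck
    have h1 := hk x
    rw [h0] at h1
    linarith
  funext x
  rw [hFG, deriv_add_const]

theorem periodic_deriv_lift (f : C1CircleMap) : Function.Periodic (deriv f.lift) 1 := by
  intro x
  have hG : f.IsLift (fun y => f.lift (y + 1)) := fun y => by
    have h := f.isLift_lift (y + 1)
    rwa [AddCircle.coe_add, AddCircle.coe_period, add_zero] at h
  have h := hG.deriv_eq f.isLift_lift
    (f.contDiff_lift.continuous.comp (continuous_id.add continuous_const))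
    f.contDiff_lift.continuous
  have h2 := congrFun h x
  rwa [deriv_comp_add_const] at h2

/-- The derivative `f' : ℝ / ℤ → ℝ` of a `C¹` map of the circle: `f' (x mod 1) = F' x`, where `F`
is a lift of `f`. -/
noncomputable def derivative (f : C1CircleMap) : C(UnitAddCircle, ℝ) where
  toFun := f.periodic_deriv_lift.lift
  continuous_toFun := by
    refine (QuotientAddGroup.isQuotientMap_mk _).continuous_iff.2 ?_
    exact f.contDiff_lift.continuous_deriv le_rfl

/-- The derivative can be computed with any continuous lift. -/
theorem derivative_coe (f : C1CircleMap) {F : ℝ → ℝ} (hF : f.IsLift F) (cF : Continuous F)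
    (x : ℝ) : f.derivative (x : UnitAddCircle) = deriv F x := by
  rw [hF.deriv_eq f.isLift_lift cF f.contDiff_lift.continuous]
  rfl

/-- A `C¹` map of the circle as a continuous map. -/
def toContinuousMap (f : C1CircleMap) : C(UnitAddCircle, UnitAddCircle) where
  toFun := f
  continuous_toFun := by
    obtain ⟨F, hF, h⟩ := f.exists_lift
    refine (QuotientAddGroup.isQuotientMap_mk _).continuous_iff.2 ?_
    exact ((AddCircle.continuous_mk' (1 : ℝ)).comp hF.continuous).congr fun x => (h x).symm

/-- The `C¹` topology: uniform convergence of the maps and of their derivatives (the circle is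
compact, so the topologies of `C(_, _)` are those of uniform convergence). -/
noncomputable instance : TopologicalSpace C1CircleMap :=
  TopologicalSpace.induced (fun f => (f.toContinuousMap, f.derivative)) inferInstance

/-- The `n`-th iterate `f ∘ ⋯ ∘ f` of a `C¹` map of the circle. -/
def iterate (f : C1CircleMap) (n : ℕ) : C1CircleMap where
  toFun := f.toFun^[n]
  exists_lift := by
    obtain ⟨F, hF, h⟩ := f.exists_lift
    refine ⟨F^[n], ?_, fun x => ?_⟩
    · induction n with
      | zero => exact contDiff_id
      | succ n ih => rw [Function.iterate_succ']; exact hF.comp ih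
    · induction n with
      | zero => rfl
      | succ n ih => rw [Function.iterate_succ_apply', Function.iterate_succ_apply', ih, h]

/-- `|(fⁿ)'(x)| > c rⁿ` for all points `x` of the circle and all positive integers `n`. -/
def IsExpandingWith (f : C1CircleMap) (c r : ℝ) : Prop :=
  ∀ n : ℕ, 1 ≤ n → ∀ x : UnitAddCircle, c * r ^ n < |(f.iterate n).derivative x|

end C1CircleMap

/-- The `C¹` expanding maps of the circle that fix `0` and whose expansion constant `c` can be
taken to be `1`. As a type it carries the topology induced by the `C¹` topology. -/
def expandingMapsFixingZero : Set C1CircleMap :=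
  {f | f 0 = 0 ∧ ∃ r : ℝ, 1 < r ∧ f.IsExpandingWith 1 r}

/-- `μ` is a (nonzero) absolutely continuous invariant `σ`-finite measure of `f`. The measure
`volume` on `UnitAddCircle` is Lebesgue measure, of total mass `1`. -/
structure IsAciSigma (f : UnitAddCircle → UnitAddCircle) (μ : Measure UnitAddCircle) : Prop where
  ne_zero : μ ≠ 0
  sigmaFinite : SigmaFinite μ
  absolutelyContinuous : μ ≪ (volume : Measure UnitAddCircle)
  invariant : MeasurePreserving f μ μ

/-! A map with Lipschitz derivative has a continuous positive invariant density `ρ`, and the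
iterates of its transfer operator `L` send every continuous `u` uniformly to `(∫ u) ρ`. Such maps
are `C¹` dense. The `C¹` topology, however, puts no bound on how the density oscillates: an
arbitrarily small perturbation can make it take values on very many different scales, each on a set
of small measure. For a generic map the averages of `Lⁿ` imitate such spread densities at suitable
times, and this is incompatible with an absolutely continuous invariant measure.

Perturbation. Conjugate `f` by a circle diffeomorphism `h` with `h' = w`. The new derivative at `h
y` is `f'(y) w(f y) / w(y)`, so the new map is `C¹` close to `f` once `h` is uniformly close to the
identity and `w ∘ f / w` is close to `1`; `w` itself may be very large or very small. The new
density is `(ρ / w) ∘ h⁻¹`. A suitable `w` is a normalised sum of `1` and `J` spikes, each of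
integral one, nearly equidistributed, slowly varying along orbits and living on a set tiny compared
with the size of the previous sum (`HasMixingDensity.exists_spike`,
`HasMixingDensity.exists_spread`). A window of bounded ratio then meets essentially one spike and
carries about `1 / (J + 1)` of the mass. This gives `HasMixingDensity.exists_isSpread_near`.

Genericity. For a fixed time `N`, the average of `Lⁿ u` over `n < N` depends continuously on the
map. Hence it is an open condition that, at some time, the averages of finitely many test functions
are close to multiples of some spread `q`. It holds at maps whose own density is spread, so it is
also dense. The density `q` need not belong to the generic map itself.

Obstruction. Let `μ` be an absolutely continuous invariant `σ`-finite measure, and take a set `A` of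
positive measure on which `μ` is Lebesgue measure up to a constant and a factor `2`. As `q` is
spread, `A` contains sizeable parts `C`, where `q` is small, and `B`, where `q` is larger by a
factor `10⁸`. Hopf's maximal inequality for `μ` says that, apart from a small part of `C`, orbits
starting in `C` visit `B` at most a fixed constant times as often as `C` up to time `N`. The
averages of `Lⁿ` say that, for Lebesgue measure, the visits are distributed like `q`, hence favour
`B` by about `10⁸`. The two contradict each other in
`C1CircleMap.not_comparable_of_transferSum_bounds`. The maximal inequality for `L` makes this work
although `1_A` is only approximated in `L¹` by a test function. -/

open Filter Topology

/-! ### Expanding lifts and their inverses -/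

/-- `F` is the lift, fixing the origin, of a degree `d` `C¹` circle map with `|F'| > 1`. -/
structure IsExpandingLift (F : ℝ → ℝ) (d : ℤ) : Prop where
  contDiff : ContDiff ℝ 1 F
  map_zero : F 0 = 0
  map_add_one : ∀ x, F (x + 1) = F x + d
  one_lt_abs_deriv : ∀ x, 1 < |deriv F x|

namespace IsExpandingLift

variable {F : ℝ → ℝ} {d : ℤ}

theorem continuous (hF : IsExpandingLift F d) : Continuous F := hF.contDiff.continuous

theorem differentiable (hF : IsExpandingLift F d) : Differentiable ℝ F :=
  hF.contDiff.differentiable one_ne_zero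

theorem continuous_deriv (hF : IsExpandingLift F d) : Continuous (deriv F) :=
  hF.contDiff.continuous_deriv le_rfl

theorem periodic_deriv (hF : IsExpandingLift F d) : Function.Periodic (deriv F) 1 := by
  intro x
  have h : (fun y => F (y + 1)) = fun y => F y + d := funext hF.map_add_one
  rw [← deriv_comp_add_const, h, deriv_add_const]

theorem map_add_nat (hF : IsExpandingLift F d) (x : ℝ) (n : ℕ) : F (x + n) = F x + n * d := by
  induction n with
  | zero => simp
  | succ n ih =>
    push_cast
    rw [← add_assoc, hF.map_add_one, ih]
    ring

theorem map_add_int (hF : IsExpandingLift F d) (x : ℝ) (n : ℤ) : F (x + n) = F x + n * d := by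
  obtain ⟨n, rfl | rfl⟩ := n.eq_nat_or_neg
  · exact_mod_cast hF.map_add_nat x n
  · have h := hF.map_add_nat (x - n) n
    rw [sub_add_cancel] at h
    push_cast
    rw [← sub_eq_add_neg]
    linarith

theorem map_int (hF : IsExpandingLift F d) (n : ℤ) : F n = n * d := by
  have h := hF.map_add_int 0 n
  rwa [zero_add, hF.map_zero, zero_add] at h

/-- A uniform expansion rate. -/
theorem exists_rate (hF : IsExpandingLift F d) : ∃ r : ℝ, 1 < r ∧ ∀ x, r ≤ |deriv F x| := by
  obtain ⟨x₀, -, h₀⟩ := isCompact_Icc.exists_isMinOn (Set.nonempty_Icc.2 zero_le_one)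
    (hF.continuous_deriv.abs.continuousOn (s := Set.Icc (0 : ℝ) 1))
  refine ⟨|deriv F x₀|, hF.one_lt_abs_deriv x₀, fun x => ?_⟩
  obtain ⟨y, hy, hxy⟩ := hF.periodic_deriv.exists_mem_Ico₀ one_pos x
  rw [hxy]
  exact h₀ ⟨hy.1, hy.2.le⟩

theorem mul_abs_sub_le (hF : IsExpandingLift F d) {r : ℝ} (hr : ∀ x, r ≤ |deriv F x|) (x y : ℝ) :
    r * |x - y| ≤ |F x - F y| := by
  wlog hxy : x < y generalizing x y
  · rcases eq_or_lt_of_le (not_lt.1 hxy) with h | h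
    · simp [h]
    · rw [abs_sub_comm, abs_sub_comm (F x)]
      exact this y x h
  obtain ⟨c, -, hc⟩ := exists_deriv_eq_slope F hxy hF.continuous.continuousOn
    hF.differentiable.differentiableOn
  have h1 : F y - F x = deriv F c * (y - x) := by
    rw [hc]
    field_simp [(sub_pos.2 hxy).ne']
  rw [abs_sub_comm x, abs_sub_comm (F x), h1, abs_mul]
  exact mul_le_mul_of_nonneg_right (hr c) (abs_nonneg _)

theorem abs_sub_le (hF : IsExpandingLift F d) (x y : ℝ) : |x - y| ≤ |F x - F y| := by
  simpa using hF.mul_abs_sub_le (fun x => (hF.one_lt_abs_deriv x).le) x y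

theorem injective (hF : IsExpandingLift F d) : Function.Injective F := fun x y h => by
  have := hF.abs_sub_le x y
  rw [h, sub_self, abs_zero] at this
  exact sub_eq_zero.1 (abs_nonpos_iff.1 this)

theorem degree_ne_zero (hF : IsExpandingLift F d) : d ≠ 0 := by
  rintro rfl
  have h := hF.map_int 1
  rw [Int.cast_zero, mul_zero, ← hF.map_zero] at h
  simpa using hF.injective h

theorem surjective (hF : IsExpandingLift F d) : Function.Surjective F := fun z => by
  obtain ⟨n, hn⟩ := exists_nat_ge |z|
  have hd : (1 : ℝ) ≤ |(d : ℝ)| := by exact_mod_cast Int.one_le_abs hF.degree_ne_zero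
  have hz := abs_le.1 hn
  have hn0 : (0 : ℝ) ≤ n := n.cast_nonneg
  have h1 := hF.map_int n
  have h2 := hF.map_int (-n)
  push_cast at h1 h2
  rcases le_abs.1 hd with h | h
  · exact mem_range_of_exists_le_of_exists_ge hF.continuous ⟨-n, by nlinarith⟩ ⟨n, by nlinarith⟩
  · exact mem_range_of_exists_le_of_exists_ge hF.continuous ⟨n, by nlinarith⟩ ⟨-n, by nlinarith⟩

theorem bijective (hF : IsExpandingLift F d) : Function.Bijective F := ⟨hF.injective, hF.surjective⟩

/-- The inverse of the lift. -/
noncomputable def inv (hF : IsExpandingLift F d) : ℝ → ℝ := (Equiv.ofBijective F hF.bijective).symm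

theorem apply_inv (hF : IsExpandingLift F d) (z : ℝ) : F (hF.inv z) = z :=
  (Equiv.ofBijective F hF.bijective).apply_symm_apply z

theorem inv_apply (hF : IsExpandingLift F d) (x : ℝ) : hF.inv (F x) = x :=
  (Equiv.ofBijective F hF.bijective).symm_apply_apply x

theorem mul_abs_inv_sub_le (hF : IsExpandingLift F d) {r : ℝ} (hr : ∀ x, r ≤ |deriv F x|)
    (x y : ℝ) : r * |hF.inv x - hF.inv y| ≤ |x - y| := by
  simpa [apply_inv] using hF.mul_abs_sub_le hr (hF.inv x) (hF.inv y)

theorem abs_inv_sub_le (hF : IsExpandingLift F d) (x y : ℝ) :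
    |hF.inv x - hF.inv y| ≤ |x - y| := by
  simpa [apply_inv] using hF.abs_sub_le (hF.inv x) (hF.inv y)

theorem continuous_inv (hF : IsExpandingLift F d) : Continuous hF.inv :=
  (LipschitzWith.of_dist_le_mul (K := 1) fun x y => by
    simpa [Real.dist_eq] using hF.abs_inv_sub_le x y).continuous

theorem inv_add_mul (hF : IsExpandingLift F d) (x : ℝ) (n : ℤ) :
    hF.inv (x + n * d) = hF.inv x + n := by
  apply hF.injective
  rw [hF.map_add_int, hF.apply_inv, hF.apply_inv]

theorem coe_inv_add_natAbs (hF : IsExpandingLift F d) (x : ℝ) :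
    ((hF.inv (x + d.natAbs) : ℝ) : UnitAddCircle) = (hF.inv x : ℝ) := by
  have h : ∃ n : ℤ, ((d.natAbs : ℕ) : ℝ) = n * d := by
    rcases Int.natAbs_eq d with h | h
    · refine ⟨1, ?_⟩
      rw [Int.cast_one, one_mul]
      conv_rhs => rw [h]
      simp
    · refine ⟨-1, ?_⟩
      conv_rhs => rw [h]
      simp
  obtain ⟨n, hn⟩ := h
  rw [hn, hF.inv_add_mul]
  simp

/-- The `C¹` circle map with a given lift. -/
def toC1CircleMap (hF : IsExpandingLift F d) : C1CircleMap where
  toFun := Function.Periodic.lift (f := fun x => (F x : UnitAddCircle)) (c := 1) fun x => by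
    simp [hF.map_add_one]
  exists_lift := ⟨F, hF.contDiff, fun _ => rfl⟩

theorem isLift_toC1CircleMap (hF : IsExpandingLift F d) : hF.toC1CircleMap.IsLift F := fun _ => rfl

end IsExpandingLift

namespace C1CircleMap

theorem IsLift.iterate {f : C1CircleMap} {F : ℝ → ℝ} (h : f.IsLift F) (n : ℕ) :
    (f.iterate n).IsLift F^[n] := fun x => by
  change f.toFun^[n] x = _
  induction n with
  | zero => rfl
  | succ n ih => rw [Function.iterate_succ_apply', Function.iterate_succ_apply', ih, h]

end C1CircleMap

theorem IsExpandingLift.mem_expandingMapsFixingZero {F : ℝ → ℝ} {d : ℤ} (hF : IsExpandingLift F d)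
    {f : C1CircleMap} (hf : f.IsLift F) : f ∈ expandingMapsFixingZero := by
  refine ⟨?_, ?_⟩
  · have h := hf 0
    rwa [hF.map_zero] at h
  obtain ⟨r, hr, hFr⟩ := hF.exists_rate
  -- The rate `r` is a minimum that may be attained, while the expansion must be strict; hence a
  -- rate strictly between `1` and `r`.
  refine ⟨(1 + r) / 2, by linarith, fun n hn x => ?_⟩
  induction x using QuotientAddGroup.induction_on with | H x => ?_
  have hd : ∀ n : ℕ, Differentiable ℝ F^[n] := fun n => hF.differentiable.iterate n
  change _ < |(f.iterate n).derivative (x : UnitAddCircle)|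
  rw [C1CircleMap.derivative_coe _ (hf.iterate n) (hF.continuous.iterate n), one_mul]
  induction n, hn using Nat.le_induction with
  | base =>
    rw [Function.iterate_one]
    linarith [hFr x]
  | succ n hn ih =>
    rw [Function.iterate_succ', deriv_comp x (hF.differentiable _) (hd n x), abs_mul, pow_succ',]
    have := hFr (F^[n] x)
    gcongr
    linarith

/-- An integer translate of any lift fixes the origin, and `F (x + 1) - F x` has zero derivative. Of
the expansion condition only `n = 1` is needed. With `IsExpandingLift.mem_expandingMapsFixingZero`
this reduces the space of maps to lifts with `|F'| > 1`. -/
theorem exists_isExpandingLift {f : C1CircleMap} (hf : f ∈ expandingMapsFixingZero) :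
    ∃ F : ℝ → ℝ, ∃ d : ℤ, IsExpandingLift F d ∧ f.IsLift F := by
  obtain ⟨h0, r, hr, hexp⟩ := hf
  have hl := f.isLift_lift
  obtain ⟨k, hk⟩ := (AddCircle.coe_eq_zero_iff (1 : ℝ)).1 ((hl 0).symm.trans h0)
  rw [zsmul_eq_mul, mul_one] at hk
  have hL : f.IsLift fun x => f.lift x - k := fun x => by
    rw [AddCircle.coe_sub, hl x, eq_comm, sub_eq_self]
    exact (AddCircle.coe_eq_zero_iff (1 : ℝ)).2 ⟨k, by simp⟩
  have h1 : ((f.lift 1 - k : ℝ) : UnitAddCircle) = 0 := by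
    rw [← hL 1, AddCircle.coe_period]
    exact h0
  obtain ⟨d, hd⟩ := (AddCircle.coe_eq_zero_iff (1 : ℝ)).1 h1
  rw [zsmul_eq_mul, mul_one] at hd
  have hc : ContDiff ℝ 1 fun x => f.lift x - k := f.contDiff_lift.sub contDiff_const
  refine ⟨fun x => f.lift x - k, d, ⟨hc, by simp [hk], fun x => ?_, fun x => ?_⟩, hL⟩
  · have hdiff : Differentiable ℝ f.lift := f.contDiff_lift.differentiable one_ne_zero
    have hdiff' : Differentiable ℝ fun y => f.lift (y + 1) :=
      hdiff.comp (differentiable_id.add_const (1 : ℝ))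
    have key := is_const_of_deriv_eq_zero (f := fun y => f.lift (y + 1) - f.lift y)
      (hdiff'.sub hdiff) (fun y => by
        rw [deriv_fun_sub (hdiff' y) (hdiff y), deriv_comp_add_const, f.periodic_deriv_lift y,
          sub_self]) x 0
    simp only [zero_add] at key
    linarith
  · rw [deriv_sub_const]
    have h := hexp 1 le_rfl (x : UnitAddCircle)
    have hit : (f.iterate 1).IsLift f.lift := by
      simpa using hl.iterate 1
    rw [C1CircleMap.derivative_coe _ hit f.contDiff_lift.continuous] at h
    rw [one_mul, pow_one] at h
    linarith

/-! ### The transfer operator and its duality with Lebesgue measure -/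

instance UnitAddCircle.isProbabilityMeasure_volume :
    IsProbabilityMeasure (volume : Measure UnitAddCircle) := ⟨UnitAddCircle.measure_univ⟩

theorem UnitAddCircle.integrable_iff_integrableOn {g : UnitAddCircle → ℝ} :
    Integrable g ↔ IntegrableOn (fun x : ℝ => g x) (Set.Ioc 0 1) := by
  have hmp : MeasurePreserving (AddCircle.measurableEquivIoc (1 : ℝ) 0) volume
      (Measure.comap Subtype.val volume) := AddCircle.measurePreserving_equivIoc 1
  have h := (hmp.symm _).integrable_comp_emb (AddCircle.measurableEquivIoc (1 : ℝ) 0).symm.measurableEmbedding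
    (g := g)
  rw [← h]
  have h2 := integrableOn_iff_comap_subtypeVal (μ := (volume : Measure ℝ)) (f := fun x : ℝ => g x)
    (measurableSet_Ioc (a := (0 : ℝ)) (b := 0 + 1))
  have h3 : IntegrableOn (fun x : ℝ => g x) (Set.Ioc 0 1) ↔
      IntegrableOn (fun x : ℝ => g x) (Set.Ioc 0 (0 + 1)) := by rw [zero_add]
  rw [h3, h2]
  rfl

theorem UnitAddCircle.intervalIntegral_eq_integral (g : UnitAddCircle → ℝ) :
    ∫ x in (0 : ℝ)..1, g x = ∫ y, g y := by
  simpa using UnitAddCircle.intervalIntegral_preimage 0 g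

namespace C1CircleMap

/-- The sum of `κ` over the fibre of `f` above `x`. -/
noncomputable def fiberSum (f : C1CircleMap) (κ : UnitAddCircle → ℝ) (x : UnitAddCircle) : ℝ :=
  ∑ᶠ y ∈ f ⁻¹' {x}, κ y

/-- The transfer operator of `f` with respect to Lebesgue measure. -/
noncomputable def transfer (f : C1CircleMap) (u : UnitAddCircle → ℝ) : UnitAddCircle → ℝ :=
  f.fiberSum fun y => u y / |f.derivative y|

end C1CircleMap

namespace IsExpandingLift

variable {F : ℝ → ℝ} {d : ℤ} {f : C1CircleMap}

theorem apply_coe_inv_add_natCast (hF : IsExpandingLift F d) (hf : f.IsLift F) (x : ℝ) (k : ℕ) :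
    f (hF.inv (x + k) : ℝ) = (x : UnitAddCircle) := by
  rw [hf, hF.apply_inv, AddCircle.coe_add, add_eq_left]
  exact (AddCircle.coe_eq_zero_iff (1 : ℝ)).2 ⟨k, by simp⟩

/-- The translates `x + k` represent the classes of `x + ℤ` modulo `d`, and `F⁻¹` turns a shift by
`d` into a shift by `1`. So each point of the fibre is met exactly once. -/
theorem fiberSum_coe (hF : IsExpandingLift F d) (hf : f.IsLift F) (κ : UnitAddCircle → ℝ) (x : ℝ) :
    f.fiberSum κ x = ∑ k ∈ Finset.range d.natAbs, κ (hF.inv (x + k) : ℝ) := by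
  have hd := hF.degree_ne_zero
  rw [C1CircleMap.fiberSum, ← finsum_mem_coe_finset]
  symm
  refine finsum_mem_eq_of_bijOn (fun k : ℕ => ((hF.inv (x + k) : ℝ) : UnitAddCircle))
    ⟨fun k _ => ?_, fun k hk l hl hkl => ?_, fun y hy => ?_⟩ fun _ _ => rfl
  · exact hF.apply_coe_inv_add_natCast hf x k
  · obtain ⟨n, hn⟩ := (AddCircle.coe_eq_zero_iff (1 : ℝ)).1 (by
      rw [AddCircle.coe_sub]; exact sub_eq_zero.2 hkl :
      ((hF.inv (x + k) - hF.inv (x + l) : ℝ) : UnitAddCircle) = 0)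
    rw [zsmul_eq_mul, mul_one] at hn
    have h1 : F (hF.inv (x + k)) = F (hF.inv (x + l) + n) := by rw [hn]; ring_nf
    rw [hF.map_add_int, hF.apply_inv, hF.apply_inv] at h1
    have h2 : (k : ℤ) = l + n * d := by
      have : (k : ℝ) = l + n * d := by linarith
      exact_mod_cast this
    simp only [Finset.coe_range, Set.mem_Iio] at hk hl
    have h3 : n = 0 := by
      by_contra hn0
      have : (d.natAbs : ℤ) ≤ |n * d| := by
        rw [abs_mul, Int.natCast_natAbs]
        exact le_mul_of_one_le_left (abs_nonneg _) (Int.one_le_abs hn0)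
      have h4 : |n * d| < (d.natAbs : ℤ) := by
        rw [abs_lt]
        constructor <;> omega
      omega
    rw [h3] at h2
    omega
  · induction y using QuotientAddGroup.induction_on with | H t => ?_
    have hy' : ((F t : ℝ) : UnitAddCircle) = x := by
      rw [← hf]; exact hy
    obtain ⟨i, hi⟩ := (AddCircle.coe_eq_zero_iff (1 : ℝ)).1 (by
      rw [AddCircle.coe_sub]; exact sub_eq_zero.2 hy' : ((F t - x : ℝ) : UnitAddCircle) = 0)
    rw [zsmul_eq_mul, mul_one] at hi
    -- `Int.emod` is nonnegative and less than `|d|` also for negative `d`, so both orientations are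
    -- covered.
    refine ⟨(i % d).toNat, ?_, ?_⟩
    · simp only [Finset.coe_range, Set.mem_Iio]
      have := Int.emod_lt i hd
      have := Int.emod_nonneg i hd
      omega
    · have h0 := Int.emod_nonneg i hd
      have h1 : (((i % d).toNat : ℕ) : ℝ) = i - (i / d : ℤ) * d := by
        have : (((i % d).toNat : ℕ) : ℤ) = i - (i / d) * d := by
          rw [Int.toNat_of_nonneg h0]
          have := Int.emod_add_ediv_mul i d
          linarith
        exact_mod_cast this
      have h2 : x + ((i % d).toNat : ℕ) = F t + (-(i / d) : ℤ) * d := by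
        rw [h1]; push_cast; linarith
      change ((hF.inv (x + ((i % d).toNat : ℕ)) : ℝ) : UnitAddCircle) = t
      rw [h2, ← hF.map_add_int, hF.inv_apply]
      simp [-Int.cast_neg]

theorem one_lt_abs_derivative (hF : IsExpandingLift F d) (hf : f.IsLift F) (y : UnitAddCircle) :
    1 < |f.derivative y| := by
  induction y using QuotientAddGroup.induction_on with | H t => ?_
  have := hF.one_lt_abs_deriv t
  rwa [← f.derivative_coe hf hF.continuous] at this

theorem continuous_fiberSum (hF : IsExpandingLift F d) (hf : f.IsLift F) {κ : UnitAddCircle → ℝ}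
    (hκ : Continuous κ) : Continuous (f.fiberSum κ) := by
  refine (QuotientAddGroup.isQuotientMap_mk _).continuous_iff.2 ?_
  have : f.fiberSum κ ∘ (QuotientAddGroup.mk : ℝ → UnitAddCircle) =
      fun x => ∑ k ∈ Finset.range d.natAbs, κ (hF.inv (x + k) : ℝ) :=
    funext fun x => hF.fiberSum_coe hf κ x
  rw [this]
  refine continuous_finsetSum _ fun k _ => hκ.comp ?_
  exact (AddCircle.continuous_mk' (1 : ℝ)).comp (hF.continuous_inv.comp (continuous_id.add_const _))

theorem transfer_coe (hF : IsExpandingLift F d) (hf : f.IsLift F) (u : UnitAddCircle → ℝ) (x : ℝ) :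
    f.transfer u x = ∑ k ∈ Finset.range d.natAbs,
      u (hF.inv (x + k) : ℝ) / |deriv F (hF.inv (x + k))| := by
  rw [C1CircleMap.transfer, hF.fiberSum_coe hf]
  simp only [f.derivative_coe hf hF.continuous]

theorem image_uIcc (hF : IsExpandingLift F d) : F '' Set.uIcc 0 1 = Set.uIcc 0 (d : ℝ) := by
  have h1 : F 1 = d := by simpa using hF.map_int 1
  have h0 := hF.map_zero
  ext z
  obtain ⟨y, rfl⟩ := hF.surjective z
  rw [hF.injective.mem_set_image]
  rcases hF.continuous.strictMono_of_inj hF.injective with h | h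
  · have hd : (0 : ℝ) ≤ d := by
      rw [← h0, ← h1]
      exact h.monotone zero_le_one
    rw [Set.uIcc_of_le zero_le_one, Set.uIcc_of_le hd, ← h0, ← h1, Set.mem_Icc, Set.mem_Icc,
      h.le_iff_le, h.le_iff_le, h0]
  · have hd : (d : ℝ) ≤ 0 := by
      rw [← h0, ← h1]
      exact h.antitone zero_le_one
    rw [Set.uIcc_of_le zero_le_one, Set.uIcc_of_ge hd, ← h0, ← h1, Set.mem_Icc, Set.mem_Icc,
      h.le_iff_ge, h.le_iff_ge, h0, and_comm]

/-- On the line, `Ψ` is the density of the image of `u` under `F`. The change of variables sends the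
integral of `u` over `[0, 1]` to that of `Ψ` over the interval between `0` and `d`; cutting a period
of length `|d|` into unit intervals gives the sum over the fibre. -/
theorem integrable_transfer_and_integral (hF : IsExpandingLift F d) (hf : f.IsLift F)
    {u : UnitAddCircle → ℝ} (hu : Integrable u) :
    Integrable (f.transfer u) ∧ ∫ x, f.transfer u x = ∫ x, u x := by
  set Ψ : ℝ → ℝ := fun z => u (hF.inv z : ℝ) / |deriv F (hF.inv z)| with hΨ
  have hΨF : ∀ y, |deriv F y| • Ψ (F y) = u y := fun y => by
    have := zero_lt_one.trans (hF.one_lt_abs_deriv y)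
    simp only [hΨ, hF.inv_apply, smul_eq_mul]
    field_simp
  have hder : ∀ x ∈ Set.uIcc (0 : ℝ) 1, HasDerivWithinAt F (deriv F x) (Set.uIcc 0 1) x :=
    fun x _ => (hF.differentiable x).hasDerivAt.hasDerivWithinAt
  have hint1 : IntegrableOn Ψ (Set.uIcc 0 (d : ℝ)) := by
    rw [← hF.image_uIcc, integrableOn_image_iff_integrableOn_abs_deriv_smul measurableSet_uIcc hder
      hF.injective.injOn]
    simp only [hΨF]
    rw [Set.uIcc_of_le zero_le_one, integrableOn_Icc_iff_integrableOn_Ioc]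
    exact UnitAddCircle.integrable_iff_integrableOn.1 hu
  have hval : ∫ z in Set.uIcc 0 (d : ℝ), Ψ z = ∫ x, u x := by
    rw [← hF.image_uIcc, integral_image_eq_integral_abs_deriv_smul measurableSet_uIcc hder
      hF.injective.injOn]
    simp only [hΨF]
    rw [Set.uIcc_of_le zero_le_one, integral_Icc_eq_integral_Ioc,
      ← intervalIntegral.integral_of_le zero_le_one, UnitAddCircle.intervalIntegral_eq_integral]
  -- Periodicity moves the interval `[d, 0]`, which occurs for negative degree, to `[0, |d|]`.
  have hper : Function.Periodic Ψ (d.natAbs : ℝ) := fun z => by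
    have h1 := hF.coe_inv_add_natAbs z
    have h2 : deriv F (hF.inv (z + d.natAbs)) = deriv F (hF.inv z) := by
      rw [← f.derivative_coe hf hF.continuous, ← f.derivative_coe hf hF.continuous, h1]
    simp only [hΨ, h1, h2]
  have hD : (d.natAbs : ℝ) ≠ 0 := by
    exact_mod_cast Int.natAbs_ne_zero.2 hF.degree_ne_zero
  have hcases : (d : ℝ) = d.natAbs ∨ (d : ℝ) = -d.natAbs := by
    rcases Int.natAbs_eq d with h | h
    · left
      calc (d : ℝ) = ((d.natAbs : ℤ) : ℝ) := congrArg _ h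
        _ = d.natAbs := Int.cast_natCast _
    · right
      calc (d : ℝ) = ((-(d.natAbs : ℤ) : ℤ) : ℝ) := congrArg _ h
        _ = -d.natAbs := by rw [Int.cast_neg, Int.cast_natCast]
  have hint2 : ∀ a b, IntervalIntegrable Ψ volume a b := by
    have h0 : IntervalIntegrable Ψ volume 0 d := by
      rw [intervalIntegrable_iff]
      exact hint1.mono_set Set.uIoc_subset_uIcc
    rcases hcases with h | h
    · exact hper.intervalIntegrable₀ hD (by rwa [← h])
    · refine hper.intervalIntegrable hD (t := -d.natAbs) ?_
      rw [neg_add_cancel, ← h]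
      exact h0.symm
  have hval2 : ∫ z in (0 : ℝ)..d.natAbs, Ψ z = ∫ x, u x := by
    rw [← hval]
    rcases hcases with h | h
    · rw [h, Set.uIcc_of_le (Nat.cast_nonneg _), integral_Icc_eq_integral_Ioc,
        ← intervalIntegral.integral_of_le (Nat.cast_nonneg _)]
    · have := hper.intervalIntegral_add_eq 0 (-d.natAbs)
      rw [zero_add, neg_add_cancel] at this
      rw [this, h, Set.uIcc_of_ge (by simp), integral_Icc_eq_integral_Ioc,
        ← intervalIntegral.integral_of_le (by simp)]
  have hsum : ∀ x : ℝ, f.transfer u x = ∑ k ∈ Finset.range d.natAbs, Ψ (x + k) :=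
    hF.transfer_coe hf u
  have hintk : ∀ k ∈ Finset.range d.natAbs,
      IntervalIntegrable (fun x => Ψ (x + k)) volume 0 1 := fun k _ => by
    have := (hint2 (0 + k) (1 + k)).comp_add_right k
    simpa using this
  constructor
  · rw [UnitAddCircle.integrable_iff_integrableOn, ← intervalIntegrable_iff_integrableOn_Ioc_of_le zero_le_one]
    simp only [hsum]
    exact (IntervalIntegrable.sum _ hintk).congr fun x _ => by simp
  · rw [← UnitAddCircle.intervalIntegral_eq_integral, ← hval2]
    simp only [hsum]
    rw [intervalIntegral.integral_finsetSum hintk]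
    simp only [intervalIntegral.integral_comp_add_right]
    have := intervalIntegral.sum_integral_adjacent_intervals (f := Ψ) (μ := volume)
      (a := fun k : ℕ => (k : ℝ)) (n := d.natAbs) fun k _ => hint2 _ _
    simp only [Nat.cast_zero] at this
    rw [← this]
    refine Finset.sum_congr rfl fun k _ => ?_
    push_cast
    rw [zero_add, add_comm]

end IsExpandingLift

theorem UnitAddCircle.induction {p : UnitAddCircle → Prop} (h : ∀ t : ℝ, p t) (x : UnitAddCircle) :
    p x := QuotientAddGroup.induction_on x h

namespace C1CircleMap

variable {f : C1CircleMap}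

section
variable (hf : f ∈ expandingMapsFixingZero)
include hf

theorem one_lt_abs_derivative (x : UnitAddCircle) : 1 < |f.derivative x| := by
  obtain ⟨F, d, hF, hl⟩ := exists_isExpandingLift hf
  exact hF.one_lt_abs_derivative hl x

theorem transfer_add (u v : UnitAddCircle → ℝ) :
    f.transfer (u + v) = f.transfer u + f.transfer v := by
  obtain ⟨F, d, hF, hl⟩ := exists_isExpandingLift hf
  refine funext (UnitAddCircle.induction fun x => ?_)
  simp only [Pi.add_apply, hF.transfer_coe hl, add_div, Finset.sum_add_distrib]

theorem transfer_mono {u v : UnitAddCircle → ℝ} (huv : u ≤ v) : f.transfer u ≤ f.transfer v := by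
  obtain ⟨F, d, hF, hl⟩ := exists_isExpandingLift hf
  refine UnitAddCircle.induction fun x => ?_
  simp only [hF.transfer_coe hl]
  gcongr
  exact huv _

/-- The transfer operator as a linear map. -/
noncomputable def transferₗ : (UnitAddCircle → ℝ) →ₗ[ℝ] (UnitAddCircle → ℝ) where
  toFun := f.transfer
  map_add' := transfer_add hf
  map_smul' c u := by
    obtain ⟨F, d, hF, hl⟩ := exists_isExpandingLift hf
    refine funext (UnitAddCircle.induction fun x => ?_)
    simp [hF.transfer_coe hl, Finset.mul_sum, mul_div_assoc]

theorem integrable_transfer {u : UnitAddCircle → ℝ} (hu : Integrable u) :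
    Integrable (f.transfer u) := by
  obtain ⟨F, d, hF, hl⟩ := exists_isExpandingLift hf
  exact (hF.integrable_transfer_and_integral hl hu).1

theorem integral_transfer {u : UnitAddCircle → ℝ} (hu : Integrable u) :
    ∫ x, f.transfer u x = ∫ x, u x := by
  obtain ⟨F, d, hF, hl⟩ := exists_isExpandingLift hf
  exact (hF.integrable_transfer_and_integral hl hu).2

/-- The factor `v ∘ f` is constant on each fibre of `f`. -/
theorem transfer_mul_comp (u v : UnitAddCircle → ℝ) :
    f.transfer (fun y => u y * v (f y)) = fun x => f.transfer u x * v x := by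
  obtain ⟨F, d, hF, hl⟩ := exists_isExpandingLift hf
  refine funext (UnitAddCircle.induction fun x => ?_)
  simp only [hF.transfer_coe hl, Finset.sum_mul]
  refine Finset.sum_congr rfl fun k _ => ?_
  rw [hF.apply_coe_inv_add_natCast hl]
  ring

theorem continuous_transfer {u : UnitAddCircle → ℝ} (hu : Continuous u) :
    Continuous (f.transfer u) := by
  obtain ⟨F, d, hF, hl⟩ := exists_isExpandingLift hf
  refine hF.continuous_fiberSum hl (hu.div f.derivative.continuous.abs fun y => ?_)
  linarith [hF.one_lt_abs_derivative hl y]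

end
end C1CircleMap

/-! ### The transfer operator on continuous functions -/

theorem ContinuousMap.nonneg_apply {X : Type*} [TopologicalSpace X] {φ : C(X, ℝ)} (h : 0 ≤ φ)
    (x : X) : 0 ≤ φ x := h x

theorem ContinuousMap.nonneg_of_forall {X : Type*} [TopologicalSpace X] {φ : C(X, ℝ)}
    (h : ∀ x, 0 ≤ φ x) : 0 ≤ φ := h

theorem UnitAddCircle.exists_coe_eq (x : UnitAddCircle) :
    ∃ s : ℝ, 0 ≤ s ∧ s < 1 ∧ (s : UnitAddCircle) = x := by
  have h : x ∈ ((↑) : ℝ → UnitAddCircle) '' Set.Ico 0 (0 + 1) := by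
    rw [AddCircle.coe_image_Ico_eq]
    trivial
  obtain ⟨s, hs, rfl⟩ := h
  exact ⟨s, hs.1, by simpa using hs.2, rfl⟩

/-- The transfer operator acting on continuous functions. -/
noncomputable def transferC (f : expandingMapsFixingZero) :
    C(UnitAddCircle, ℝ) →ₗ[ℝ] C(UnitAddCircle, ℝ) where
  toFun u := ⟨(f : C1CircleMap).transfer u, C1CircleMap.continuous_transfer f.2 u.continuous⟩
  map_add' u v := by
    ext x
    exact congrFun (C1CircleMap.transfer_add f.2 u v) x
  map_smul' c u := by
    ext x
    exact congrFun ((C1CircleMap.transferₗ f.2).map_smul c u) x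

@[simp] theorem transferC_apply (f : expandingMapsFixingZero) (u : C(UnitAddCircle, ℝ))
    (x : UnitAddCircle) : transferC f u x = (f : C1CircleMap).transfer u x := rfl

theorem UnitAddCircle.integrable_continuousMap (u : C(UnitAddCircle, ℝ)) :
    Integrable (u : UnitAddCircle → ℝ) :=
  u.continuous.integrable_of_hasCompactSupport (HasCompactSupport.of_compactSpace _)

section transferC

variable (f : expandingMapsFixingZero)

theorem transferC_mono {u v : C(UnitAddCircle, ℝ)} (h : u ≤ v) : transferC f u ≤ transferC f v :=
  fun x => C1CircleMap.transfer_mono f.2 h x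

theorem transferC_pow_mono (n : ℕ) {u v : C(UnitAddCircle, ℝ)} (h : u ≤ v) :
    (transferC f ^ n) u ≤ (transferC f ^ n) v := by
  induction n with
  | zero => exact h
  | succ n ih =>
    rw [pow_succ', Module.End.mul_apply, Module.End.mul_apply]
    exact transferC_mono f ih

theorem transferC_pow_nonneg (n : ℕ) {u : C(UnitAddCircle, ℝ)} (h : 0 ≤ u) :
    0 ≤ (transferC f ^ n) u := by
  simpa using transferC_pow_mono f n h

theorem integral_transferC (u : C(UnitAddCircle, ℝ)) : ∫ x, transferC f u x = ∫ x, u x :=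
  C1CircleMap.integral_transfer f.2 (UnitAddCircle.integrable_continuousMap u)

theorem integral_transferC_pow (n : ℕ) (u : C(UnitAddCircle, ℝ)) :
    ∫ x, (transferC f ^ n) u x = ∫ x, u x := by
  induction n with
  | zero => rfl
  | succ n ih => rw [pow_succ', Module.End.mul_apply, integral_transferC, ih]

theorem abs_transferC_pow_le (n : ℕ) (u : C(UnitAddCircle, ℝ)) (x : UnitAddCircle) :
    |(transferC f ^ n) u x| ≤ ‖u‖ * (transferC f ^ n) 1 x := by
  have h1 : u ≤ ‖u‖ • (1 : C(UnitAddCircle, ℝ)) := fun y => by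
    simpa using (le_abs_self _).trans (u.norm_coe_le_norm y)
  have h2 : -(‖u‖ • (1 : C(UnitAddCircle, ℝ))) ≤ u := fun y => by
    simpa using neg_le_of_abs_le (u.norm_coe_le_norm y)
  have h3 := transferC_pow_mono f n h1 x
  have h4 := transferC_pow_mono f n h2 x
  rw [map_neg, map_smul] at h4
  rw [map_smul] at h3
  exact abs_le.2 ⟨h4, h3⟩

/-- `ρ` is the density of an absolutely continuous invariant probability for which the iterates of
the transfer operator converge uniformly. -/
structure HasMixingDensity (f : expandingMapsFixingZero) (ρ : C(UnitAddCircle, ℝ)) : Prop where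
  pos : ∀ x, 0 < ρ x
  tendsto : ∀ u : C(UnitAddCircle, ℝ),
    Tendsto (fun n => (transferC f ^ n) u) atTop (𝓝 ((∫ x, u x) • ρ))

end transferC

/-! ### Log-Lipschitz cones and mixing for maps with Lipschitz derivative -/

/-- `φ` is log-Lipschitz with constant `a`. -/
def LogLip (a : ℝ) (φ : C(UnitAddCircle, ℝ)) : Prop :=
  ∀ x y : ℝ, φ (x : UnitAddCircle) ≤ Real.exp (a * |x - y|) * φ (y : UnitAddCircle)

namespace LogLip

variable {a b : ℝ} {φ : C(UnitAddCircle, ℝ)}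

theorem le_exp_mul (ha : 0 ≤ a) (h0 : 0 ≤ φ) (h : LogLip a φ) (x y : UnitAddCircle) :
    φ x ≤ Real.exp a * φ y := by
  obtain ⟨s, hs0, hs1, rfl⟩ := UnitAddCircle.exists_coe_eq x
  obtain ⟨t, ht0, ht1, rfl⟩ := UnitAddCircle.exists_coe_eq y
  refine (h s t).trans (mul_le_mul_of_nonneg_right (Real.exp_le_exp.2 ?_) (h0 _))
  refine mul_le_of_le_one_right ha (abs_le.2 ⟨?_, ?_⟩) <;> linarith

theorem le_exp_mul_integral (ha : 0 ≤ a) (h0 : 0 ≤ φ) (h : LogLip a φ) (x : UnitAddCircle) :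
    φ x ≤ Real.exp a * ∫ y, φ y := by
  have := integral_mono (μ := volume) (integrable_const (φ x))
    ((UnitAddCircle.integrable_continuousMap φ).const_mul (Real.exp a))
    fun y => le_exp_mul ha h0 h x y
  rwa [integral_const_mul, integral_const, probReal_univ, one_smul] at this

theorem integral_le_exp_mul (ha : 0 ≤ a) (h0 : 0 ≤ φ) (h : LogLip a φ) (x : UnitAddCircle) :
    ∫ y, φ y ≤ Real.exp a * φ x := by
  have := integral_mono (μ := volume) (UnitAddCircle.integrable_continuousMap φ)
    (integrable_const (Real.exp a * φ x)) fun y => le_exp_mul ha h0 h y x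
  rwa [integral_const, probReal_univ, one_smul] at this

theorem mono (hab : a ≤ b) (h0 : 0 ≤ φ) (h : LogLip a φ) : LogLip b φ := fun x y =>
  (h x y).trans (by have := h0 (y : UnitAddCircle); gcongr)

theorem one (ha : 0 ≤ a) : LogLip a 1 := fun x y => by
  simp only [ContinuousMap.one_apply, mul_one]
  exact Real.one_le_exp (by positivity)

/-- A log-Lipschitz function stays log-Lipschitz, with a worse constant, when a small constant is
subtracted. -/
theorem sub_const (hb : 0 < b) (ha : 0 ≤ a) (hab : a < b) (h : LogLip a φ) {c : ℝ}
    (hc : ∀ x, c ≤ (1 - a / b) * φ x) (hc0 : ∀ x, 0 ≤ φ x) :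
    LogLip b (φ - c • (1 : C(UnitAddCircle, ℝ))) := fun x y => by
  have ht : 0 ≤ |x - y| := abs_nonneg _
  -- Convexity of `exp` between `b |x - y|` and `0`, with weights `a / b` and `1 - a / b`. The
  -- weight of `0` is the fraction of `φ` that can be subtracted.
  have hcv : Real.exp (a * |x - y|) ≤ a / b * Real.exp (b * |x - y|) + (1 - a / b) := by
    have hab' : a / b ≤ 1 := (div_le_one hb).2 hab.le
    have := convexOn_exp.2 (Set.mem_univ (b * |x - y|)) (Set.mem_univ 0) (by positivity : 0 ≤ a / b)
      (by linarith : 0 ≤ 1 - a / b) (by ring)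
    simp only [smul_eq_mul, mul_zero, add_zero, Real.exp_zero, mul_one] at this
    rwa [← mul_assoc, div_mul_cancel₀ _ hb.ne'] at this
  have h1 := h x y
  have h2 := hc (y : UnitAddCircle)
  have h3 := hc0 (y : UnitAddCircle)
  have h4 : 1 ≤ Real.exp (b * |x - y|) := Real.one_le_exp (by positivity)
  simp only [ContinuousMap.sub_apply, ContinuousMap.smul_apply, ContinuousMap.one_apply, smul_eq_mul,
    mul_one]
  nlinarith [mul_le_mul_of_nonneg_right hcv h3, mul_le_mul_of_nonneg_right h2 (sub_nonneg.2 h4)]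

/-- Along an inverse branch, `φ` contributes `a` and `1 / |F'|` contributes `c` to the log-Lipschitz
constant, and the branch contracts distances by `r`. -/
theorem transferC {f : expandingMapsFixingZero} {F : ℝ → ℝ} {d : ℤ} (hF : IsExpandingLift F d)
    (hl : (f : C1CircleMap).IsLift F) {r c : ℝ} (hr : 1 < r) (hFr : ∀ x, r ≤ |deriv F x|)
    (hc : 0 ≤ c) (hFc : ∀ x y, |deriv F x - deriv F y| ≤ c * |x - y|) (ha : 0 ≤ a)
    (h0 : 0 ≤ φ) (h : LogLip a φ) : LogLip ((a + c) / r) (transferC f φ) := fun x y => by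
  simp only [transferC_apply]
  rw [hF.transfer_coe hl, hF.transfer_coe hl, Finset.mul_sum]
  refine Finset.sum_le_sum fun k _ => ?_
  set X := hF.inv (x + k)
  set Y := hF.inv (y + k)
  have hXY : |X - Y| ≤ |x - y| / r := by
    rw [le_div_iff₀' (by linarith)]
    simpa using hF.mul_abs_inv_sub_le hFr (x + k) (y + k)
  have hX := hF.one_lt_abs_deriv X
  have hY := hF.one_lt_abs_deriv Y
  -- Since `|F'| > 1`, the additive error `c |X - Y|` is at most the relative error `c |X - Y|`, and
  -- `1 + t ≤ exp t`.
  have h1 : |deriv F Y| ≤ Real.exp (c * |X - Y|) * |deriv F X| := by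
    have e1 := Real.add_one_le_exp (c * |X - Y|)
    have e2 := abs_sub_abs_le_abs_sub (deriv F Y) (deriv F X)
    have e3 := hFc Y X
    rw [abs_sub_comm Y X] at e3
    have e4 : 0 ≤ c * |X - Y| := by positivity
    nlinarith
  have h2 : Real.exp (a * |X - Y|) * Real.exp (c * |X - Y|) ≤
      Real.exp ((a + c) / r * |x - y|) := by
    rw [← Real.exp_add, ← add_mul, Real.exp_le_exp, div_mul_eq_mul_div, mul_div_assoc]
    gcongr
  rw [div_le_iff₀ (by linarith), mul_assoc]
  have h3 := h X Y
  have h4 := ContinuousMap.nonneg_apply h0 (Y : UnitAddCircle)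
  have h5 : Real.exp (a * |X - Y|) * φ Y * |deriv F Y| ≤
      Real.exp (a * |X - Y|) * φ Y * (Real.exp (c * |X - Y|) * |deriv F X|) := by gcongr
  have h6 : φ X ≤ Real.exp (a * |X - Y|) * Real.exp (c * |X - Y|) *
      (φ Y / |deriv F Y| * |deriv F X|) := by
    have : Real.exp (a * |X - Y|) * Real.exp (c * |X - Y|) * (φ Y / |deriv F Y| * |deriv F X|) =
      Real.exp (a * |X - Y|) * φ Y * (Real.exp (c * |X - Y|) * |deriv F X|) / |deriv F Y| := by
      ring
    rw [this, le_div_iff₀ (by linarith)]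
    exact (mul_le_mul_of_nonneg_right h3 (abs_nonneg _)).trans h5
  refine h6.trans (mul_le_mul_of_nonneg_right h2 (by positivity))

end LogLip

section contraction

variable {f : expandingMapsFixingZero} {a b : ℝ}

/-- A coupling argument. After one step both functions are log-Lipschitz with the smaller constant
`a`, hence at least `exp (-a) I`. The same constant `κ I` can be subtracted from both without
leaving the cone of constant `b`; it cancels in the difference and leaves two functions of integral
`(1 - κ) I`. -/
theorem abs_transferC_pow_sub_le (ha : 0 ≤ a) (hab : a < b)
    (hstep : ∀ φ : C(UnitAddCircle, ℝ), 0 ≤ φ → LogLip b φ → LogLip a (transferC f φ)) (n : ℕ) :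
    ∀ (φ ψ : C(UnitAddCircle, ℝ)) (I : ℝ), 0 ≤ φ → 0 ≤ ψ → LogLip b φ → LogLip b ψ →
      ∫ x, φ x = I → ∫ x, ψ x = I → ∀ x, |(transferC f ^ n) φ x - (transferC f ^ n) ψ x| ≤
        (1 - Real.exp (-a) * (1 - a / b)) ^ n * (Real.exp b * I) := by
  have hb : 0 < b := ha.trans_lt hab
  set κ := Real.exp (-a) * (1 - a / b) with hκ
  induction n with
  | zero =>
    intro φ ψ I h0 h0' h h' hI hI' x
    have h1 := h.le_exp_mul_integral hb.le h0 x
    have h2 := h'.le_exp_mul_integral hb.le h0' x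
    rw [hI] at h1
    rw [hI'] at h2
    have h3 := ContinuousMap.nonneg_apply h0 x
    have h4 := ContinuousMap.nonneg_apply h0' x
    simp only [pow_zero, Module.End.one_apply, one_mul]
    exact abs_le.2 ⟨by linarith, by linarith⟩
  | succ n ih =>
    have key : ∀ (φ : C(UnitAddCircle, ℝ)) (I : ℝ), 0 ≤ φ → LogLip b φ → ∫ x, φ x = I →
        0 ≤ transferC f φ - (κ * I) • (1 : C(UnitAddCircle, ℝ)) ∧
        LogLip b (transferC f φ - (κ * I) • (1 : C(UnitAddCircle, ℝ))) ∧
        ∫ x, (transferC f φ - (κ * I) • (1 : C(UnitAddCircle, ℝ))) x = (1 - κ) * I := by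
      intro φ I h0 h hI
      have h0L : 0 ≤ transferC f φ := by simpa using transferC_pow_nonneg f 1 h0
      have hL := hstep φ h0 h
      have hq : 0 < 1 - a / b := by rw [sub_pos, div_lt_one hb]; exact hab
      have hlow : ∀ x, κ * I ≤ (1 - a / b) * transferC f φ x := fun x => by
        have h1 := hL.integral_le_exp_mul ha h0L x
        rw [integral_transferC, hI] at h1
        have h2 : Real.exp (-a) * I ≤ transferC f φ x := by
          rw [Real.exp_neg, inv_mul_le_iff₀ (Real.exp_pos a)]
          exact h1
        rw [hκ]
        nlinarith
      refine ⟨ContinuousMap.nonneg_of_forall fun x => ?_, hL.sub_const hb ha hab hlow h0L, ?_⟩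
      · have h1 := hlow x
        have h2 := ContinuousMap.nonneg_apply h0L x
        have h3 : 0 ≤ a / b := by positivity
        simp only [ContinuousMap.sub_apply, ContinuousMap.smul_apply,
          ContinuousMap.one_apply, smul_eq_mul, mul_one]
        nlinarith
      · simp only [ContinuousMap.sub_apply, ContinuousMap.smul_apply,
          ContinuousMap.one_apply, smul_eq_mul, mul_one]
        rw [integral_sub (UnitAddCircle.integrable_continuousMap _) (integrable_const _),
          integral_transferC, hI, integral_const, probReal_univ, one_smul]
        ring
    intro φ ψ I h0 h0' h h' hI hI' x
    obtain ⟨k1, k2, k3⟩ := key φ I h0 h hI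
    obtain ⟨l1, l2, l3⟩ := key ψ I h0' h' hI'
    have := ih _ _ _ k1 l1 k2 l2 k3 l3 x
    rw [pow_succ, Module.End.mul_apply, Module.End.mul_apply]
    simp only [map_sub, map_smul, ContinuousMap.sub_apply, sub_sub_sub_cancel_right] at this
    refine this.trans (le_of_eq ?_)
    ring

end contraction

/-- Lipschitz functions on the circle. -/
def lipschitzSubalgebra : Subalgebra ℝ C(UnitAddCircle, ℝ) where
  carrier := {φ | ∃ K : ℝ, 0 ≤ K ∧ ∀ x y : ℝ, |φ (x : UnitAddCircle) - φ (y : UnitAddCircle)| ≤ K * |x - y|}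
  mul_mem' := by
    rintro φ ψ ⟨K, hK, h⟩ ⟨K', hK', h'⟩
    refine ⟨‖φ‖ * K' + ‖ψ‖ * K, by positivity, fun x y => ?_⟩
    have e : (φ * ψ) (x : UnitAddCircle) - (φ * ψ) (y : UnitAddCircle) =
      φ x * (ψ x - ψ y) + ψ y * (φ x - φ y) := by
      simp only [ContinuousMap.mul_apply]
      ring
    rw [e, add_mul, mul_assoc, mul_assoc]
    refine (abs_add_le _ _).trans ?_
    rw [abs_mul, abs_mul]
    have h1 : |φ x| ≤ ‖φ‖ := φ.norm_coe_le_norm x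
    have h2 : |ψ y| ≤ ‖ψ‖ := ψ.norm_coe_le_norm y
    gcongr
    exacts [h' x y, h x y]
  add_mem' := by
    rintro φ ψ ⟨K, hK, h⟩ ⟨K', hK', h'⟩
    refine ⟨K + K', by positivity, fun x y => ?_⟩
    have e : (φ + ψ) (x : UnitAddCircle) - (φ + ψ) (y : UnitAddCircle) =
      (φ x - φ y) + (ψ x - ψ y) := by
      simp only [ContinuousMap.add_apply]
      ring
    rw [e, add_mul]
    exact (abs_add_le _ _).trans (add_le_add (h x y) (h' x y))
  algebraMap_mem' c := ⟨0, le_rfl, fun x y => by simp⟩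

theorem lipschitzSubalgebra_separatesPoints : lipschitzSubalgebra.SeparatesPoints := by
  intro p q hpq
  refine ⟨fun x => dist x p, ⟨⟨fun x => dist x p, by fun_prop⟩, ⟨1, zero_le_one, fun x y => ?_⟩, rfl⟩,
    ?_⟩
  · rw [one_mul]
    refine (abs_dist_sub_le (x : UnitAddCircle) y p).trans ?_
    rw [dist_eq_norm, ← AddCircle.coe_sub]
    exact QuotientAddGroup.norm_mk_le_norm
  · simpa using (dist_pos.2 hpq.symm).ne

/-- Expanding maps with Lipschitz derivative have a mixing density. -/
theorem exists_hasMixingDensity {f : expandingMapsFixingZero} {F : ℝ → ℝ} {d : ℤ}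
    (hF : IsExpandingLift F d) (hl : (f : C1CircleMap).IsLift F) {c : ℝ}
    (hFc : ∀ x y, |deriv F x - deriv F y| ≤ c * |x - y|) : ∃ ρ, HasMixingDensity f ρ := by
  have hc : 0 ≤ c := by simpa using (abs_nonneg _).trans (hFc 0 1)
  obtain ⟨r, hr, hFr⟩ := hF.exists_rate
  -- The inequality means `c < b (r - 1)`: the cone of constant `b` is mapped strictly inside
  -- itself.
  obtain ⟨b, hb, hab⟩ : ∃ b, 0 < b ∧ (b + c) / r < b := by
    refine ⟨(c + 1) / (r - 1), div_pos (by linarith) (by linarith), ?_⟩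
    rw [div_lt_iff₀ (by linarith)]
    have : (c + 1) / (r - 1) * (r - 1) = c + 1 := div_mul_cancel₀ _ (by linarith)
    nlinarith
  set a := (b + c) / r with ha'
  have ha : 0 ≤ a := by positivity
  have hcontr := abs_transferC_pow_sub_le (f := f) ha hab
    fun φ h0 h => h.transferC hF hl hr hFr hc hFc hb.le h0
  set κ := Real.exp (-a) * (1 - a / b)
  have hq : 0 < 1 - a / b := by rw [sub_pos, div_lt_one hb]; exact hab
  have hκ0 : 0 < κ := mul_pos (Real.exp_pos _) hq
  have hκ1 : κ ≤ 1 := by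
    have h1 : Real.exp (-a) ≤ 1 := Real.exp_le_one_iff.2 (by linarith)
    have h2 : 1 - a / b ≤ 1 := by
      have : 0 ≤ a / b := by positivity
      linarith
    exact mul_le_one₀ h1 hq.le h2
  have hlim : Tendsto (fun n : ℕ => (1 - κ) ^ n) atTop (𝓝 0) :=
    tendsto_pow_atTop_nhds_zero_of_lt_one (by linarith) (by linarith)
  have h01 : (0 : C(UnitAddCircle, ℝ)) ≤ 1 := fun _ => by simp
  have hone : ∫ x, (1 : C(UnitAddCircle, ℝ)) x = 1 := by simp
  have hconeL : ∀ m : ℕ, 0 ≤ (transferC f ^ m) 1 ∧ LogLip b ((transferC f ^ m) 1) := by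
    intro m
    refine ⟨transferC_pow_nonneg f m h01, ?_⟩
    induction m with
    | zero => exact LogLip.one hb.le
    | succ m ih =>
      rw [pow_succ', Module.End.mul_apply]
      have h0 := transferC_pow_nonneg f m h01
      exact (ih.transferC hF hl hr hFr hc hFc hb.le h0).mono hab.le
        (by simpa using transferC_mono f h0)
  have hcauchy : CauchySeq fun n => (transferC f ^ n) (1 : C(UnitAddCircle, ℝ)) := by
    refine cauchySeq_of_le_tendsto_0' (fun n => (1 - κ) ^ n * (Real.exp b * 1)) (fun n m hnm => ?_) ?_
    · obtain ⟨k, rfl⟩ := Nat.exists_eq_add_of_le hnm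
      rw [dist_eq_norm]
      refine (ContinuousMap.norm_le _ (mul_nonneg (pow_nonneg (by linarith) _) (by positivity))).2
        fun x => ?_
      rw [pow_add, Module.End.mul_apply]
      exact hcontr n _ _ 1 h01 (hconeL k).1 (LogLip.one hb.le) (hconeL k).2 hone
        ((integral_transferC_pow f k 1).trans hone) x
    · simpa using hlim.mul_const (Real.exp b * 1)
  obtain ⟨ρ, hρ⟩ := cauchySeq_tendsto_of_complete hcauchy
  have hρx : ∀ x, Tendsto (fun n => (transferC f ^ n) 1 x) atTop (𝓝 (ρ x)) := fun x =>
    ((continuous_eval_const x).tendsto ρ).comp hρ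
  have hupper : ∀ n x, (transferC f ^ n) 1 x ≤ Real.exp b := fun n x => by
    have := (hconeL n).2.le_exp_mul_integral hb.le (hconeL n).1 x
    rwa [integral_transferC_pow, hone, mul_one] at this
  have hlower : ∀ n x, Real.exp (-b) ≤ (transferC f ^ n) 1 x := fun n x => by
    have := (hconeL n).2.integral_le_exp_mul hb.le (hconeL n).1 x
    rw [integral_transferC_pow, hone] at this
    rw [Real.exp_neg, inv_le_iff_one_le_mul₀' (Real.exp_pos _)]
    exact this
  refine ⟨ρ, fun x => (Real.exp_pos (-b)).trans_le (ge_of_tendsto' (hρx x) fun n => hlower n x),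
    fun u => ?_⟩
  have hlog : ∀ φ : C(UnitAddCircle, ℝ), 0 ≤ φ → LogLip b φ →
      Tendsto (fun n => (transferC f ^ n) φ) atTop (𝓝 ((∫ x, φ x) • ρ)) := by
    intro φ h0 h
    have hI : 0 ≤ ∫ x, φ x := integral_nonneg h0
    have h1 : Tendsto (fun n => (transferC f ^ n) φ - (∫ x, φ x) • (transferC f ^ n) 1) atTop (𝓝 0) := by
      refine squeeze_zero_norm (a := fun n => (1 - κ) ^ n * (Real.exp b * ∫ x, φ x)) (fun n => ?_) ?_
      · refine (ContinuousMap.norm_le _ (mul_nonneg (pow_nonneg (by linarith) _) (by positivity))).2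
          fun x => ?_
        have hIl : LogLip b ((∫ x, φ x) • (1 : C(UnitAddCircle, ℝ))) := fun x y => by
          have := mul_le_mul_of_nonneg_left (LogLip.one hb.le x y) hI
          simp only [ContinuousMap.smul_apply, ContinuousMap.one_apply, smul_eq_mul] at this ⊢
          linarith
        rw [← map_smul]
        exact hcontr n _ _ _ h0 (smul_nonneg hI h01) h hIl rfl
          (by simp) x
      · simpa using hlim.mul_const (Real.exp b * ∫ x, φ x)
    have h2 := h1.add (hρ.const_smul (∫ x, φ x))
    simpa using h2
  have hlip : ∀ φ ∈ lipschitzSubalgebra,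
      Tendsto (fun n => (transferC f ^ n) φ) atTop (𝓝 ((∫ x, φ x) • ρ)) := by
    rintro φ ⟨K, hK, h⟩
    -- Adding a constant makes a Lipschitz function positive enough to be log-Lipschitz: above the
    -- level `K / b`, Lipschitz constant `K` gives logarithmic constant `b`. Convergence for the
    -- added constant is already known.
    set M := ‖φ‖ + K / b + 1 with hM
    have hφM : ∀ x, K / b + 1 ≤ (φ + M • (1 : C(UnitAddCircle, ℝ))) x := fun x => by
      have := neg_le_of_abs_le (φ.norm_coe_le_norm x)
      simp only [ContinuousMap.add_apply, ContinuousMap.smul_apply, ContinuousMap.one_apply,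
        smul_eq_mul, mul_one]
      linarith
    have hKb : 0 ≤ K / b := by positivity
    have h0 : 0 ≤ φ + M • (1 : C(UnitAddCircle, ℝ)) := ContinuousMap.nonneg_of_forall fun x => by
      have := hφM x
      linarith
    have hl : LogLip b (φ + M • (1 : C(UnitAddCircle, ℝ))) := fun x y => by
      have h1 := le_of_abs_le (h x y)
      have h2 := hφM y
      have h3 := Real.add_one_le_exp (b * |x - y|)
      have h4 : K ≤ b * (φ + M • (1 : C(UnitAddCircle, ℝ))) y := by
        have : K = b * (K / b) := by field_simp
        rw [this]
        gcongr
        linarith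
      have h5 : (φ + M • (1 : C(UnitAddCircle, ℝ))) x =
          (φ + M • (1 : C(UnitAddCircle, ℝ))) y + (φ x - φ y) := by
        simp only [ContinuousMap.add_apply, ContinuousMap.smul_apply, ContinuousMap.one_apply]
        ring
      have h6 : 0 ≤ (φ + M • (1 : C(UnitAddCircle, ℝ))) y := h0 y
      rw [h5]
      nlinarith [mul_le_mul_of_nonneg_right h4 (abs_nonneg (x - y)), mul_le_mul_of_nonneg_right h3 h6]
    have h1 := (hlog _ h0 hl).sub (hρ.const_smul M)
    have e1 : ∀ n, (transferC f ^ n) (φ + M • (1 : C(UnitAddCircle, ℝ))) - M • (transferC f ^ n) 1 =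
        (transferC f ^ n) φ := fun n => by
      rw [map_add, map_smul, add_sub_cancel_right]
    have e2 : (∫ x, (φ + M • (1 : C(UnitAddCircle, ℝ))) x) = (∫ x, φ x) + M := by
      simp only [ContinuousMap.add_apply, ContinuousMap.smul_apply, ContinuousMap.one_apply,
        smul_eq_mul, mul_one]
      rw [integral_add (UnitAddCircle.integrable_continuousMap _) (integrable_const _),
        integral_const, probReal_univ, one_smul]
    simp only [e1] at h1
    rw [e2, add_smul, add_sub_cancel_right] at h1
    exact h1
  rw [Metric.tendsto_atTop]
  intro ε hε
  have hC : 0 < Real.exp b + ‖ρ‖ + 1 := by positivity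
  -- Stone-Weierstrass. The error of the approximation survives all iterates, because `Lⁿ 1 ≤ exp b`
  -- bounds the operators uniformly in `n`.
  obtain ⟨⟨v, hvA⟩, hv⟩ := ContinuousMap.exists_mem_subalgebra_near_continuousMap_of_separatesPoints
    lipschitzSubalgebra lipschitzSubalgebra_separatesPoints u (ε / 2 / (Real.exp b + ‖ρ‖ + 1))
    (by positivity)
  obtain ⟨n₀, hn₀⟩ := Metric.tendsto_atTop.1 (hlip v hvA) (ε / 2) (by positivity)
  refine ⟨n₀, fun n hn => ?_⟩
  have h1 := hn₀ n hn
  rw [dist_eq_norm] at h1 ⊢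
  have h2 : ‖(transferC f ^ n) (u - v)‖ ≤ ‖u - v‖ * Real.exp b :=
    (ContinuousMap.norm_le _ (by positivity)).2 fun x =>
      (abs_transferC_pow_le f n (u - v) x).trans (by gcongr; exact hupper n x)
  have h3 : ‖((∫ x, v x) - ∫ x, u x) • ρ‖ ≤ ‖u - v‖ * ‖ρ‖ := by
    rw [norm_smul]
    gcongr
    rw [← integral_sub (UnitAddCircle.integrable_continuousMap _)
      (UnitAddCircle.integrable_continuousMap _)]
    have := norm_integral_le_of_norm_le_const (μ := (volume : Measure UnitAddCircle))
      (f := fun x => v x - u x) (C := ‖u - v‖) (ae_of_all _ fun x => by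
        rw [norm_sub_rev]
        exact (u - v).norm_coe_le_norm x)
    simpa using this
  have h4 : (transferC f ^ n) u - (∫ x, u x) • ρ = (transferC f ^ n) (u - v) +
      ((transferC f ^ n) v - (∫ x, v x) • ρ) + ((∫ x, v x) - ∫ x, u x) • ρ := by
    rw [map_sub, sub_smul]
    abel
  have h5 : ‖u - v‖ * (Real.exp b + ‖ρ‖ + 1) < ε / 2 := by
    rw [← lt_div_iff₀ hC, norm_sub_rev]
    exact hv
  rw [h4]
  refine (norm_add₃_le).trans_lt ?_
  nlinarith [norm_nonneg (u - v)]

/-! ### Duality with composition, and uniform estimates from mixing -/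

theorem setIntegral_le_add_of_subset_union {X : Type*} [MeasurableSpace X] {μ : Measure X}
    {g : X → ℝ} (hg : Integrable g μ) (h0 : ∀ x, 0 ≤ g x) {s a b : Set X}
    (ha : MeasurableSet a) (hb : MeasurableSet b) (h : s ⊆ a ∪ b) :
    ∫ x in s, g x ∂μ ≤ (∫ x in a, g x ∂μ) + ∫ x in b, g x ∂μ := by
  have h1 : ∫ x in s, g x ∂μ ≤ ∫ x in a ∪ b \ a, g x ∂μ :=
    setIntegral_mono_set hg.integrableOn (ae_of_all _ h0) (by
      rw [Set.union_sdiff_self]; exact h.eventuallyLE)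
  rw [setIntegral_union Set.disjoint_sdiff_right (hb.diff ha) hg.integrableOn hg.integrableOn] at h1
  have h2 : ∫ x in b \ a, g x ∂μ ≤ ∫ x in b, g x ∂μ :=
    setIntegral_mono_set hg.integrableOn (ae_of_all _ h0) Set.sdiff_subset.eventuallyLE
  linarith

theorem UnitAddCircle.integrable_mul (u v : C(UnitAddCircle, ℝ)) : Integrable fun x => u x * v x :=
  UnitAddCircle.integrable_continuousMap (u * v)

/-- The function `u ∘ fⁿ`. -/
def compIterate (f : expandingMapsFixingZero) (n : ℕ) (u : C(UnitAddCircle, ℝ)) :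
    C(UnitAddCircle, ℝ) :=
  u.comp ⟨(f : C1CircleMap).toFun^[n], (f : C1CircleMap).toContinuousMap.continuous.iterate n⟩

@[simp] theorem compIterate_apply (f : expandingMapsFixingZero) (n : ℕ) (u : C(UnitAddCircle, ℝ))
    (x : UnitAddCircle) : compIterate f n u x = u ((f : C1CircleMap).toFun^[n] x) := rfl

theorem transferC_pow_mul_compIterate (f : expandingMapsFixingZero) (n : ℕ) :
    ∀ u v : C(UnitAddCircle, ℝ), (transferC f ^ n) (u * compIterate f n v) =
      (transferC f ^ n) u * v := by
  induction n with
  | zero => intro u v; rfl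
  | succ n ih =>
    intro u v
    have h1 : compIterate f (n + 1) v = compIterate f n (compIterate f 1 v) := by
      ext x
      simp [Function.iterate_succ_apply']
    rw [pow_succ', Module.End.mul_apply, Module.End.mul_apply, h1, ih]
    ext x
    exact congrFun (C1CircleMap.transfer_mul_comp f.2 ((transferC f ^ n) u) v) x

/-- Duality converts integrals against `v ∘ fⁿ` into integrals against `Lⁿ u`, where mixing applies.
-/
theorem integral_mul_compIterate (f : expandingMapsFixingZero) (n : ℕ) (u v : C(UnitAddCircle, ℝ)) :
    ∫ x, u x * compIterate f n v x = ∫ x, (transferC f ^ n) u x * v x := by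
  have := integral_transferC_pow f n (u * compIterate f n v)
  rw [transferC_pow_mul_compIterate] at this
  exact this.symm

theorem integral_compIterate (f : expandingMapsFixingZero) (n : ℕ) (v : C(UnitAddCircle, ℝ)) :
    ∫ x, compIterate f n v x = ∫ x, (transferC f ^ n) 1 x * v x := by
  simpa using integral_mul_compIterate f n 1 v

theorem volume_real_closedBall_le {κ : ℝ} (hκ : 0 ≤ κ) :
    volume.real (Metric.closedBall (0 : UnitAddCircle) κ) ≤ 2 * κ := by
  rw [Measure.real, AddCircle.volume_closedBall]
  refine ENNReal.toReal_le_of_le_ofReal (by linarith) (ENNReal.ofReal_le_ofReal (min_le_right _ _))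

theorem le_volume_real_closedBall {κ : ℝ} (hκ : 2 * κ ≤ 1) :
    2 * κ ≤ volume.real (Metric.closedBall (0 : UnitAddCircle) κ) := by
  rw [Measure.real, AddCircle.volume_closedBall, min_eq_right hκ]
  rcases le_total 0 (2 * κ) with h | h
  · rw [ENNReal.toReal_ofReal h]
  · exact h.trans ENNReal.toReal_nonneg

namespace HasMixingDensity

variable {f : expandingMapsFixingZero} {ρ : C(UnitAddCircle, ℝ)}

theorem tendsto_one (h : HasMixingDensity f ρ) :
    Tendsto (fun n => (transferC f ^ n) 1) atTop (𝓝 ρ) := by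
  simpa using h.tendsto 1

theorem exists_le (h : HasMixingDensity f ρ) :
    ∃ C : ℝ, 0 < C ∧ ∀ n x, (transferC f ^ n) 1 x ≤ C := by
  obtain ⟨C, hC⟩ := h.tendsto_one.norm.bddAbove_range
  refine ⟨max C 1, by positivity, fun n x => ?_⟩
  exact ((le_abs_self _).trans (((transferC f ^ n) 1).norm_coe_le_norm x)).trans
    ((hC ⟨n, rfl⟩).trans (le_max_left _ _))

theorem exists_pos_le (h : HasMixingDensity f ρ) : ∃ p : ℝ, 0 < p ∧ ∀ x, p ≤ ρ x := by
  obtain ⟨x₀, -, h₀⟩ := isCompact_univ.exists_isMinOn (Set.univ_nonempty (α := UnitAddCircle))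
    ρ.continuous.continuousOn
  exact ⟨ρ x₀, h.pos x₀, fun x => h₀ (Set.mem_univ x)⟩

/-- For large times, `Lⁿ θ` is proportional to `Lⁿ 1` up to a small relative error. -/
theorem eventually_abs_sub_le (h : HasMixingDensity f ρ) {ε : ℝ} (hε : 0 < ε)
    (θ : C(UnitAddCircle, ℝ)) : ∀ᶠ n in atTop, ∀ x,
      |(transferC f ^ n) θ x - (∫ y, θ y) * (transferC f ^ n) 1 x| ≤ ε * (transferC f ^ n) 1 x := by
  obtain ⟨p, hp, hpρ⟩ := h.exists_pos_le
  have h1 : Tendsto (fun n => (transferC f ^ n) θ - (∫ y, θ y) • (transferC f ^ n) 1) atTop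
      (𝓝 0) := by
    simpa using (h.tendsto θ).sub (h.tendsto_one.const_smul (∫ y, θ y))
  have h2 := (Metric.tendsto_atTop.1 h.tendsto_one) (p / 2) (by positivity)
  obtain ⟨n₁, h2⟩ := h2
  have h3 := (Metric.tendsto_atTop.1 h1) (ε * (p / 2)) (by positivity)
  obtain ⟨n₂, h3⟩ := h3
  filter_upwards [eventually_ge_atTop n₁, eventually_ge_atTop n₂] with n hn1 hn2 x
  have e1 := (ContinuousMap.dist_apply_le_dist x).trans (h2 n hn1).le
  have e2 := (ContinuousMap.dist_apply_le_dist x).trans (h3 n hn2).le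
  rw [Real.dist_eq] at e1 e2
  have e3 := hpρ x
  have e4 := (abs_le.1 e1).1
  simp only [ContinuousMap.sub_apply, ContinuousMap.smul_apply, smul_eq_mul,
    ContinuousMap.zero_apply, sub_zero] at e2
  refine e2.trans ?_
  gcongr
  linarith

theorem eventually_half_le (h : HasMixingDensity f ρ) {p : ℝ} (hp : 0 < p) (hpρ : ∀ x, p ≤ ρ x) :
    ∀ᶠ n in atTop, ∀ x, p / 2 ≤ (transferC f ^ n) 1 x := by
  obtain ⟨n₁, h2⟩ := (Metric.tendsto_atTop.1 h.tendsto_one) (p / 2) (by positivity)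
  filter_upwards [eventually_ge_atTop n₁] with n hn1 x
  have e1 := (ContinuousMap.dist_apply_le_dist x).trans (h2 n hn1).le
  rw [Real.dist_eq] at e1
  have e3 := hpρ x
  have e4 := (abs_le.1 e1).1
  linarith

end HasMixingDensity

/-! ### Spikes: equidistributed, slowly varying functions with tiny support -/

section spike

/-- The exponent weights `q ^ |i - T|`. -/
noncomputable def tentWeight (q : ℝ) (T i : ℕ) : ℝ := q ^ ((i - T) + (T - i))

theorem tentWeight_succ_le {q ε : ℝ} (hε : 0 ≤ ε) (hq0 : 0 < q) (hq : q * (1 + ε) = 1) (T i : ℕ) :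
    tentWeight q T (i + 1) ≤ (1 + ε) * tentWeight q T i ∧
      tentWeight q T i ≤ (1 + ε) * tentWeight q T (i + 1) := by
  have hq1 : q ≤ 1 := by nlinarith
  have key : ∀ n : ℕ, (1 + ε) * q ^ (n + 1) = q ^ n ∧ q ^ (n + 1) ≤ (1 + ε) * q ^ n := fun n => by
    have h1 : 0 < q ^ n := by positivity
    refine ⟨by rw [pow_succ]; linear_combination q ^ n * hq, ?_⟩
    rw [pow_succ]
    nlinarith
  unfold tentWeight
  rcases le_or_gt T i with h | h
  · have e : (i + 1 - T) + (T - (i + 1)) = (i - T) + (T - i) + 1 := by omega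
    rw [e]
    exact ⟨(key _).2, (key _).1.ge⟩
  · have e : (i - T) + (T - i) = (i + 1 - T) + (T - (i + 1)) + 1 := by omega
    rw [e]
    exact ⟨(key _).1.ge, (key _).2⟩

/-- Weighted sums along an orbit with slowly varying weights change slowly under a shift. -/
theorem sum_tentWeight_shift_le {q ε : ℝ} (hε : 0 ≤ ε) (hq0 : 0 < q) (hq : q * (1 + ε) = 1) (T : ℕ)
    (a : ℕ → ℝ) (ha0 : ∀ i, 0 ≤ a i) (ha1 : ∀ i, a i ≤ 1) :
    ∑ i ∈ Finset.range (2 * T + 1), tentWeight q T i * a (i + 1) ≤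
      (1 + ε) * (∑ i ∈ Finset.range (2 * T + 1), tentWeight q T i * a i) + q ^ T ∧
    ∑ i ∈ Finset.range (2 * T + 1), tentWeight q T i * a i ≤
      (1 + ε) * (∑ i ∈ Finset.range (2 * T + 1), tentWeight q T i * a (i + 1)) + q ^ T := by
  have hw : ∀ i, 0 ≤ tentWeight q T i := fun i => by unfold tentWeight; positivity
  have e0 : tentWeight q T 0 = q ^ T := by simp [tentWeight]
  have e1 : tentWeight q T (2 * T) = q ^ T := by
    unfold tentWeight
    congr 1
    omega
  have hqT : 0 ≤ q ^ T := by positivity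
  constructor
  · rw [Finset.sum_range_succ, Finset.sum_range_succ' (fun i => tentWeight q T i * a i), e1, e0,
      mul_add, Finset.mul_sum]
    have h1 : ∑ i ∈ Finset.range (2 * T), tentWeight q T i * a (i + 1) ≤
        ∑ i ∈ Finset.range (2 * T), (1 + ε) * (tentWeight q T (i + 1) * a (i + 1)) := by
      refine Finset.sum_le_sum fun i _ => ?_
      rw [← mul_assoc]
      exact mul_le_mul_of_nonneg_right (tentWeight_succ_le hε hq0 hq T i).2 (ha0 _)
    have h2 : q ^ T * a (2 * T + 1) ≤ q ^ T := mul_le_of_le_one_right hqT (ha1 _)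
    have h3 : 0 ≤ (1 + ε) * (q ^ T * a 0) := by have := ha0 0; positivity
    linarith
  · rw [Finset.sum_range_succ', Finset.sum_range_succ (fun i => tentWeight q T i * a (i + 1)), e1, e0,
      mul_add, Finset.mul_sum]
    have h1 : ∑ i ∈ Finset.range (2 * T), tentWeight q T (i + 1) * a (i + 1) ≤
        ∑ i ∈ Finset.range (2 * T), (1 + ε) * (tentWeight q T i * a (i + 1)) := by
      refine Finset.sum_le_sum fun i _ => ?_
      rw [← mul_assoc]
      exact mul_le_mul_of_nonneg_right (tentWeight_succ_le hε hq0 hq T i).1 (ha0 _)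
    have h2 : q ^ T * a 0 ≤ q ^ T := mul_le_of_le_one_right hqT (ha1 _)
    have h3 : 0 ≤ (1 + ε) * (q ^ T * a (2 * T + 1)) := by have := ha0 (2 * T + 1); positivity
    linarith

/-- A tent function at the origin, together with a plateau above its support. -/
theorem exists_bump {κ : ℝ} (hκ : 0 < κ) (hκ1 : κ ≤ 1) : ∃ χ χ' : C(UnitAddCircle, ℝ),
    (∀ x, 0 ≤ χ x) ∧ (∀ x, χ x ≤ 1) ∧ (∀ x, 0 ≤ χ' x) ∧ (∀ x, χ x ≠ 0 → 1 ≤ χ' x) ∧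
      κ / 2 ≤ ∫ x, χ x ∧ ∫ x, χ' x ≤ 4 * κ := by
  refine ⟨⟨fun x => max 0 (1 - ‖x‖ / κ), by fun_prop⟩,
    ⟨fun x => max 0 (min 1 (2 - ‖x‖ / κ)), by fun_prop⟩, fun x => le_max_left _ _, fun x => ?_,
    fun x => le_max_left _ _, fun x hx => ?_, ?_, ?_⟩
  · have : 0 ≤ ‖x‖ / κ := by positivity
    simpa using this
  · simp only [ContinuousMap.coe_mk] at hx ⊢
    have h1 : 0 < 1 - ‖x‖ / κ := by
      by_contra h
      exact hx (max_eq_left (not_lt.1 h))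
    exact le_max_of_le_right (le_min le_rfl (by linarith))
  · have h1 : (κ / 2) ≤ ∫ x in Metric.closedBall (0 : UnitAddCircle) (κ / 2), (1 / 2 : ℝ) := by
      rw [setIntegral_const, smul_eq_mul]
      have := le_volume_real_closedBall (κ := κ / 2) (by linarith)
      linarith
    refine h1.trans ?_
    have hint := UnitAddCircle.integrable_continuousMap ⟨fun x : UnitAddCircle => max 0 (1 - ‖x‖ / κ), by fun_prop⟩
    refine (setIntegral_mono_on (by simp) hint.integrableOn Metric.isClosed_closedBall.measurableSet
      fun x hx => ?_).trans (setIntegral_le_integral hint (ae_of_all _ fun x => le_max_left _ _))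
    rw [mem_closedBall_zero_iff] at hx
    refine le_max_of_le_right ?_
    have : ‖x‖ / κ ≤ 1 / 2 := by
      rw [div_le_iff₀ hκ]
      linarith
    linarith
  · have hint := UnitAddCircle.integrable_continuousMap
      ⟨fun x : UnitAddCircle => max 0 (min 1 (2 - ‖x‖ / κ)), by fun_prop⟩
    have h1 : ∫ x : UnitAddCircle, max 0 (min 1 (2 - ‖x‖ / κ)) ≤
        ∫ x, (Metric.closedBall (0 : UnitAddCircle) (2 * κ)).indicator (fun _ => (1 : ℝ)) x := by
      refine integral_mono hint
        ((integrable_const _).indicator Metric.isClosed_closedBall.measurableSet) fun x => ?_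
      by_cases hx : x ∈ Metric.closedBall (0 : UnitAddCircle) (2 * κ)
      · rw [Set.indicator_of_mem hx]
        exact max_le zero_le_one (min_le_left _ _)
      · rw [Set.indicator_of_notMem hx]
        rw [mem_closedBall_zero_iff, not_le, ← lt_div_iff₀ hκ] at hx
        exact max_le le_rfl ((min_le_right _ _).trans (by linarith))
    refine h1.trans ?_
    rw [integral_indicator_const _ Metric.isClosed_closedBall.measurableSet, smul_eq_mul, mul_one]
    linarith [volume_real_closedBall_le (κ := 2 * κ) (by linarith)]

/-- `Y` is a normalised sum of `χ ∘ f^(n₀ + i)`, `i ≤ 2T`, with weights `q ^ |i - T|`, where `χ` is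
a narrow bump. Composing with `f` shifts the index, which changes the weights by at most the factor
`1 + ε`, apart from the end terms. The delay `n₀` gives equidistribution: `Lⁿ θ` is then
proportional to `Lⁿ 1` up to a relative error `ε`, whatever the bump. A narrow bump makes the
support small. -/
theorem HasMixingDensity.exists_spike_of_finset {f : expandingMapsFixingZero}
    {ρ : C(UnitAddCircle, ℝ)} (h : HasMixingDensity f ρ) {ε : ℝ} (hε : 0 < ε)
    (Θ : Finset C(UnitAddCircle, ℝ)) : ∃ Y : C(UnitAddCircle, ℝ), (∀ x, 0 ≤ Y x) ∧ ∫ x, Y x = 1 ∧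
      (∀ θ ∈ Θ, |(∫ x, θ x * Y x) - ∫ x, θ x| ≤ ε) ∧ volume.real {x | Y x ≠ 0} ≤ ε ∧
      (∀ x, Y ((f : C1CircleMap) x) ≤ (1 + ε) * Y x + ε) ∧
      (∀ x, Y x ≤ (1 + ε) * Y ((f : C1CircleMap) x) + ε) := by
  obtain ⟨p, hp, hpρ⟩ := h.exists_pos_le
  obtain ⟨C, hC, hCL⟩ := h.exists_le
  set q := (1 + ε)⁻¹ with hqdef
  have hq0 : 0 < q := by positivity
  have hq : q * (1 + ε) = 1 := inv_mul_cancel₀ (by positivity)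
  have hq1 : q < 1 := by nlinarith
  obtain ⟨n₀, hn₀⟩ := eventually_atTop.1 ((h.eventually_half_le hp hpρ).and
    ((Finset.eventually_all Θ).2 fun θ _ => h.eventually_abs_sub_le hε θ))
  -- The bump radius will be `κ = 4 q^T / (p ε)`, for which the lower bound `p κ / 4` of the
  -- normaliser `c` times `ε` is exactly the end weight `q^T`. The support is covered by `2T + 1`
  -- preimages of measure at most `C · 4κ`; geometric decay beats the factor `2T + 1`.
  obtain ⟨T, hT1, hT2⟩ : ∃ T : ℕ, 4 * q ^ T / (p * ε) ≤ 1 ∧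
      (2 * T + 1) * (C * (4 * (4 * q ^ T / (p * ε)))) ≤ ε := by
    have l1 := tendsto_pow_atTop_nhds_zero_of_lt_one hq0.le hq1
    have l2 := tendsto_self_mul_const_pow_of_lt_one hq0.le hq1
    have l3 : Tendsto (fun T : ℕ => 4 * q ^ T / (p * ε)) atTop (𝓝 0) := by
      simpa using (l1.const_mul 4).div_const (p * ε)
    have l4 : Tendsto (fun T : ℕ => (2 * (T * q ^ T) + q ^ T) * (C * (4 * (4 / (p * ε))))) atTop (𝓝 0) := by
      simpa using ((l2.const_mul 2).add l1).mul_const (C * (4 * (4 / (p * ε))))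
    obtain ⟨T, h1, h2⟩ := ((l3.eventually_le_const zero_lt_one).and
      (l4.eventually_le_const hε)).exists
    refine ⟨T, h1, le_trans (le_of_eq ?_) h2⟩
    ring
  set κ := 4 * q ^ T / (p * ε) with hκdef
  have hκ0 : 0 < κ := by positivity
  obtain ⟨χ, χ', hχ0, hχ1, hχ'0, hχ'1, hχint, hχ'int⟩ := exists_bump hκ0 hT1
  set R := Finset.range (2 * T + 1) with hR
  set w := tentWeight q T with hw
  have hw0 : ∀ i, 0 ≤ w i := fun i => by rw [hw]; unfold tentWeight; positivity
  set Z : C(UnitAddCircle, ℝ) := ∑ i ∈ R, w i • compIterate f (n₀ + i) χ with hZ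
  have hZx : ∀ x, Z x = ∑ i ∈ R, w i * χ ((f : C1CircleMap).toFun^[n₀ + i] x) := fun x => by
    simp [hZ, ContinuousMap.sum_apply]
  have hZ0 : ∀ x, 0 ≤ Z x := fun x => by
    rw [hZx]
    exact Finset.sum_nonneg fun i _ => mul_nonneg (hw0 i) (hχ0 _)
  have hθZ : ∀ θ : C(UnitAddCircle, ℝ),
      ∫ x, θ x * Z x = ∑ i ∈ R, w i * ∫ x, (transferC f ^ (n₀ + i)) θ x * χ x := fun θ => by
    simp only [← integral_mul_compIterate]
    simp only [← integral_const_mul]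
    rw [← integral_finsetSum _ fun i _ =>
      (UnitAddCircle.integrable_mul θ (compIterate f (n₀ + i) χ)).const_mul _]
    congr 1
    ext x
    rw [hZx, Finset.mul_sum]
    refine Finset.sum_congr rfl fun i _ => ?_
    simp only [compIterate_apply]
    ring
  set c := ∫ x, Z x with hcdef
  have hcsum : c = ∑ i ∈ R, w i * ∫ x, (transferC f ^ (n₀ + i)) 1 x * χ x := by
    simpa using hθZ 1
  have hLχ : ∀ i, 0 ≤ ∫ x, (transferC f ^ (n₀ + i)) 1 x * χ x := fun i =>
    integral_nonneg fun x => mul_nonneg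
      (ContinuousMap.nonneg_apply (transferC_pow_nonneg f _ (fun _ => zero_le_one)) x) (hχ0 x)
  -- The central term, of weight `1`, already gives the bound.
  have hc : p * κ / 4 ≤ c := by
    have h1 : w T * ∫ x, (transferC f ^ (n₀ + T)) 1 x * χ x ≤ c := by
      rw [hcsum]
      exact Finset.single_le_sum (f := fun i => w i * ∫ x, (transferC f ^ (n₀ + i)) 1 x * χ x)
        (fun i _ => mul_nonneg (hw0 i) (hLχ i)) (by rw [hR, Finset.mem_range]; omega)
    have h2 : w T = 1 := by simp [hw, tentWeight]
    have h3 : p / 2 * ∫ x, χ x ≤ ∫ x, (transferC f ^ (n₀ + T)) 1 x * χ x := by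
      rw [← integral_const_mul]
      exact integral_mono ((UnitAddCircle.integrable_continuousMap χ).const_mul _)
        (UnitAddCircle.integrable_mul ((transferC f ^ (n₀ + T)) 1) χ)
        fun x => mul_le_mul_of_nonneg_right ((hn₀ (n₀ + T) (by omega)).1 x) (hχ0 x)
    rw [h2, one_mul] at h1
    nlinarith
  have hc0 : 0 < c := lt_of_lt_of_le (by positivity) hc
  have hqc : c⁻¹ * q ^ T ≤ ε := by
    rw [inv_mul_le_iff₀ hc0]
    have : p * κ / 4 * ε = q ^ T := by
      rw [hκdef]
      field_simp
    nlinarith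
  have hshift := fun x => sum_tentWeight_shift_le hε.le hq0 hq T
    (fun i => χ ((f : C1CircleMap).toFun^[n₀ + i] x)) (fun i => hχ0 _) (fun i => hχ1 _)
  have hZf : ∀ x, Z ((f : C1CircleMap) x) =
      ∑ i ∈ R, w i * χ ((f : C1CircleMap).toFun^[n₀ + (i + 1)] x) := fun x => by
    rw [hZx]
    refine Finset.sum_congr rfl fun i _ => ?_
    rw [← add_assoc, Function.iterate_succ_apply]
  refine ⟨c⁻¹ • Z, fun x => ?_, ?_, fun θ hθ => ?_, ?_, fun x => ?_, fun x => ?_⟩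
  · simp only [ContinuousMap.smul_apply, smul_eq_mul]
    exact mul_nonneg (inv_nonneg.2 hc0.le) (hZ0 x)
  · simp only [ContinuousMap.smul_apply, smul_eq_mul]
    rw [integral_const_mul, ← hcdef, inv_mul_cancel₀ hc0.ne']
  · simp only [ContinuousMap.smul_apply, smul_eq_mul, mul_left_comm _ c⁻¹]
    rw [integral_const_mul]
    have h1 : |(∫ x, θ x * Z x) - (∫ x, θ x) * c| ≤ ε * c := by
      rw [hθZ, hcsum, Finset.mul_sum, Finset.mul_sum, ← Finset.sum_sub_distrib]
      refine (Finset.abs_sum_le_sum_abs _ _).trans (Finset.sum_le_sum fun i _ => ?_)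
      rw [mul_left_comm, ← mul_sub, abs_mul, abs_of_nonneg (hw0 i), mul_left_comm ε]
      refine mul_le_mul_of_nonneg_left ?_ (hw0 i)
      have i1 := UnitAddCircle.integrable_mul ((transferC f ^ (n₀ + i)) θ) χ
      have i2 := UnitAddCircle.integrable_mul ((transferC f ^ (n₀ + i)) 1) χ
      rw [← integral_const_mul, ← integral_const_mul, ← integral_sub i1 (i2.const_mul _)]
      refine (abs_integral_le_integral_abs).trans (integral_mono (i1.sub (i2.const_mul _)).abs
        (i2.const_mul _) fun x => ?_)
      have := (hn₀ (n₀ + i) (by omega)).2 θ hθ x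
      have e : (transferC f ^ (n₀ + i)) θ x * χ x - (∫ y, θ y) * ((transferC f ^ (n₀ + i)) 1 x * χ x) =
        ((transferC f ^ (n₀ + i)) θ x - (∫ y, θ y) * (transferC f ^ (n₀ + i)) 1 x) * χ x := by ring
      simp only
      rw [e, abs_mul, abs_of_nonneg (hχ0 x), ← mul_assoc]
      exact mul_le_mul_of_nonneg_right this (hχ0 x)
    have e : c⁻¹ * (∫ x, θ x * Z x) - ∫ x, θ x = c⁻¹ * ((∫ x, θ x * Z x) - (∫ x, θ x) * c) := by
      field_simp
    rw [e, abs_mul, abs_of_pos (inv_pos.2 hc0), inv_mul_le_iff₀ hc0, mul_comm c]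
    exact h1
  · have hsub : {x | (c⁻¹ • Z) x ≠ 0} ⊆ {x | 1 ≤ ∑ i ∈ R, compIterate f (n₀ + i) χ' x} := by
      intro x hx
      have hZx0 : Z x ≠ 0 := fun h0 => hx (by simp [h0])
      rw [hZx] at hZx0
      obtain ⟨i, hi, hi0⟩ := Finset.exists_ne_zero_of_sum_ne_zero hZx0
      refine (hχ'1 _ (right_ne_zero_of_mul hi0)).trans ?_
      exact Finset.single_le_sum (f := fun i => compIterate f (n₀ + i) χ' x)
        (fun i _ => hχ'0 _) hi
    have hint : Integrable fun x => ∑ i ∈ R, compIterate f (n₀ + i) χ' x :=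
      integrable_finsetSum _ fun i _ => UnitAddCircle.integrable_continuousMap _
    -- Markov's inequality for the sum of the plateaus, which is at least `1` wherever the spike is
    -- nonzero.
    have hmk := mul_meas_ge_le_integral_of_nonneg (μ := volume)
      (f := fun x => ∑ i ∈ R, compIterate f (n₀ + i) χ' x)
      (ae_of_all _ fun x => Finset.sum_nonneg fun i _ => hχ'0 _) hint 1
    rw [one_mul, integral_finsetSum _ fun i _ => UnitAddCircle.integrable_continuousMap _] at hmk
    refine (measureReal_mono hsub).trans (hmk.trans ?_)
    have hi : ∀ i ∈ R, ∫ x, compIterate f (n₀ + i) χ' x ≤ C * (4 * κ) := fun i _ => by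
      rw [integral_compIterate]
      refine (integral_mono (UnitAddCircle.integrable_mul ((transferC f ^ (n₀ + i)) 1) χ')
        ((UnitAddCircle.integrable_continuousMap χ').const_mul C)
        fun x => mul_le_mul_of_nonneg_right (hCL _ x) (hχ'0 x)).trans ?_
      rw [integral_const_mul]
      gcongr
    refine (Finset.sum_le_sum hi).trans ?_
    rw [Finset.sum_const, hR, Finset.card_range, nsmul_eq_mul]
    push_cast
    exact hT2
  · simp only [ContinuousMap.smul_apply, smul_eq_mul]
    rw [hZf, hZx]
    have := mul_le_mul_of_nonneg_left (hshift x).1 (inv_nonneg.2 hc0.le)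
    linarith
  · simp only [ContinuousMap.smul_apply, smul_eq_mul]
    rw [hZf, hZx]
    have := mul_le_mul_of_nonneg_left (hshift x).2 (inv_nonneg.2 hc0.le)
    linarith

end spike

theorem volume_coe_image_Icc_le {a b : ℝ} (ha : 0 ≤ a) (hb : b ≤ 1) :
    volume (((↑) : ℝ → UnitAddCircle) '' Set.Icc a b) ≤ ENNReal.ofReal (b - a) := by
  have hmeas : MeasurableSet (((↑) : ℝ → UnitAddCircle) '' Set.Icc a b) :=
    (isCompact_Icc.image (AddCircle.continuous_mk' (1 : ℝ))).measurableSet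
  rw [AddCircle.add_projection_respects_measure 1 0 hmeas]
  -- The fundamental domain `(0, 1]` represents the class of `0` by `1`, hence the extra null point.
  have hsub : QuotientAddGroup.mk ⁻¹' (((↑) : ℝ → UnitAddCircle) '' Set.Icc a b) ∩
      Set.Ioc (0 : ℝ) (0 + 1) ⊆ Set.Icc a b ∪ {1} := by
    rintro t ⟨⟨s, hs, hst⟩, ht0, ht1⟩
    obtain ⟨k, hk⟩ := (AddCircle.coe_eq_zero_iff (1 : ℝ)).1 (by
      rw [AddCircle.coe_sub]; exact sub_eq_zero.2 hst.symm : ((t - s : ℝ) : UnitAddCircle) = 0)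
    rw [zsmul_eq_mul, mul_one] at hk
    have h1 : (-1 : ℝ) < k := by linarith [hs.2]
    have h2 : (k : ℝ) < 2 := by linarith [hs.1]
    have h1' : -1 < k := by exact_mod_cast h1
    have h2' : k < 2 := by exact_mod_cast h2
    obtain rfl | rfl : k = 0 ∨ k = 1 := by omega
    · left
      have : t = s := by simpa [sub_eq_zero, eq_comm] using hk
      rwa [this]
    · right
      rw [Int.cast_one] at hk
      simp only [Set.mem_singleton_iff]
      linarith [hs.1]
  refine (measure_mono hsub).trans ((measure_union_le _ _).trans ?_)
  simp [Real.volume_Icc]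

/-- Outer approximation of an interval by a continuous function on the circle. -/
theorem exists_continuous_ge_indicator_Icc {a b ε : ℝ} (ha : 0 ≤ a) (hab : a ≤ b) (hb : b ≤ 1)
    (hε : 0 < ε) : ∃ θ : C(UnitAddCircle, ℝ), (∀ x, 0 ≤ θ x) ∧
      (∀ t ∈ Set.Icc a b, θ (t : UnitAddCircle) = 1) ∧ ∫ x, θ x ≤ b - a + ε := by
  set K := ((↑) : ℝ → UnitAddCircle) '' Set.Icc a b
  have hK : IsCompact K := isCompact_Icc.image (AddCircle.continuous_mk' (1 : ℝ))
  obtain ⟨U, hKU, hU, hvol⟩ := K.exists_isOpen_lt_add (μ := volume) (measure_ne_top _ _)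
    (ε := ENNReal.ofReal ε) (by simpa using hε)
  obtain ⟨θ, h0, h1, h01⟩ := exists_continuous_zero_one_of_isClosed hU.isClosed_compl hK.isClosed
    (Set.disjoint_compl_left_iff_subset.2 hKU)
  refine ⟨θ, fun x => (h01 x).1, fun t ht => h1 ⟨t, ht, rfl⟩, ?_⟩
  have h2 : ∫ x, θ x ≤ ∫ x, U.indicator (fun _ => (1 : ℝ)) x := by
    refine integral_mono (UnitAddCircle.integrable_continuousMap θ)
      ((integrable_const _).indicator hU.measurableSet) fun x => ?_
    by_cases hx : x ∈ U
    · rw [Set.indicator_of_mem hx]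
      exact (h01 x).2
    · rw [Set.indicator_of_notMem hx]
      exact (h0 hx).le
  refine h2.trans ?_
  rw [integral_indicator_const _ hU.measurableSet, smul_eq_mul, mul_one, Measure.real]
  refine ENNReal.toReal_le_of_le_ofReal (by linarith) (hvol.le.trans ?_)
  rw [ENNReal.ofReal_add (by linarith) hε.le]
  gcongr
  exact volume_coe_image_Icc_le ha hb

theorem intervalIntegrable_coe (u : C(UnitAddCircle, ℝ)) (a b : ℝ) :
    IntervalIntegrable (fun t : ℝ => u (t : UnitAddCircle)) volume a b :=
  (u.continuous.comp (AddCircle.continuous_mk' (1 : ℝ))).intervalIntegrable a b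

/-- Over an interval where `θ = 1`, the integral of `Y` is at most that of `θ Y` over the circle. -/
theorem intervalIntegral_le_integral_mul {θ Y : C(UnitAddCircle, ℝ)} (hθ : ∀ x, 0 ≤ θ x)
    (hY : ∀ x, 0 ≤ Y x) {a b s t : ℝ} (ha : 0 ≤ s) (hst : s ≤ t) (ht : t ≤ 1)
    (h : ∀ r ∈ Set.Icc a b, θ (r : UnitAddCircle) = 1) (has : a ≤ s) (htb : t ≤ b) :
    ∫ r in s..t, Y (r : UnitAddCircle) ≤ ∫ x, θ x * Y x := by
  rw [← UnitAddCircle.intervalIntegral_eq_integral]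
  have h1 : ∫ r in s..t, Y (r : UnitAddCircle) = ∫ r in s..t, (θ * Y) (r : UnitAddCircle) := by
    refine intervalIntegral.integral_congr fun r hr => ?_
    rw [Set.uIcc_of_le hst] at hr
    simp only [ContinuousMap.mul_apply]
    rw [h r ⟨has.trans hr.1, hr.2.trans htb⟩, one_mul]
  rw [h1]
  exact intervalIntegral.integral_mono_interval ha hst ht
    (ae_of_all _ fun r => mul_nonneg (hθ _) (hY _)) (intervalIntegrable_coe (θ * Y) 0 1)

/-- Nearness of the distribution function to the identity follows from finitely many test functions,
one above each interval `[0, j / M]` and `[j / M, 1]`. The error splits into three parts of size `ε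
/ 3`: the mesh, the excess of the test functions, and their equidistribution error. -/
theorem HasMixingDensity.exists_spike {f : expandingMapsFixingZero} {ρ : C(UnitAddCircle, ℝ)}
    (h : HasMixingDensity f ρ) {ε : ℝ} (hε : 0 < ε) :
    ∃ Y : C(UnitAddCircle, ℝ), (∀ x, 0 ≤ Y x) ∧ ∫ x, Y x = 1 ∧
      (∀ x ∈ Set.Icc (0 : ℝ) 1, |(∫ t in (0 : ℝ)..x, Y t) - x| ≤ ε) ∧ volume.real {x | Y x ≠ 0} ≤ ε ∧
      (∀ x, Y ((f : C1CircleMap) x) ≤ (1 + ε) * Y x + ε) ∧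
      (∀ x, Y x ≤ (1 + ε) * Y ((f : C1CircleMap) x) + ε) := by
  classical
  obtain ⟨M, hM⟩ := exists_nat_gt (3 / ε)
  have hM0 : (0 : ℝ) < M := lt_trans (by positivity) hM
  have hMε : 1 / (M : ℝ) ≤ ε / 3 := by
    rw [div_le_div_iff₀ hM0 (by norm_num)]
    rw [div_lt_iff₀ hε] at hM
    linarith
  have hgrid : ∀ j : ℕ, j ≤ M → (j : ℝ) / M ≤ 1 := fun j hj => by
    rw [div_le_one hM0]
    exact_mod_cast hj
  have hex1 : ∀ j : ℕ, ∃ θ : C(UnitAddCircle, ℝ), j ≤ M → (∀ x, 0 ≤ θ x) ∧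
      (∀ t ∈ Set.Icc 0 ((j : ℝ) / M), θ (t : UnitAddCircle) = 1) ∧ ∫ x, θ x ≤ (j : ℝ) / M - 0 + ε / 3 :=
    fun j => by
      by_cases hj : j ≤ M
      · obtain ⟨θ, hθ⟩ := exists_continuous_ge_indicator_Icc le_rfl (by positivity : 0 ≤ (j : ℝ) / M)
          (hgrid j hj) (by positivity : 0 < ε / 3)
        exact ⟨θ, fun _ => hθ⟩
      · exact ⟨0, fun h => absurd h hj⟩
  have hex2 : ∀ j : ℕ, ∃ θ : C(UnitAddCircle, ℝ), j ≤ M → (∀ x, 0 ≤ θ x) ∧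
      (∀ t ∈ Set.Icc ((j : ℝ) / M) 1, θ (t : UnitAddCircle) = 1) ∧ ∫ x, θ x ≤ 1 - (j : ℝ) / M + ε / 3 :=
    fun j => by
      by_cases hj : j ≤ M
      · obtain ⟨θ, hθ⟩ := exists_continuous_ge_indicator_Icc (by positivity : 0 ≤ (j : ℝ) / M)
          (hgrid j hj) le_rfl (by positivity : 0 < ε / 3)
        exact ⟨θ, fun _ => hθ⟩
      · exact ⟨0, fun h => absurd h hj⟩
  choose θ₁ hθ₁ using hex1
  choose θ₂ hθ₂ using hex2
  obtain ⟨Y, hY0, hY1, hΘ, hvol, hs1, hs2⟩ := h.exists_spike_of_finset (by positivity : 0 < ε / 3)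
    ((Finset.range (M + 1)).image θ₁ ∪ (Finset.range (M + 1)).image θ₂)
  refine ⟨Y, hY0, hY1, fun x hx => ?_, hvol.trans (by linarith),
    fun x => (hs1 x).trans (by have := hY0 x; gcongr <;> linarith),
    fun x => (hs2 x).trans (by have := hY0 ((f : C1CircleMap) x); gcongr <;> linarith)⟩
  have hxM : x * M ≤ M := mul_le_of_le_one_left hM0.le hx.2
  have hxM0 : 0 ≤ x * M := mul_nonneg hx.1 hM0.le
  have hsplit : (∫ t in (0 : ℝ)..x, Y t) + ∫ t in x..1, Y t = 1 := by
    rw [intervalIntegral.integral_add_adjacent_intervals (intervalIntegrable_coe Y _ _)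
      (intervalIntegrable_coe Y _ _), UnitAddCircle.intervalIntegral_eq_integral, hY1]
  rw [abs_le]
  constructor
  -- The test functions only bound masses from above, so the lower bound for `[0, x]` comes from an
  -- upper bound for `[x, 1]` and the total mass `1`.
  · set j := ⌊x * M⌋₊
    have hj1 : (j : ℝ) ≤ x * M := Nat.floor_le hxM0
    have hj2 : x * M < j + 1 := Nat.lt_floor_add_one _
    have hjM : j ≤ M := by exact_mod_cast hj1.trans hxM
    obtain ⟨e0, e1, e2⟩ := hθ₂ j hjM
    have hjx : (j : ℝ) / M ≤ x := (div_le_iff₀ hM0).2 hj1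
    have hjx' : x ≤ (j : ℝ) / M + 1 / M := by
      rw [← add_div, le_div_iff₀ hM0]
      exact hj2.le
    have e3 := intervalIntegral_le_integral_mul e0 hY0 hx.1 hx.2 le_rfl e1 hjx le_rfl
    have e4 := (abs_le.1 (hΘ (θ₂ j) (Finset.mem_union_right _ (Finset.mem_image_of_mem _
      (Finset.mem_range.2 (Nat.lt_succ_of_le hjM)))))).2
    linarith
  · set j := ⌈x * M⌉₊
    have hj1 : x * M ≤ j := Nat.le_ceil _
    have hj2 : (j : ℝ) < x * M + 1 := Nat.ceil_lt_add_one hxM0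
    have hjM : j ≤ M := Nat.ceil_le.2 hxM
    obtain ⟨e0, e1, e2⟩ := hθ₁ j hjM
    have hjx : x ≤ (j : ℝ) / M := (le_div_iff₀ hM0).2 hj1
    have hjx' : (j : ℝ) / M ≤ x + 1 / M := by
      rw [div_le_iff₀ hM0, add_mul, one_div, inv_mul_cancel₀ hM0.ne']
      exact hj2.le
    have e3 := intervalIntegral_le_integral_mul e0 hY0 le_rfl hx.1 hx.2 e1 le_rfl hjx
    have e4 := (abs_le.1 (hΘ (θ₁ j) (Finset.mem_union_left _ (Finset.mem_image_of_mem _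
      (Finset.mem_range.2 (Nat.lt_succ_of_le hjM)))))).2
    linarith

/-! ### Densities spread over many scales -/

theorem measurableSet_window (W : C(UnitAddCircle, ℝ)) (s t : ℝ) :
    MeasurableSet {x | s ≤ W x ∧ W x ≤ t} :=
  ((isClosed_le continuous_const W.continuous).inter
    (isClosed_le W.continuous continuous_const)).measurableSet

/-- A slowly varying density, spread over many scales: any window of ratio `Λ` carries at most a
proportion about `1 / (J + 1)` of its mass. -/
theorem HasMixingDensity.exists_spread {f : expandingMapsFixingZero} {ρ : C(UnitAddCircle, ℝ)}
    (h : HasMixingDensity f ρ) {Λ : ℝ} (hΛ : 1 ≤ Λ) (J : ℕ) : ∀ δ : ℝ, 0 < δ →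
    ∃ W : C(UnitAddCircle, ℝ), (∀ x, 1 ≤ W x) ∧ ∫ x, W x = J + 1 ∧
      (∀ x ∈ Set.Icc (0 : ℝ) 1, |(∫ t in (0 : ℝ)..x, W t) - (J + 1) * x| ≤ δ) ∧
      (∀ x, W ((f : C1CircleMap) x) ≤ (1 + δ) * W x) ∧
      (∀ x, W x ≤ (1 + δ) * W ((f : C1CircleMap) x)) ∧
      ∀ t, ∫ x in {x | t ≤ W x ∧ W x ≤ Λ * t}, W x ≤ 1 + δ := by
  induction J with
  | zero =>
    intro δ hδ
    refine ⟨1, fun x => le_rfl, by simp, fun x hx => by simpa using hδ.le, fun x => ?_, fun x => ?_,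
      fun t => ?_⟩
    · simpa using hδ.le
    · simpa using hδ.le
    · simp only [ContinuousMap.one_apply]
      rw [setIntegral_const, smul_eq_mul, mul_one]
      have : volume.real {x : UnitAddCircle | t ≤ 1 ∧ 1 ≤ Λ * t} ≤ 1 := measureReal_le_one
      linarith
  | succ J ih =>
    intro δ hδ
    obtain ⟨W, hW1, hWint, hWcdf, hWs1, hWs2, hWwin⟩ := ih (δ / 2) (by positivity)
    have hn1 : 1 ≤ ‖W‖ := (hW1 0).trans ((le_abs_self _).trans (W.norm_coe_le_norm 0))
    -- The new spike is chosen after `W`. Its support is so small that both `W` and any function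
    -- bounded by `Λ ‖W‖` have integral at most `δ / 4` over it. The additive error `ε` in its
    -- variation is absorbed by `W ≥ 1`.
    set ε := δ / (4 * Λ * ‖W‖) with hε
    have hε0 : 0 < ε := by positivity
    have hΛn : 1 ≤ Λ * ‖W‖ := one_le_mul_of_one_le_of_one_le hΛ hn1
    have hεΛ : Λ * ‖W‖ * ε = δ / 4 := by rw [hε]; field_simp
    have hεn : ‖W‖ * ε ≤ δ / 4 := by
      rw [← hεΛ, mul_assoc]
      exact le_mul_of_one_le_left (by positivity) hΛ
    have hεδ : ε ≤ δ / 4 := by nlinarith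
    obtain ⟨Y, hY0, hY1, hYcdf, hYvol, hYs1, hYs2⟩ := h.exists_spike hε0
    have hiW := UnitAddCircle.integrable_continuousMap W
    have hiY := UnitAddCircle.integrable_continuousMap Y
    refine ⟨W + Y, fun x => ?_, ?_, fun x hx => ?_, fun x => ?_, fun x => ?_, fun t => ?_⟩
    · have := hW1 x
      have := hY0 x
      rw [ContinuousMap.add_apply]
      linarith
    · simp only [ContinuousMap.add_apply]
      rw [integral_add hiW hiY, hWint, hY1]
      push_cast
      ring
    · simp only [ContinuousMap.add_apply]
      rw [intervalIntegral.integral_add (intervalIntegrable_coe W _ _) (intervalIntegrable_coe Y _ _)]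
      have h1 := abs_le.1 (hWcdf x hx)
      have h2 := abs_le.1 (hYcdf x hx)
      push_cast
      rw [abs_le]
      constructor <;> linarith
    · have h1 := hWs1 x
      have h2 := hYs1 x
      have h3 := hW1 x
      have h4 := hY0 x
      rw [ContinuousMap.add_apply, ContinuousMap.add_apply]
      nlinarith
    · have h1 := hWs2 x
      have h2 := hYs2 x
      have h3 := hW1 ((f : C1CircleMap) x)
      have h4 := hY0 ((f : C1CircleMap) x)
      rw [ContinuousMap.add_apply, ContinuousMap.add_apply]
      nlinarith
    · simp only [ContinuousMap.add_apply]
      set S := {x | t ≤ W x + Y x ∧ W x + Y x ≤ Λ * t} with hS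
      have hSm : MeasurableSet S := measurableSet_window (W + Y) t (Λ * t)
      have hNm : MeasurableSet {x | Y x ≠ 0} :=
        (isOpen_ne_fun Y.continuous continuous_const).measurableSet
      rw [integral_add hiW.integrableOn hiY.integrableOn]
      have hbound : ∀ (g : C(UnitAddCircle, ℝ)) (s : Set UnitAddCircle) (c : ℝ), 0 ≤ c →
          MeasurableSet s → (∀ x ∈ s, |g x| ≤ c) → ∫ x in s, g x ≤ c * volume.real s :=
        fun g s c _ hs hc => (Real.le_norm_self _).trans
          (norm_setIntegral_le_of_norm_le_const (measure_lt_top _ _) hc)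
      have hWN : ∫ x in {x | Y x ≠ 0}, W x ≤ δ / 4 :=
        (hbound W _ ‖W‖ (norm_nonneg _) hNm fun x _ => W.norm_coe_le_norm x).trans
          ((mul_le_mul_of_nonneg_left hYvol (norm_nonneg _)).trans hεn)
      -- A window above `‖W‖` sees only the support of the spike: mass at most `1` from `Y` and
      -- little from `W`. In a lower window `Y` is at most `Λ ‖W‖`, so the spike adds little to the
      -- window of `W`.
      rcases lt_or_ge ‖W‖ t with ht | ht
      · have h1 : S ⊆ {x | Y x ≠ 0} := by
          rintro x ⟨hx, -⟩ h0
          rw [h0, add_zero] at hx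
          exact absurd ((le_abs_self _).trans (W.norm_coe_le_norm x)) (by
            rw [not_le]; exact ht.trans_le hx)
        have h2 : ∫ x in S, W x ≤ ∫ x in {x | Y x ≠ 0}, W x :=
          setIntegral_mono_set hiW.integrableOn (ae_of_all _ fun x => zero_le_one.trans (hW1 x))
            h1.eventuallyLE
        have h3 : ∫ x in S, Y x ≤ ∫ x, Y x := setIntegral_le_integral hiY (ae_of_all _ hY0)
        linarith
      · have h1 : S ⊆ {x | t ≤ W x ∧ W x ≤ Λ * t} ∪ {x | Y x ≠ 0} := by
          intro x hx
          by_cases h0 : Y x = 0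
          · left
            simpa [hS, h0] using hx
          · exact Or.inr h0
        have h2 := setIntegral_le_add_of_subset_union hiW (fun x => zero_le_one.trans (hW1 x))
          (measurableSet_window W t (Λ * t)) hNm h1
        have h3 : ∫ x in S, Y x ≤ δ / 4 := by
          have e1 : ∫ x in S, Y x = ∫ x in S ∩ {x | Y x ≠ 0}, Y x := by
            rw [← setIntegral_indicator hNm]
            refine setIntegral_congr_fun hSm fun x _ => ?_
            by_cases h0 : Y x = 0
            · simp [Set.indicator, h0]
            · simp [Set.indicator, h0]
          rw [e1]
          have hΛt : ∀ x ∈ S ∩ {x | Y x ≠ 0}, |Y x| ≤ Λ * ‖W‖ := by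
            rintro x ⟨hx, -⟩
            rw [abs_of_nonneg (hY0 x)]
            have := hW1 x
            have : Λ * t ≤ Λ * ‖W‖ := by gcongr
            linarith [hx.2]
          refine (hbound Y _ _ (by positivity) (hSm.inter hNm) hΛt).trans ?_
          rw [← hεΛ]
          refine mul_le_mul_of_nonneg_left (le_trans ?_ hYvol) (by positivity)
          exact measureReal_mono Set.inter_subset_right
        have h4 := hWwin t
        linarith

/-! ### Circle diffeomorphisms with prescribed derivative, and conjugation -/

/-- The lift of the circle diffeomorphism that fixes the origin and has derivative `w`. -/
noncomputable def primitiveLift (w : C(UnitAddCircle, ℝ)) (x : ℝ) : ℝ :=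
  ∫ t in (0 : ℝ)..x, w (t : UnitAddCircle)

/-- `w` is the derivative of an orientation preserving circle diffeomorphism. -/
structure IsPosDensity (w : C(UnitAddCircle, ℝ)) : Prop where
  pos : ∀ x, 0 < w x
  integral_eq : ∫ x, w x = 1

namespace IsPosDensity

variable {w : C(UnitAddCircle, ℝ)}

local notation "H" => primitiveLift

theorem continuous_coe (w : C(UnitAddCircle, ℝ)) : Continuous fun t : ℝ => w (t : UnitAddCircle) :=
  w.continuous.comp (AddCircle.continuous_mk' (1 : ℝ))

theorem hasDerivAt (w : C(UnitAddCircle, ℝ)) (x : ℝ) : HasDerivAt (H w) (w x) x :=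
  intervalIntegral.integral_hasDerivAt_right (intervalIntegrable_coe w _ _)
    (continuous_coe w).aestronglyMeasurable.stronglyMeasurableAtFilter
    (continuous_coe w).continuousAt

theorem map_zero (w : C(UnitAddCircle, ℝ)) : H w 0 = 0 := intervalIntegral.integral_same

theorem differentiable (w : C(UnitAddCircle, ℝ)) : Differentiable ℝ (H w) :=
  fun x => (hasDerivAt w x).differentiableAt

theorem continuous (w : C(UnitAddCircle, ℝ)) : Continuous (H w) := (differentiable w).continuous

theorem map_add_one (hw : IsPosDensity w) (x : ℝ) : H w (x + 1) = H w x + 1 := by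
  unfold primitiveLift
  rw [← intervalIntegral.integral_add_adjacent_intervals (intervalIntegrable_coe w 0 x)
    (intervalIntegrable_coe w x (x + 1)), UnitAddCircle.intervalIntegral_preimage, hw.integral_eq]

theorem strictMono (hw : IsPosDensity w) : StrictMono (H w) :=
  strictMono_of_deriv_pos fun x => by
    rw [(hasDerivAt w x).deriv]
    exact hw.pos x

theorem map_add_nat (hw : IsPosDensity w) (x : ℝ) (n : ℕ) : H w (x + n) = H w x + n := by
  induction n with
  | zero => simp
  | succ n ih =>
    push_cast
    rw [← add_assoc, hw.map_add_one, ih, add_assoc]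

theorem map_add_int (hw : IsPosDensity w) (x : ℝ) (n : ℤ) : H w (x + n) = H w x + n := by
  obtain ⟨n, rfl | rfl⟩ := n.eq_nat_or_neg
  · exact_mod_cast hw.map_add_nat x n
  · have h := hw.map_add_nat (x - n) n
    rw [sub_add_cancel] at h
    push_cast
    rw [← sub_eq_add_neg]
    linarith

theorem surjective (hw : IsPosDensity w) : Function.Surjective (H w) := fun z => by
  obtain ⟨n, hn⟩ := exists_nat_ge |z|
  have h1 := hw.map_add_int 0 n
  have h2 := hw.map_add_int 0 (-n)
  rw [map_zero] at h1 h2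
  push_cast at h1 h2
  have := abs_le.1 hn
  exact mem_range_of_exists_le_of_exists_ge (continuous w) ⟨0 + -n, by linarith⟩
    ⟨0 + n, by linarith⟩

/-- The inverse diffeomorphism. -/
noncomputable def inv (hw : IsPosDensity w) : ℝ → ℝ :=
  (Equiv.ofBijective (H w) ⟨hw.strictMono.injective, hw.surjective⟩).symm

theorem apply_inv (hw : IsPosDensity w) (z : ℝ) : H w (hw.inv z) = z :=
  (Equiv.ofBijective (H w) ⟨hw.strictMono.injective, hw.surjective⟩).apply_symm_apply z

theorem inv_apply (hw : IsPosDensity w) (x : ℝ) : hw.inv (H w x) = x :=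
  (Equiv.ofBijective (H w) ⟨hw.strictMono.injective, hw.surjective⟩).symm_apply_apply x

theorem inv_add_one (hw : IsPosDensity w) (x : ℝ) : hw.inv (x + 1) = hw.inv x + 1 := by
  apply hw.strictMono.injective
  rw [hw.map_add_one, hw.apply_inv, hw.apply_inv]

theorem continuous_inv (hw : IsPosDensity w) : Continuous hw.inv := by
  have hm : StrictMono hw.inv := fun x y hxy => by
    rw [← hw.strictMono.lt_iff_lt, hw.apply_inv, hw.apply_inv]
    exact hxy
  exact hm.monotone.continuous_of_surjective fun x => ⟨H w x, hw.inv_apply x⟩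

theorem hasDerivAt_inv (hw : IsPosDensity w) (z : ℝ) :
    HasDerivAt hw.inv (w (hw.inv z : ℝ))⁻¹ z :=
  HasDerivAt.of_local_left_inverse hw.continuous_inv.continuousAt (hasDerivAt w _)
    (hw.pos _).ne' (Eventually.of_forall hw.apply_inv)

theorem abs_sub_le (hw : IsPosDensity w) {ε : ℝ} (h : ∀ x ∈ Set.Icc (0 : ℝ) 1, |H w x - x| ≤ ε)
    (x : ℝ) : |H w x - x| ≤ ε := by
  have h1 := h (Int.fract x) ⟨Int.fract_nonneg x, (Int.fract_lt_one x).le⟩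
  have h2 := hw.map_add_int (Int.fract x) ⌊x⌋
  rw [Int.fract_add_floor] at h2
  rw [h2]
  have h3 : Int.fract x = x - ⌊x⌋ := rfl
  rw [h3] at h1 ⊢
  refine le_of_eq_of_le ?_ h1
  congr 1
  ring

theorem abs_inv_sub_le (hw : IsPosDensity w) {ε : ℝ}
    (h : ∀ x ∈ Set.Icc (0 : ℝ) 1, |H w x - x| ≤ ε) (z : ℝ) : |hw.inv z - z| ≤ ε := by
  have := hw.abs_sub_le h (hw.inv z)
  rwa [hw.apply_inv, abs_sub_comm] at this

/-- The diffeomorphism of the circle with derivative `w`. -/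
noncomputable def circleMap (hw : IsPosDensity w) : C(UnitAddCircle, UnitAddCircle) where
  toFun := Function.Periodic.lift (f := fun x => (H w x : UnitAddCircle)) (c := 1) fun x => by
    simp [hw.map_add_one]
  continuous_toFun := (QuotientAddGroup.isQuotientMap_mk _).continuous_iff.2
    ((AddCircle.continuous_mk' (1 : ℝ)).comp (continuous w))

/-- The inverse of `circleMap`. -/
noncomputable def circleMapInv (hw : IsPosDensity w) : C(UnitAddCircle, UnitAddCircle) where
  toFun := Function.Periodic.lift (f := fun x => (hw.inv x : UnitAddCircle)) (c := 1) fun x => by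
    simp [hw.inv_add_one]
  continuous_toFun := (QuotientAddGroup.isQuotientMap_mk _).continuous_iff.2
    ((AddCircle.continuous_mk' (1 : ℝ)).comp hw.continuous_inv)

theorem circleMap_coe (hw : IsPosDensity w) (x : ℝ) : hw.circleMap (x : UnitAddCircle) = (H w x : ℝ) :=
  rfl

theorem circleMapInv_coe (hw : IsPosDensity w) (x : ℝ) :
    hw.circleMapInv (x : UnitAddCircle) = (hw.inv x : ℝ) := rfl

theorem circleMapInv_circleMap (hw : IsPosDensity w) (x : UnitAddCircle) :
    hw.circleMapInv (hw.circleMap x) = x := by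
  induction x using UnitAddCircle.induction with | h t => ?_
  rw [circleMap_coe, circleMapInv_coe, hw.inv_apply]

theorem circleMap_circleMapInv (hw : IsPosDensity w) (x : UnitAddCircle) :
    hw.circleMap (hw.circleMapInv x) = x := by
  induction x using UnitAddCircle.induction with | h t => ?_
  rw [circleMapInv_coe, circleMap_coe, hw.apply_inv]

/-- Change of variables. -/
theorem integral_eq_integral_mul (hw : IsPosDensity w) (φ : UnitAddCircle → ℝ) :
    ∫ x, φ x = ∫ x, w x * φ (hw.circleMap x) := by
  have himg : H w '' Set.Ioc 0 1 = Set.Ioc 0 1 := by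
    have h0 := map_zero w
    have h1 : H w 1 = 1 := by
      have := hw.map_add_one 0
      rwa [zero_add, h0, zero_add] at this
    ext z
    obtain ⟨y, rfl⟩ := hw.surjective z
    rw [hw.strictMono.injective.mem_set_image, Set.mem_Ioc, Set.mem_Ioc]
    rw [← hw.strictMono.lt_iff_lt (a := 0), ← hw.strictMono.le_iff_le (b := 1), h0, h1]
  rw [← UnitAddCircle.integral_preimage 0, ← UnitAddCircle.integral_preimage 0, zero_add]
  conv_lhs => rw [← himg]
  rw [integral_image_eq_integral_abs_deriv_smul measurableSet_Ioc
    (fun x _ => (hasDerivAt w x).hasDerivWithinAt) hw.strictMono.injective.injOn]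
  refine integral_congr_ae (ae_of_all _ fun x => ?_)
  simp only [smul_eq_mul, circleMap_coe]
  rw [abs_of_pos (hw.pos _)]

section conj

variable {F : ℝ → ℝ} {d : ℤ}

/-- The lift of `f` in the coordinate with derivative `w`. -/
noncomputable def conj (hw : IsPosDensity w) (F : ℝ → ℝ) (x : ℝ) : ℝ := H w (F (hw.inv x))

theorem hasDerivAt_conj (hw : IsPosDensity w) (hF : IsExpandingLift F d) (x : ℝ) :
    HasDerivAt (hw.conj F)
      (w (F (hw.inv x) : ℝ) * (deriv F (hw.inv x) * (w (hw.inv x : ℝ))⁻¹)) x :=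
  (hasDerivAt w _).comp x ((hF.differentiable _).hasDerivAt.comp x (hw.hasDerivAt_inv x))

theorem isExpandingLift_conj (hw : IsPosDensity w) (hF : IsExpandingLift F d)
    (h : ∀ x, 1 < |deriv (hw.conj F) x|) : IsExpandingLift (hw.conj F) d where
  contDiff := by
    rw [contDiff_one_iff_deriv]
    refine ⟨fun x => (hw.hasDerivAt_conj hF x).differentiableAt, ?_⟩
    have : deriv (hw.conj F) = fun x =>
        w (F (hw.inv x) : ℝ) * (deriv F (hw.inv x) * (w (hw.inv x : ℝ))⁻¹) :=
      funext fun x => (hw.hasDerivAt_conj hF x).deriv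
    rw [this]
    exact ((continuous_coe w).comp (hF.continuous.comp hw.continuous_inv)).mul
      ((hF.continuous_deriv.comp hw.continuous_inv).mul
        (((continuous_coe w).comp hw.continuous_inv).inv₀ fun x => (hw.pos _).ne'))
  map_zero := by
    have h0 : hw.inv 0 = 0 := by
      have := hw.inv_apply 0
      rwa [IsPosDensity.map_zero] at this
    rw [conj, h0, hF.map_zero, IsPosDensity.map_zero]
  map_add_one x := by
    rw [conj, conj, hw.inv_add_one, hF.map_add_one, hw.map_add_int]
  one_lt_abs_deriv := h

variable {f g : expandingMapsFixingZero}

/-- The operator `u ↦ (u ∘ h) w` pulls densities back along `h`, so it intertwines the two transfer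
operators. Iterating this carries mixing over to the conjugate map. -/
theorem transferC_conj_apply (hw : IsPosDensity w) (hF : IsExpandingLift F d)
    (hf : (f : C1CircleMap).IsLift F) (hG : IsExpandingLift (hw.conj F) d)
    (hg : (g : C1CircleMap).IsLift (hw.conj F)) (u : C(UnitAddCircle, ℝ)) :
    (transferC g u).comp hw.circleMap * w = transferC f (u.comp hw.circleMap * w) := by
  refine ContinuousMap.ext (UnitAddCircle.induction fun x => ?_)
  simp only [ContinuousMap.mul_apply, ContinuousMap.comp_apply, circleMap_coe, transferC_apply]
  rw [hG.transfer_coe hg, hF.transfer_coe hf, Finset.sum_mul]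
  refine Finset.sum_congr rfl fun k _ => ?_
  have h1 : hG.inv (H w x + k) = H w (hF.inv (x + k)) := by
    apply hG.injective
    rw [hG.apply_inv, conj, hw.inv_apply, hF.apply_inv, hw.map_add_nat]
  rw [h1, (hw.hasDerivAt_conj hF _).deriv, hw.inv_apply, hF.apply_inv]
  simp only [ContinuousMap.mul_apply, ContinuousMap.comp_apply, circleMap_coe]
  have h2 : ((x + k : ℝ) : UnitAddCircle) = x := by
    rw [AddCircle.coe_add, add_eq_left]
    exact (AddCircle.coe_eq_zero_iff (1 : ℝ)).2 ⟨k, by simp⟩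
  rw [h2, abs_mul, abs_mul, abs_inv, abs_of_pos (hw.pos _), abs_of_pos (hw.pos _)]
  have h3 := (hw.pos (x : UnitAddCircle)).ne'
  have h4 := (hw.pos (hF.inv (x + k) : UnitAddCircle)).ne'
  have h5 := (zero_lt_one.trans (hF.one_lt_abs_deriv (hF.inv (x + k)))).ne'
  field_simp

theorem transferC_pow_conj_apply (hw : IsPosDensity w) (hF : IsExpandingLift F d)
    (hf : (f : C1CircleMap).IsLift F) (hG : IsExpandingLift (hw.conj F) d)
    (hg : (g : C1CircleMap).IsLift (hw.conj F)) (n : ℕ) (u : C(UnitAddCircle, ℝ)) :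
    ((transferC g ^ n) u).comp hw.circleMap * w = (transferC f ^ n) (u.comp hw.circleMap * w) := by
  induction n with
  | zero => rfl
  | succ n ih =>
    rw [pow_succ', pow_succ', Module.End.mul_apply, Module.End.mul_apply,
      hw.transferC_conj_apply hF hf hG hg, ih]

/-- `1 / w` as a continuous function. -/
noncomputable def recip (hw : IsPosDensity w) : C(UnitAddCircle, ℝ) :=
  ⟨fun x => (w x)⁻¹, w.continuous.inv₀ fun x => (hw.pos x).ne'⟩

/-- Mixing densities transform like densities under a change of coordinates. -/
theorem hasMixingDensity_conj (hw : IsPosDensity w) (hF : IsExpandingLift F d)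
    (hf : (f : C1CircleMap).IsLift F) (hG : IsExpandingLift (hw.conj F) d)
    (hg : (g : C1CircleMap).IsLift (hw.conj F)) {ρ : C(UnitAddCircle, ℝ)}
    (h : HasMixingDensity f ρ) : HasMixingDensity g ((ρ * hw.recip).comp hw.circleMapInv) where
  pos x := mul_pos (h.pos _) (inv_pos.2 (hw.pos _))
  tendsto u := by
    have hcont : Continuous fun v : C(UnitAddCircle, ℝ) => (v * hw.recip).comp hw.circleMapInv :=
      (ContinuousMap.continuous_precomp hw.circleMapInv).comp (continuous_id.mul continuous_const)
    have h1 := (hcont.tendsto _).comp (h.tendsto (u.comp hw.circleMap * w))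
    have h2 : ∫ x, (u.comp hw.circleMap * w) x = ∫ x, u x := by
      rw [hw.integral_eq_integral_mul u]
      simp only [ContinuousMap.mul_apply, ContinuousMap.comp_apply, mul_comm (w _)]
    rw [h2] at h1
    convert h1 using 1
    · ext n x
      simp only [Function.comp_apply, ← hw.transferC_pow_conj_apply hF hf hG hg,
        ContinuousMap.comp_apply, ContinuousMap.mul_apply, circleMap_circleMapInv]
      rw [mul_assoc]
      change _ = _ * (w _ * (w _)⁻¹)
      rw [mul_inv_cancel₀ (hw.pos _).ne', mul_one]
    · rw [smul_mul_assoc]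
      rfl

end conj

end IsPosDensity

/-! ### The `C¹` topology and continuity of the transfer operator -/

/-- A continuous function on the circle is uniformly continuous when read on the line. -/
theorem exists_delta_abs_sub_lt (u : C(UnitAddCircle, ℝ)) {ε : ℝ} (hε : 0 < ε) :
    ∃ δ > 0, ∀ x y : ℝ, |x - y| ≤ δ → |u (x : UnitAddCircle) - u (y : UnitAddCircle)| < ε := by
  obtain ⟨δ, hδ, h⟩ := Metric.uniformContinuous_iff.1
    (CompactSpace.uniformContinuous_of_continuous u.continuous) ε hε
  refine ⟨δ / 2, by positivity, fun x y hxy => ?_⟩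
  have h1 : dist (x : UnitAddCircle) y ≤ |x - y| := by
    rw [dist_eq_norm, ← AddCircle.coe_sub]
    exact QuotientAddGroup.norm_mk_le_norm
  exact h (lt_of_le_of_lt h1 (by linarith))

section topology

variable {f g : C1CircleMap} {F G : ℝ → ℝ} {d e : ℤ}

theorem IsExpandingLift.abs_deriv_sub_le (hF : IsExpandingLift F d) (hf : f.IsLift F)
    (hG : IsExpandingLift G e) (hg : g.IsLift G) (x : ℝ) :
    |deriv F x - deriv G x| ≤ dist f.derivative g.derivative := by
  rw [← f.derivative_coe hf hF.continuous, ← g.derivative_coe hg hG.continuous]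
  exact ContinuousMap.dist_apply_le_dist (f := f.derivative) (g := g.derivative) _

theorem IsExpandingLift.abs_sub_le_mul (hF : IsExpandingLift F d) (hf : f.IsLift F)
    (hG : IsExpandingLift G e) (hg : g.IsLift G) (x : ℝ) :
    |F x - G x| ≤ dist f.derivative g.derivative * |x| := by
  have := Convex.norm_image_sub_le_of_norm_deriv_le (f := fun y => F y - G y) (s := Set.univ)
    (C := dist f.derivative g.derivative) (x := 0) (y := x)
    (fun y _ => (hF.differentiable y).sub (hG.differentiable y)) (fun y _ => by
      rw [deriv_fun_sub (hF.differentiable y) (hG.differentiable y)]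
      exact hF.abs_deriv_sub_le hf hG hg y) convex_univ trivial trivial
  simpa [hF.map_zero, hG.map_zero] using this

/-- Both lifts vanish at `0` and take the integer values `d` and `e` at `1`; close derivatives put
these at distance less than `1`. -/
theorem IsExpandingLift.degree_eq (hF : IsExpandingLift F d) (hf : f.IsLift F)
    (hG : IsExpandingLift G e) (hg : g.IsLift G) (h : dist f.derivative g.derivative < 1) :
    d = e := by
  have h1 := hF.abs_sub_le_mul hf hG hg 1
  have h2 := hF.map_int 1
  have h3 := hG.map_int 1
  simp only [Int.cast_one, one_mul] at h2 h3
  rw [h2, h3, abs_one, mul_one] at h1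
  have h4 : |(d - e : ℤ)| < 1 := by
    have : |((d - e : ℤ) : ℝ)| < 1 := by
      push_cast
      exact h1.trans_lt h
    exact_mod_cast this
  have := Int.abs_lt_one_iff.1 h4
  omega

theorem IsExpandingLift.abs_sub_le_dist (hF : IsExpandingLift F d) (hf : f.IsLift F)
    (hG : IsExpandingLift G d) (hg : g.IsLift G) (x : ℝ) :
    |F x - G x| ≤ dist f.derivative g.derivative := by
  have h1 := hF.map_add_int (Int.fract x) ⌊x⌋
  have h2 := hG.map_add_int (Int.fract x) ⌊x⌋
  rw [Int.fract_add_floor] at h1 h2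
  rw [h1, h2, add_sub_add_right_eq_sub]
  refine (hF.abs_sub_le_mul hf hG hg _).trans (mul_le_of_le_one_right dist_nonneg ?_)
  rw [abs_of_nonneg (Int.fract_nonneg x)]
  exact (Int.fract_lt_one x).le

theorem IsExpandingLift.abs_inv_sub_inv_le (hF : IsExpandingLift F d) (hf : f.IsLift F)
    (hG : IsExpandingLift G d) (hg : g.IsLift G) (z : ℝ) :
    |hF.inv z - hG.inv z| ≤ dist f.derivative g.derivative := by
  refine (hF.abs_sub_le _ _).trans ?_
  have := hF.abs_sub_le_dist hf hG hg (hG.inv z)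
  rw [hG.apply_inv] at this
  rwa [hF.apply_inv, abs_sub_comm]

/-- The common fixed point makes the derivative control the map: the lifts agree at `0`, and the
mean value inequality is applied on a unit interval. -/
theorem dist_toContinuousMap_le (f g : expandingMapsFixingZero) :
    dist (f : C1CircleMap).toContinuousMap (g : C1CircleMap).toContinuousMap ≤
      dist (f : C1CircleMap).derivative (g : C1CircleMap).derivative := by
  obtain ⟨F, d, hF, hf⟩ := exists_isExpandingLift f.2
  obtain ⟨G, e, hG, hg⟩ := exists_isExpandingLift g.2
  refine (ContinuousMap.dist_le dist_nonneg).2 fun x => ?_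
  obtain ⟨t, h0, h1, rfl⟩ := UnitAddCircle.exists_coe_eq x
  change dist ((f : C1CircleMap) t) ((g : C1CircleMap) t) ≤ _
  rw [hf, hg, dist_eq_norm, ← AddCircle.coe_sub]
  refine (QuotientAddGroup.norm_mk_le_norm).trans ((hF.abs_sub_le_mul hf hG hg t).trans
    (mul_le_of_le_one_right dist_nonneg ?_))
  rw [abs_of_nonneg h0]
  exact h1.le

/-- Among expanding maps fixing the origin, the `C¹` topology is that of uniform convergence of the
derivatives. -/
theorem isInducing_derivative :
    IsInducing fun f : expandingMapsFixingZero => (f : C1CircleMap).derivative := by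
  have hp : IsInducing fun f : expandingMapsFixingZero =>
      ((f : C1CircleMap).toContinuousMap, (f : C1CircleMap).derivative) :=
    (IsInducing.mk rfl : IsInducing fun f : C1CircleMap => (f.toContinuousMap, f.derivative)).comp
      IsInducing.subtypeVal
  rw [isInducing_iff_nhds]
  intro f
  refine le_antisymm (continuous_snd.comp hp.continuous).continuousAt.tendsto.le_comap ?_
  rw [hp.nhds_eq_comap, ← tendsto_iff_comap, nhds_prod_eq]
  refine Tendsto.prodMk ?_ tendsto_comap
  rw [tendsto_iff_dist_tendsto_zero]
  have h1 : Tendsto (fun g : expandingMapsFixingZero =>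
      dist (g : C1CircleMap).derivative (f : C1CircleMap).derivative)
      (comap (fun g : expandingMapsFixingZero => (g : C1CircleMap).derivative)
        (𝓝 (f : C1CircleMap).derivative)) (𝓝 0) :=
    tendsto_iff_dist_tendsto_zero.1 tendsto_comap
  exact squeeze_zero (fun _ => dist_nonneg) (fun g => dist_toContinuousMap_le g f) h1

theorem continuous_derivative :
    Continuous fun f : expandingMapsFixingZero => (f : C1CircleMap).derivative :=
  isInducing_derivative.continuous

end topology

section transferContinuity

theorem abs_div_sub_div_le {a b p q : ℝ} (hp : 1 < |p|) (hq : 1 < |q|) :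
    |(a / |p| - b / |q|)| ≤ |a - b| + |b| * |p - q| := by
  have h1 : a / |p| - b / |q| = (a - b) / |p| + b * (|q| - |p|) / (|p| * |q|) := by
    field_simp
    ring
  rw [h1]
  refine (abs_add_le _ _).trans (add_le_add ?_ ?_)
  · rw [abs_div, abs_abs]
    exact div_le_self (abs_nonneg _) hp.le
  · rw [abs_div, abs_mul, abs_mul, abs_abs, abs_abs]
    refine (div_le_self (by positivity) (one_le_mul_of_one_le_of_one_le hp.le hq.le)).trans ?_
    rw [abs_sub_comm p q]
    exact mul_le_mul_of_nonneg_left (abs_abs_sub_abs_le _ _) (abs_nonneg _)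

/-- The transfer operator depends continuously on the map and the function. -/
theorem tendsto_transferC {f : expandingMapsFixingZero}
    {U : expandingMapsFixingZero → C(UnitAddCircle, ℝ)} {u : C(UnitAddCircle, ℝ)}
    (hU : Tendsto U (𝓝 f) (𝓝 u)) :
    Tendsto (fun g => transferC g (U g)) (𝓝 f) (𝓝 (transferC f u)) := by
  obtain ⟨F, d, hF, hf⟩ := exists_isExpandingLift f.2
  have hD : Tendsto (fun g : expandingMapsFixingZero =>
      dist (f : C1CircleMap).derivative (g : C1CircleMap).derivative) (𝓝 f) (𝓝 0) := by
    have := (continuous_const (y := (f : C1CircleMap).derivative)).dist continuous_derivative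
    simpa using this.tendsto f
  have hUd := tendsto_iff_dist_tendsto_zero.1 hU
  rw [Metric.tendsto_nhds]
  intro ε hε
  set η := ε / (d.natAbs + 1) / 4 with hη
  have hη0 : 0 < η := by positivity
  set κ : C(UnitAddCircle, ℝ) := ⟨fun y => u y / |(f : C1CircleMap).derivative y|,
    u.continuous.div (f : C1CircleMap).derivative.continuous.abs fun y =>
      (zero_lt_one.trans (C1CircleMap.one_lt_abs_derivative f.2 y)).ne'⟩ with hκ
  obtain ⟨δ, hδ, hκδ⟩ := exists_delta_abs_sub_lt κ hη0
  have hnu : 0 < ‖u‖ + 1 := by positivity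
  filter_upwards [hD.eventually_lt_const zero_lt_one, hD.eventually_lt_const hδ,
    hD.eventually_lt_const (show 0 < η / (‖u‖ + 1) by positivity),
    hUd.eventually_lt_const hη0] with g h1 h2 h3 h4
  obtain ⟨G, e, hG, hg⟩ := exists_isExpandingLift g.2
  obtain rfl := hF.degree_eq hf hG hg h1
  -- Each of the `|d|` inverse branches contributes at most `3η`: one `η` each for the change of
  -- function, of derivative and of preimage.
  have hbound : ∀ x, dist (transferC g (U g) x) (transferC f u x) ≤ d.natAbs * (3 * η) := by
    refine UnitAddCircle.induction fun x => ?_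
    rw [Real.dist_eq, transferC_apply, transferC_apply, C1CircleMap.transfer, C1CircleMap.transfer,
      hG.fiberSum_coe hg, hF.fiberSum_coe hf, ← Finset.sum_sub_distrib]
    refine (Finset.abs_sum_le_sum_abs _ _).trans ((Finset.sum_le_card_nsmul _ _ (3 * η)
      fun k _ => ?_).trans (by rw [Finset.card_range, nsmul_eq_mul]))
    set y := hF.inv (x + k)
    set z := hG.inv (x + k)
    have e1 : |κ (z : UnitAddCircle) - κ y| < η := by
      refine hκδ _ _ ?_
      rw [abs_sub_comm]
      exact (hF.abs_inv_sub_inv_le hf hG hg (x + k)).trans h2.le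
    have e2 : |U g z / |(g : C1CircleMap).derivative z| - κ z| ≤ 2 * η := by
      refine (abs_div_sub_div_le (C1CircleMap.one_lt_abs_derivative g.2 _)
        (C1CircleMap.one_lt_abs_derivative f.2 _)).trans ?_
      have i1 : |U g z - u z| ≤ η :=
        (ContinuousMap.dist_apply_le_dist (f := U g) (g := u) (z : UnitAddCircle)).trans h4.le
      have i2 : |u z| ≤ ‖u‖ := u.norm_coe_le_norm _
      have i3 : |(g : C1CircleMap).derivative z - (f : C1CircleMap).derivative z| ≤ η / (‖u‖ + 1) := by
        refine (ContinuousMap.dist_apply_le_dist (f := (g : C1CircleMap).derivative)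
          (g := (f : C1CircleMap).derivative) (z : UnitAddCircle)).trans ?_
        rw [dist_comm]
        exact h3.le
      have i4 : |u z| * |(g : C1CircleMap).derivative z - (f : C1CircleMap).derivative z| ≤
          (‖u‖ + 1) * (η / (‖u‖ + 1)) := by gcongr; linarith
      rw [mul_div_cancel₀ _ hnu.ne'] at i4
      linarith
    have e3 := abs_add_le (U g z / |(g : C1CircleMap).derivative z| - κ z) (κ z - κ y)
    rw [sub_add_sub_cancel] at e3
    refine e3.trans ?_
    linarith
  refine lt_of_le_of_lt ((ContinuousMap.dist_le (by positivity)).2 hbound) ?_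
  have : (d.natAbs + 1 : ℝ) * (4 * η) = ε := by
    rw [hη]
    field_simp
  nlinarith [(Nat.cast_nonneg d.natAbs : (0 : ℝ) ≤ d.natAbs)]

theorem tendsto_transferC_pow (f : expandingMapsFixingZero) (u : C(UnitAddCircle, ℝ)) (n : ℕ) :
    Tendsto (fun g => (transferC g ^ n) u) (𝓝 f) (𝓝 ((transferC f ^ n) u)) := by
  induction n with
  | zero => exact tendsto_const_nhds
  | succ n ih =>
    simp only [pow_succ', Module.End.mul_apply]
    exact tendsto_transferC ih

end transferContinuity

/-! ### Density of maps with Lipschitz derivative and of maps with spread densities -/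

section density

/-- Maps with Lipschitz derivative are `C¹` dense. -/
theorem exists_lipschitz_deriv_near (f : expandingMapsFixingZero) {η : ℝ} (hη : 0 < η) :
    ∃ (g : expandingMapsFixingZero) (G : ℝ → ℝ) (d : ℤ) (c : ℝ), IsExpandingLift G d ∧
      (g : C1CircleMap).IsLift G ∧ (∀ x y, |deriv G x - deriv G y| ≤ c * |x - y|) ∧
      dist (g : C1CircleMap).derivative (f : C1CircleMap).derivative ≤ η := by
  obtain ⟨F, d, hF, hf⟩ := exists_isExpandingLift f.2
  obtain ⟨h, hh, hδ⟩ := exists_delta_abs_sub_lt (f : C1CircleMap).derivative hη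
  simp only [(f : C1CircleMap).derivative_coe hf hF.continuous] at hδ
  obtain ⟨r, hr, hFr⟩ := hF.exists_rate
  set M := ‖(f : C1CircleMap).derivative‖
  have hM : ∀ x, |deriv F x| ≤ M := fun x => by
    rw [← (f : C1CircleMap).derivative_coe hf hF.continuous]
    exact (f : C1CircleMap).derivative.norm_coe_le_norm _
  have hFM : ∀ x y, |F x - F y| ≤ M * |x - y| := fun x y =>
    Convex.norm_image_sub_le_of_norm_deriv_le (s := Set.univ) (fun z _ => hF.differentiable z)
      (fun z _ => hM z) convex_univ trivial trivial
  set Φ : ℝ → ℝ := fun x => ∫ t in (0 : ℝ)..x, F t with hΦ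
  have hΦd : ∀ x, HasDerivAt Φ (F x) x := fun x => by
    exact intervalIntegral.integral_hasDerivAt_right (hF.continuous.intervalIntegrable _ _)
      hF.continuous.aestronglyMeasurable.stronglyMeasurableAtFilter hF.continuous.continuousAt
  -- The average of `F` over `[x, x + h]`, shifted so as to vanish at `0`. Its derivative is a
  -- difference quotient of `F`: Lipschitz because `F` is, bounded below in modulus by the expansion
  -- rate, and equal to a value of `F'` at distance at most `h`.
  set G : ℝ → ℝ := fun x => (Φ (x + h) - Φ x - Φ h) / h with hG
  have hGd : ∀ x, HasDerivAt G ((F (x + h) - F x) / h) x := fun x =>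
    ((((hΦd (x + h)).comp_add_const x h).sub (hΦd x)).sub_const _).div_const h
  have hGderiv : deriv G = fun x => (F (x + h) - F x) / h := funext fun x => (hGd x).deriv
  have hGlift : IsExpandingLift G d := by
    refine ⟨?_, ?_, fun x => ?_, fun x => ?_⟩
    · rw [contDiff_one_iff_deriv, hGderiv]
      refine ⟨fun x => (hGd x).differentiableAt, ?_⟩
      exact ((hF.continuous.comp (continuous_add_const h)).sub hF.continuous).div_const h
    · simp [hG, hΦ]
    -- The integral of `F` over a unit interval grows linearly with slope `d`; comparing it at `x +
    -- h` and at `x` gives the degree of `G`.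
    · have hψ : ∀ x, HasDerivAt (fun x => Φ (x + 1) - Φ x - d * x) 0 x := fun x => by
        have := ((((hΦd (x + 1)).comp_add_const x 1).sub (hΦd x)).sub
          ((hasDerivAt_id x).const_mul (d : ℝ)))
        rw [hF.map_add_one] at this
        refine this.congr_deriv ?_
        ring
      have hc := is_const_of_deriv_eq_zero (fun x => (hψ x).differentiableAt)
        (fun x => (hψ x).deriv) (x + h) x
      have e : x + 1 + h = x + h + 1 := by ring
      simp only [hG]
      rw [e, div_add' _ _ _ hh.ne']
      congr 1
      linarith
    · rw [hGderiv, abs_div, abs_of_pos hh, lt_div_iff₀ hh]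
      have := hF.mul_abs_sub_le hFr (x + h) x
      rw [add_sub_cancel_left, abs_of_pos hh] at this
      nlinarith
  refine ⟨⟨hGlift.toC1CircleMap, hGlift.mem_expandingMapsFixingZero hGlift.isLift_toC1CircleMap⟩,
    G, d, 2 * M / h, hGlift, hGlift.isLift_toC1CircleMap, fun x y => ?_, ?_⟩
  · rw [hGderiv]
    simp only
    rw [← sub_div, abs_div, abs_of_pos hh, div_mul_eq_mul_div, div_le_div_iff_of_pos_right hh]
    have e1 := hFM (x + h) (y + h)
    have e2 := hFM x y
    rw [add_sub_add_right_eq_sub] at e1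
    have e3 : F (x + h) - F x - (F (y + h) - F y) = (F (x + h) - F (y + h)) - (F x - F y) := by ring
    rw [e3]
    exact (abs_sub _ _).trans (by linarith)
  · refine (ContinuousMap.dist_le hη.le).2 (UnitAddCircle.induction fun x => ?_)
    change dist (hGlift.toC1CircleMap.derivative (x : UnitAddCircle)) _ ≤ η
    rw [C1CircleMap.derivative_coe _ hGlift.isLift_toC1CircleMap hGlift.continuous,
      C1CircleMap.derivative_coe _ hf hF.continuous, hGderiv, Real.dist_eq]
    obtain ⟨ξ, hξ, hξe⟩ := exists_deriv_eq_slope F (lt_add_of_pos_right x hh)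
      hF.continuous.continuousOn hF.differentiable.differentiableOn
    rw [add_sub_cancel_left] at hξe
    simp only
    rw [← hξe]
    refine (hδ ξ x ?_).le
    rw [abs_of_pos (sub_pos.2 hξ.1)]
    linarith [hξ.2]

/-- The density `q` spreads over all scales: no window of ratio `Λ` has measure over `η`. -/
def IsSpread (q : C(UnitAddCircle, ℝ)) (Λ η : ℝ) : Prop :=
  ∀ s, 0 < s → volume.real {x | s ≤ q x ∧ q x ≤ Λ * s} ≤ η

/-- The map is conjugated by the diffeomorphism `h` whose derivative is a normalised spread function
`W`. The derivative changes little, because `W` varies slowly along orbits and `h` is near the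
identity. In the old coordinate the new density is `(J + 1) ρ / W`, and Lebesgue measure becomes `W
/ (J + 1)`, so a window of the density is controlled by the `W`-mass of a window of `W`. -/
theorem HasMixingDensity.exists_isSpread_near {f : expandingMapsFixingZero}
    {ρ : C(UnitAddCircle, ℝ)} (h : HasMixingDensity f ρ) {Λ η : ℝ} (hΛ : 1 ≤ Λ) (hη : 0 < η) :
    ∃ (g : expandingMapsFixingZero) (q : C(UnitAddCircle, ℝ)), HasMixingDensity g q ∧
      IsSpread q Λ η ∧ dist (g : C1CircleMap).derivative (f : C1CircleMap).derivative ≤ η := by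
  obtain ⟨F, d, hF, hf⟩ := exists_isExpandingLift f.2
  obtain ⟨p, hp, hpρ⟩ := h.exists_pos_le
  obtain ⟨r, hr, hFr⟩ := hF.exists_rate
  have hpn : p ≤ ‖ρ‖ := (hpρ 0).trans ((Real.le_norm_self _).trans (ρ.norm_coe_le_norm 0))
  have hρ0 : 0 < ‖ρ‖ := hp.trans_le hpn
  -- The ratio is enlarged by the oscillation of `ρ`, since only `ρ / W` is seen in the end.
  set Λ' := Λ * ‖ρ‖ / p with hΛ'
  have hΛ'1 : 1 ≤ Λ' := by
    rw [hΛ', le_div_iff₀ hp, one_mul]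
    nlinarith
  -- The derivative will move by at most `2η'`, which is less than `r - 1`, so the conjugate map
  -- still expands.
  set η' := min η (r - 1) / 4 with hη'
  have hη'0 : 0 < η' := by
    have : 0 < min η (r - 1) := lt_min hη (by linarith)
    positivity
  obtain ⟨J, hJ⟩ := exists_nat_gt (2 / η)
  obtain ⟨δ₁, hδ₁, hu⟩ := exists_delta_abs_sub_lt (f : C1CircleMap).derivative hη'0
  simp only [(f : C1CircleMap).derivative_coe hf hF.continuous] at hu
  set M := ‖(f : C1CircleMap).derivative‖ with hMdef
  have hM : ∀ x, |deriv F x| ≤ M := fun x => by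
    rw [← (f : C1CircleMap).derivative_coe hf hF.continuous]
    exact (f : C1CircleMap).derivative.norm_coe_le_norm _
  have hM0 : 0 ≤ M := norm_nonneg _
  set δ := min (min 1 δ₁) (η' / (M + 1)) with hδ
  have hδ0 : 0 < δ := lt_min (lt_min one_pos hδ₁) (by positivity)
  have hδM : δ * M ≤ η' := by
    have h1 : δ ≤ η' / (M + 1) := min_le_right _ _
    rw [le_div_iff₀ (by positivity)] at h1
    nlinarith
  obtain ⟨W, hW1, hWint, hWcdf, hWs1, hWs2, hWwin⟩ := h.exists_spread hΛ'1 J δ hδ0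
  have hJ0 : (0 : ℝ) < J + 1 := by positivity
  set w : C(UnitAddCircle, ℝ) := ((J : ℝ) + 1)⁻¹ • W with hwdef
  have hwx : ∀ x, w x = ((J : ℝ) + 1)⁻¹ * W x := fun x => rfl
  have hw : IsPosDensity w := by
    refine ⟨fun x => mul_pos (inv_pos.2 hJ0) (zero_lt_one.trans_le (hW1 x)), ?_⟩
    simp only [hwx]
    rw [integral_const_mul, hWint, inv_mul_cancel₀ hJ0.ne']
  have hclose : ∀ x ∈ Set.Icc (0 : ℝ) 1, |primitiveLift w x - x| ≤ δ := fun x hx => by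
    unfold primitiveLift
    simp only [hwx]
    rw [intervalIntegral.integral_const_mul]
    have e : ((J : ℝ) + 1)⁻¹ * (∫ t in (0 : ℝ)..x, W t) - x =
        ((J : ℝ) + 1)⁻¹ * ((∫ t in (0 : ℝ)..x, W t) - (J + 1) * x) := by field_simp
    rw [e, abs_mul, abs_of_pos (inv_pos.2 hJ0)]
    exact (mul_le_of_le_one_left (abs_nonneg _) (inv_le_one_of_one_le₀ (by
      have : (0 : ℝ) ≤ J := J.cast_nonneg
      linarith))).trans (hWcdf x hx)
  have hderiv : ∀ x, |deriv (hw.conj F) x - deriv F x| ≤ 2 * η' := fun x => by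
    set y := hw.inv x with hy
    have e1 : |deriv F y - deriv F x| < η' :=
      hu y x ((hw.abs_inv_sub_le hclose x).trans ((min_le_left _ _).trans (min_le_right _ _)))
    have hWy : 0 < W (y : UnitAddCircle) := zero_lt_one.trans_le (hW1 _)
    have hfy : (f : C1CircleMap) (y : UnitAddCircle) = (F y : ℝ) := hf y
    have s1 := hWs1 y
    have s2 := hWs2 y
    rw [hfy] at s1 s2
    have e2 : |w (F y : ℝ) * (w (y : UnitAddCircle))⁻¹ - 1| ≤ δ := by
      have : w (F y : ℝ) * (w (y : UnitAddCircle))⁻¹ = W (F y : ℝ) / W (y : UnitAddCircle) := by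
        rw [hwx, hwx]
        field_simp
      rw [this, div_sub_one hWy.ne', abs_div, abs_of_pos hWy, div_le_iff₀ hWy, abs_le]
      constructor
      · by_contra hcon
        rw [not_le] at hcon
        have hlt : W (F y : ℝ) < (1 - δ) * W (y : UnitAddCircle) := by linarith
        have : (1 + δ) * W (F y : ℝ) < (1 + δ) * ((1 - δ) * W (y : UnitAddCircle)) := by gcongr
        nlinarith [mul_pos (mul_pos hδ0 hδ0) hWy]
      · linarith
    rw [(hw.hasDerivAt_conj hF x).deriv]
    have e3 : w (F (hw.inv x) : ℝ) * (deriv F (hw.inv x) * (w (hw.inv x : ℝ))⁻¹) - deriv F x =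
        (w (F y : ℝ) * (w (y : UnitAddCircle))⁻¹ - 1) * deriv F y + (deriv F y - deriv F x) := by
      rw [← hy]
      ring
    rw [e3]
    refine (abs_add_le _ _).trans ?_
    rw [abs_mul]
    have e4 : |w (F y : ℝ) * (w (y : UnitAddCircle))⁻¹ - 1| * |deriv F y| ≤ δ * M := by
      gcongr
      exact hM y
    linarith
  have hη'1 : 2 * η' ≤ η := by
    linarith [min_le_left η (r - 1)]
  have hη'2 : 2 * η' < r - 1 := by
    rw [hη']
    linarith [min_le_right η (r - 1)]
  have hGlift : IsExpandingLift (hw.conj F) d := by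
    refine hw.isExpandingLift_conj hF fun x => ?_
    have h1 := (abs_sub_abs_le_abs_sub (deriv F x) (deriv (hw.conj F) x)).trans
      ((abs_sub_comm _ _).trans_le (hderiv x))
    linarith [hFr x]
  set g : expandingMapsFixingZero := ⟨hGlift.toC1CircleMap,
    hGlift.mem_expandingMapsFixingZero hGlift.isLift_toC1CircleMap⟩
  have hg : (g : C1CircleMap).IsLift (hw.conj F) := hGlift.isLift_toC1CircleMap
  refine ⟨g, (ρ * hw.recip).comp hw.circleMapInv, hw.hasMixingDensity_conj hF hf hGlift hg h,
    fun s hs => ?_, ?_⟩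
  · have hSm := measurableSet_window ((ρ * hw.recip).comp hw.circleMapInv) s (Λ * s)
    rw [← integral_indicator_one hSm, hw.integral_eq_integral_mul]
    -- With `p ≤ ρ ≤ ‖ρ‖`, a density value `(J + 1) ρ / W` in `[s, Λ s]` forces `W` into `[t, Λ'
    -- t]`.
    set t := (J + 1) * p / (Λ * s) with ht
    have hΛs : 0 < Λ * s := by positivity
    have h1 : ∀ x, w x * Set.indicator {x | s ≤ ((ρ * hw.recip).comp hw.circleMapInv) x ∧
        ((ρ * hw.recip).comp hw.circleMapInv) x ≤ Λ * s} 1 (hw.circleMap x) ≤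
        ((J : ℝ) + 1)⁻¹ * {x | t ≤ W x ∧ W x ≤ Λ' * t}.indicator W x := by
      intro x
      by_cases hx : hw.circleMap x ∈ {x | s ≤ ((ρ * hw.recip).comp hw.circleMapInv) x ∧
        ((ρ * hw.recip).comp hw.circleMapInv) x ≤ Λ * s}
      · rw [Set.indicator_of_mem hx]
        obtain ⟨hx1, hx2⟩ := hx
        have hq : ((ρ * hw.recip).comp hw.circleMapInv) (hw.circleMap x) = (J + 1) * ρ x / W x := by
          simp only [ContinuousMap.comp_apply, IsPosDensity.circleMapInv_circleMap,
            ContinuousMap.mul_apply]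
          change ρ x * (w x)⁻¹ = _
          rw [hwx]
          field_simp
        have hWx : 0 < W x := zero_lt_one.trans_le (hW1 x)
        rw [hq, le_div_iff₀ hWx] at hx1
        rw [hq, div_le_iff₀ hWx] at hx2
        have hρx : ρ x ≤ ‖ρ‖ := (Real.le_norm_self _).trans (ρ.norm_coe_le_norm x)
        have hmem : x ∈ {x | t ≤ W x ∧ W x ≤ Λ' * t} := by
          constructor
          · rw [ht, div_le_iff₀ hΛs]
            have := hpρ x
            nlinarith
          · have : Λ' * t = (J + 1) * ‖ρ‖ / s := by
              rw [hΛ', ht]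
              field_simp
            rw [this, le_div_iff₀ hs]
            nlinarith
        rw [Set.indicator_of_mem hmem, Pi.one_apply, mul_one, hwx]
      · rw [Set.indicator_of_notMem hx, mul_zero]
        exact mul_nonneg (inv_nonneg.2 hJ0.le) (Set.indicator_nonneg
          (fun y _ => zero_le_one.trans (hW1 y)) _)
    have hint := (UnitAddCircle.integrable_continuousMap W).indicator
      (measurableSet_window W t (Λ' * t))
    refine (integral_mono_of_nonneg (ae_of_all _ fun x => mul_nonneg (hw.pos x).le
      (Set.indicator_nonneg (fun _ _ => zero_le_one) _)) (hint.const_mul _)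
      (ae_of_all _ h1)).trans ?_
    rw [integral_const_mul, integral_indicator (measurableSet_window W t (Λ' * t)),
      inv_mul_le_iff₀ hJ0]
    have h2 := hWwin t
    have h3 : δ ≤ 1 := (min_le_left _ _).trans (min_le_left _ _)
    rw [div_lt_iff₀ hη] at hJ
    nlinarith
  · refine (ContinuousMap.dist_le hη.le).2 (UnitAddCircle.induction fun x => ?_)
    rw [C1CircleMap.derivative_coe _ hg hGlift.continuous,
      C1CircleMap.derivative_coe _ hf hF.continuous, Real.dist_eq]
    exact (hderiv x).trans hη'1

end density

/-! ### Maximal inequalities -/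

/-- Hopf's maximal ergodic inequality for a positive operator preserving integrals. -/
theorem exists_setIntegral_nonneg_of_positive {X : Type*} [MeasurableSpace X] {μ : Measure X}
    (P : (X → ℝ) →ₗ[ℝ] (X → ℝ)) (hpos : ∀ u, 0 ≤ u → 0 ≤ P u)
    (hmeas : ∀ u, Measurable u → Measurable (P u)) (hint : ∀ u, Integrable u μ → Integrable (P u) μ)
    (heq : ∀ u, Integrable u μ → ∫ x, P u x ∂μ = ∫ x, u x ∂μ) {u : X → ℝ} (hu : Measurable u)
    (hui : Integrable u μ) (N : ℕ) :
    ∃ E, MeasurableSet E ∧ 0 ≤ ∫ x in E, u x ∂μ ∧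
      ∀ x ∉ E, ∑ k ∈ Finset.range N, (P ^ k) u x ≤ 0 := by
  have hmono : ∀ u v, u ≤ v → P u ≤ P v := fun u v h => by
    have := hpos (v - u) (sub_nonneg.2 h)
    rwa [map_sub, sub_nonneg] at this
  -- Garsia's argument. This recursion gives an increasing nonnegative sequence that dominates the
  -- partial sums, by positivity alone.
  let M : ℕ → X → ℝ := fun n => Nat.rec 0 (fun _ v => 0 ⊔ (u + P v)) n
  have M0 : M 0 = 0 := rfl
  have Ms : ∀ n, M (n + 1) = 0 ⊔ (u + P (M n)) := fun n => rfl
  have Mnn : ∀ n, 0 ≤ M n := fun n => by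
    cases n with
    | zero => exact le_rfl
    | succ n => rw [Ms]; exact le_sup_left
  have Mm : ∀ n, Measurable (M n) := fun n => by
    induction n with
    | zero => exact measurable_const
    | succ n ih => rw [Ms]; exact measurable_const.sup (hu.add (hmeas _ ih))
  have Mi : ∀ n, Integrable (M n) μ := fun n => by
    induction n with
    | zero => exact integrable_zero _ _ _
    | succ n ih => rw [Ms]; exact (integrable_zero _ _ _).sup (hui.add (hint _ ih))
  have Mle : ∀ n, M n ≤ M (n + 1) := fun n => by
    induction n with
    | zero => exact Mnn 1
    | succ n ih =>
      rw [Ms n, Ms (n + 1)]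
      exact sup_le_sup_left (add_le_add_right (hmono _ _ ih) u) 0
  have MS : ∀ n, ∑ k ∈ Finset.range n, (P ^ k) u ≤ M n := fun n => by
    induction n with
    | zero => simp [M0]
    | succ n ih =>
      rw [Ms, Finset.sum_range_succ']
      refine le_trans ?_ le_sup_right
      have h := hmono _ _ ih
      rw [map_sum] at h
      rw [add_comm]
      refine add_le_add (by simp) (le_trans (le_of_eq ?_) h)
      exact Finset.sum_congr rfl fun k _ => by rw [pow_succ']; rfl
  refine ⟨{x | 0 < M N x}, measurableSet_lt measurable_const (Mm N), ?_, fun x hx => ?_⟩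
  · have hE : MeasurableSet {x | 0 < M N x} := measurableSet_lt measurable_const (Mm N)
    -- Where `M N` is positive it equals `u + P (M (N - 1))`, hence is at most `u + P (M N)`.
    -- Integrating and using that `P` preserves integrals bounds the integral of `u` below by `0`.
    have h1 : ∫ x in {x | 0 < M N x}, (M N x - P (M N) x) ∂μ ≤ ∫ x in {x | 0 < M N x}, u x ∂μ := by
      refine setIntegral_mono_on ((Mi N).sub (hint _ (Mi N))).integrableOn hui.integrableOn hE
        fun x hx => ?_
      cases N with
      | zero => exact absurd hx (by simp [M0])
      | succ n =>
        have h2 : M (n + 1) x = max 0 (u x + P (M n) x) := rfl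
        have h3 : P (M n) x ≤ P (M (n + 1)) x := hmono _ _ (Mle n) x
        have h4 : 0 < M (n + 1) x := hx
        rcases max_choice 0 (u x + P (M n) x) with h | h <;> rw [h] at h2 <;> linarith
    refine le_trans ?_ h1
    rw [integral_sub (Mi N).integrableOn (hint _ (Mi N)).integrableOn]
    have h2 : ∫ x in {x | 0 < M N x}, M N x ∂μ = ∫ x, M N x ∂μ :=
      setIntegral_eq_integral_of_forall_compl_eq_zero fun x hx =>
        le_antisymm (not_lt.1 hx) (Mnn N x)
    have h3 : ∫ x in {x | 0 < M N x}, P (M N) x ∂μ ≤ ∫ x, P (M N) x ∂μ :=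
      setIntegral_le_integral (hint _ (Mi N)) (Eventually.of_forall (hpos _ (Mnn N)))
    rw [heq _ (Mi N)] at h3
    linarith
  · have h := MS N x
    rw [Finset.sum_apply] at h
    exact h.trans (not_lt.1 hx)

theorem UnitAddCircle.measurable_of_comp_coe {g : UnitAddCircle → ℝ}
    (hg : Measurable fun x : ℝ => g x) : Measurable g := by
  have h : g = (fun x : ℝ => g x) ∘ Subtype.val ∘ AddCircle.measurableEquivIoc (1 : ℝ) 0 := by
    funext x
    exact congrArg g ((AddCircle.measurableEquivIoc (1 : ℝ) 0).symm_apply_apply x).symm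
  rw [h]
  exact hg.comp (measurable_subtype_coe.comp (MeasurableEquiv.measurable _))

namespace C1CircleMap

variable {f : C1CircleMap} (hf : f ∈ expandingMapsFixingZero)
include hf

theorem measurable_transfer {u : UnitAddCircle → ℝ} (hu : Measurable u) :
    Measurable (f.transfer u) := by
  obtain ⟨F, d, hF, hFf⟩ := exists_isExpandingLift hf
  refine UnitAddCircle.measurable_of_comp_coe ?_
  simp only [hF.transfer_coe hFf]
  have h1 : ∀ k : ℕ, Continuous fun x : ℝ => hF.inv (x + k) := fun k =>
    hF.continuous_inv.comp (continuous_id.add_const _)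
  refine Finset.measurable_fun_sum _ fun k _ => Measurable.div ?_ ?_
  · exact hu.comp ((AddCircle.continuous_mk' (1 : ℝ)).comp (h1 k)).measurable
  · exact ((hF.contDiff.continuous_deriv le_rfl).comp (h1 k)).abs.measurable

theorem integrable_transfer_pow {u : UnitAddCircle → ℝ} (hu : Integrable u) (n : ℕ) :
    Integrable ((transferₗ hf ^ n) u) := by
  induction n with
  | zero => exact hu
  | succ n ih => rw [pow_succ']; exact integrable_transfer hf ih

theorem transfer_pow_mono {u v : UnitAddCircle → ℝ} (huv : u ≤ v) (n : ℕ) :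
    (transferₗ hf ^ n) u ≤ (transferₗ hf ^ n) v := by
  induction n with
  | zero => exact huv
  | succ n ih => rw [pow_succ']; exact transfer_mono hf ih

theorem transfer_pow_mul_comp (u v : UnitAddCircle → ℝ) (n : ℕ) :
    (transferₗ hf ^ n) (fun y => u y * v (f^[n] y)) = fun x => (transferₗ hf ^ n) u x * v x := by
  induction n generalizing v with
  | zero => rfl
  | succ n ih =>
    rw [pow_succ', Module.End.mul_apply, Module.End.mul_apply]
    simp only [Function.iterate_succ_apply']
    rw [ih fun y => v (f y)]
    exact transfer_mul_comp hf _ v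

theorem integral_transfer_pow {u : UnitAddCircle → ℝ} (hu : Integrable u) (n : ℕ) :
    ∫ x, (transferₗ hf ^ n) u x = ∫ x, u x := by
  induction n with
  | zero => rfl
  | succ n ih =>
    rw [← ih, pow_succ']
    exact integral_transfer hf (integrable_transfer_pow hf hu n)

end C1CircleMap

namespace C1CircleMap

variable {f : C1CircleMap} (hf : f ∈ expandingMapsFixingZero)

/-- The sum of the first `N` iterates of the transfer operator. -/
noncomputable def transferSum (N : ℕ) : (UnitAddCircle → ℝ) →ₗ[ℝ] (UnitAddCircle → ℝ) :=
  ∑ n ∈ Finset.range N, transferₗ hf ^ n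

theorem transferSum_apply (N : ℕ) (u : UnitAddCircle → ℝ) (x : UnitAddCircle) :
    transferSum hf N u x = ∑ n ∈ Finset.range N, (transferₗ hf ^ n) u x := by
  simp [transferSum, LinearMap.sum_apply, Finset.sum_apply]

theorem transferSum_mono (N : ℕ) {u v : UnitAddCircle → ℝ} (huv : u ≤ v) :
    transferSum hf N u ≤ transferSum hf N v := fun x => by
  rw [transferSum_apply, transferSum_apply]
  exact Finset.sum_le_sum fun n _ => transfer_pow_mono hf huv n x

theorem integrable_transferSum (N : ℕ) {u : UnitAddCircle → ℝ} (hu : Integrable u) :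
    Integrable (transferSum hf N u) := by
  have : transferSum hf N u = fun x => ∑ n ∈ Finset.range N, (transferₗ hf ^ n) u x :=
    funext (transferSum_apply hf N u)
  rw [this]
  exact integrable_finsetSum _ fun n _ => integrable_transfer_pow hf hu n

theorem transfer_nonneg {u : UnitAddCircle → ℝ} (hu : 0 ≤ u) : 0 ≤ transferₗ hf u := by
  have h := transfer_mono hf hu
  have h0 : f.transfer (0 : UnitAddCircle → ℝ) = 0 := (transferₗ hf).map_zero
  rwa [h0] at h

theorem continuous_self (f : C1CircleMap) : Continuous f := f.toContinuousMap.continuous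

/-- Termwise duality: the expected number of visits to `B` from a Lebesgue start in `D` is the mass
that `Σ Lⁿ 1_D` gives to `B`. This links orbit counts to the transfer operator. -/
theorem setIntegral_birkhoffSum_indicator (N : ℕ) {D B : Set UnitAddCircle} (hD : MeasurableSet D)
    (hB : MeasurableSet B) :
    ∫ x in D, ∑ n ∈ Finset.range N, B.indicator (1 : UnitAddCircle → ℝ) (f^[n] x) =
      ∫ x in B, transferSum hf N (D.indicator 1) x := by
  have hcont : ∀ n, Measurable f^[n] := fun n => (f.continuous_self.iterate n).measurable
  have hD1 : Integrable (D.indicator (1 : UnitAddCircle → ℝ)) :=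
    (integrable_const (1 : ℝ)).indicator hD
  have hDB : ∀ n, Integrable fun x => D.indicator (1 : UnitAddCircle → ℝ) x *
      B.indicator (1 : UnitAddCircle → ℝ) (f^[n] x) := fun n => by
    have h := (integrable_const (1 : ℝ)).indicator (hD.inter (hcont n hB)) (μ := volume)
    refine h.congr (Eventually.of_forall fun x => ?_)
    by_cases h1 : x ∈ D <;> by_cases h2 : f^[n] x ∈ B <;> simp [h1, h2]
  rw [← integral_indicator hD, ← integral_indicator hB]
  have e1 : (D.indicator fun x => ∑ n ∈ Finset.range N,
      B.indicator (1 : UnitAddCircle → ℝ) (f^[n] x)) = fun x => ∑ n ∈ Finset.range N,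
      D.indicator (1 : UnitAddCircle → ℝ) x * B.indicator (1 : UnitAddCircle → ℝ) (f^[n] x) := by
    funext x
    by_cases h1 : x ∈ D <;> simp [h1]
  have e2 : (B.indicator fun x => transferSum hf N (D.indicator 1) x) =
      fun x => ∑ n ∈ Finset.range N, (transferₗ hf ^ n) (fun y =>
        D.indicator (1 : UnitAddCircle → ℝ) y * B.indicator (1 : UnitAddCircle → ℝ) (f^[n] y)) x := by
    funext x
    simp only [transfer_pow_mul_comp]
    by_cases h1 : x ∈ B <;> simp [h1, transferSum_apply]
  rw [e1, e2, integral_finsetSum _ fun n _ => hDB n,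
    integral_finsetSum _ fun n _ => integrable_transfer_pow hf (hDB n) n]
  exact Finset.sum_congr rfl fun n _ => (integral_transfer_pow hf (hDB n) n).symm

/-- Hopf's inequality for the transfer operator and `u - β 1_A`. It turns an `L¹` bound on `u` into
a pointwise bound on the transfer sums, relative to those of `1_A`, off a set with small trace on
`A`. -/
theorem exists_maximal_transferSum_le (N : ℕ) {u : UnitAddCircle → ℝ} (hum : Measurable u)
    (hu : Integrable u) (hu0 : 0 ≤ u) {A : Set UnitAddCircle} (hA : MeasurableSet A) {β : ℝ} :
    ∃ E, MeasurableSet E ∧ β * volume.real (A ∩ E) ≤ ∫ x, u x ∧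
      ∀ x ∉ E, transferSum hf N u x ≤ β * transferSum hf N (A.indicator 1) x := by
  have hA1 : Integrable (A.indicator (1 : UnitAddCircle → ℝ)) :=
    (integrable_const (1 : ℝ)).indicator hA
  obtain ⟨E, hE, h1, h2⟩ := exists_setIntegral_nonneg_of_positive (μ := volume) (transferₗ hf)
    (fun v hv => transfer_nonneg hf hv) (fun v => measurable_transfer hf)
    (fun v => integrable_transfer hf) (fun v => integral_transfer hf)
    (u := u - β • A.indicator 1) (hum.sub ((measurable_one.indicator hA).const_smul β))
    (hu.sub (hA1.smul β)) N
  refine ⟨E, hE, ?_, fun x hx => ?_⟩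
  · have h3 : ∫ x in E, (u - β • A.indicator (1 : UnitAddCircle → ℝ)) x =
        (∫ x in E, u x) - β * volume.real (A ∩ E) := by
      simp only [Pi.sub_apply, Pi.smul_apply, smul_eq_mul]
      rw [integral_sub hu.integrableOn (hA1.const_mul β).integrableOn, integral_const_mul,
        integral_indicator_one hA, measureReal_restrict_apply hA]
    have h4 := setIntegral_le_integral (s := E) hu (Eventually.of_forall hu0)
    linarith
  · have h3 := h2 x hx
    rw [← transferSum_apply, map_sub, map_smul] at h3
    simp only [Pi.sub_apply, Pi.smul_apply, smul_eq_mul] at h3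
    linarith

end C1CircleMap

/-- Hopf's inequality for the operator `u ↦ u ∘ f` and `1_B - t 1_C`. Only `B` and `C` need finite
measure, so an infinite `μ` is allowed. -/
theorem MeasureTheory.MeasurePreserving.exists_maximal_birkhoffSum_le {X : Type*}
    [MeasurableSpace X] {μ : Measure X} {f : X → X} (hf : MeasurePreserving f μ μ) (N : ℕ)
    {B C : Set X} (hB : MeasurableSet B) (hC : MeasurableSet C) (hμB : μ B ≠ ⊤) (hμC : μ C ≠ ⊤)
    (t : ℝ) :
    ∃ E, MeasurableSet E ∧ t * μ.real (C ∩ E) ≤ μ.real B ∧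
      ∀ x ∉ E, ∑ n ∈ Finset.range N, B.indicator (1 : X → ℝ) (f^[n] x) ≤
        t * ∑ n ∈ Finset.range N, C.indicator (1 : X → ℝ) (f^[n] x) := by
  have hind : ∀ {S : Set X}, MeasurableSet S → μ S ≠ ⊤ →
      Integrable (S.indicator (1 : X → ℝ)) μ := fun hS h =>
    (integrable_indicator_iff hS).2 (integrableOn_const h)
  have hpow : ∀ (u : X → ℝ) (n : ℕ) (x : X), (LinearMap.funLeft ℝ ℝ f ^ n) u x = u (f^[n] x) := by
    intro u n
    induction n with
    | zero => intro x; rfl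
    | succ n ih =>
      intro x
      rw [pow_succ', Function.iterate_succ_apply]
      exact ih _
  obtain ⟨E, hE, h1, h2⟩ := exists_setIntegral_nonneg_of_positive (μ := μ)
    (LinearMap.funLeft ℝ ℝ f) (fun v hv x => hv (f x)) (fun v hv => hv.comp hf.measurable)
    (fun v hv => hf.integrable_comp_of_integrable hv)
    (fun v hv => by
      have h := integral_map hf.aemeasurable (f := v) (by rw [hf.map_eq]; exact hv.1)
      rw [hf.map_eq] at h
      exact h.symm)
    (u := B.indicator 1 - t • C.indicator 1)
    ((measurable_one.indicator hB).sub ((measurable_one.indicator hC).const_smul t))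
    ((hind hB hμB).sub ((hind hC hμC).smul t)) N
  refine ⟨E, hE, ?_, fun x hx => ?_⟩
  · have h3 : ∫ x in E, (B.indicator (1 : X → ℝ) - t • C.indicator (1 : X → ℝ)) x ∂μ =
        μ.real (B ∩ E) - t * μ.real (C ∩ E) := by
      simp only [Pi.sub_apply, Pi.smul_apply, smul_eq_mul]
      rw [integral_sub (hind hB hμB).integrableOn ((hind hC hμC).const_mul t).integrableOn,
        integral_const_mul, integral_indicator_one hC, integral_indicator_one hB,
        measureReal_restrict_apply hC, measureReal_restrict_apply hB]
    have h4 : μ.real (B ∩ E) ≤ μ.real B := measureReal_mono Set.inter_subset_left hμB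
    linarith
  · have h3 := h2 x hx
    simp only [Pi.sub_apply, Pi.smul_apply, smul_eq_mul, hpow,
      Finset.sum_sub_distrib, ← Finset.mul_sum] at h3
    linarith

/-! ### An invariant measure against a spread density -/

namespace C1CircleMap

variable {f : C1CircleMap} (hf : f ∈ expandingMapsFixingZero)

theorem integrable_birkhoffSum_indicator (f : C1CircleMap) (N : ℕ) {B : Set UnitAddCircle}
    (hB : MeasurableSet B) :
    Integrable fun x => ∑ n ∈ Finset.range N, B.indicator (1 : UnitAddCircle → ℝ) (f^[n] x) := by
  refine integrable_finsetSum _ fun n _ => ?_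
  exact (integrable_const (1 : ℝ)).indicator ((f.continuous_self.iterate n).measurable hB)

-- The visit inequality for `μ` holds pointwise on `D`, so it may be integrated against Lebesgue
-- measure instead of `μ` and rewritten with transfer sums. Invariance of `μ` becomes a statement
-- about the transfer operator.
include hf in
theorem setIntegral_transferSum_le_of_invariant {μ : Measure UnitAddCircle}
    (hμ : MeasurePreserving f μ μ) (N : ℕ) {B C : Set UnitAddCircle} (hB : MeasurableSet B)
    (hC : MeasurableSet C) (hμB : μ B ≠ ⊤) (hμC : μ C ≠ ⊤) {t : ℝ} (ht : 0 ≤ t) :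
    ∃ D, MeasurableSet D ∧ D ⊆ C ∧ t * μ.real (C \ D) ≤ μ.real B ∧
      ∫ x in B, transferSum hf N (D.indicator 1) x ≤
        t * ∫ x in C, transferSum hf N (C.indicator 1) x := by
  obtain ⟨E, hE, h1, h2⟩ := hμ.exists_maximal_birkhoffSum_le N hB hC hμB hμC t
  have hD : MeasurableSet (C \ E) := hC.diff hE
  refine ⟨C \ E, hD, Set.sdiff_subset, ?_, ?_⟩
  · rwa [Set.sdiff_sdiff_right_self]
  · rw [← setIntegral_birkhoffSum_indicator hf N hD hB]
    have h3 : ∫ x in C \ E, ∑ n ∈ Finset.range N, B.indicator (1 : UnitAddCircle → ℝ) (f^[n] x) ≤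
        ∫ x in C \ E, t * ∑ n ∈ Finset.range N, C.indicator (1 : UnitAddCircle → ℝ) (f^[n] x) :=
      setIntegral_mono_on (integrable_birkhoffSum_indicator f N hB).integrableOn
        ((integrable_birkhoffSum_indicator f N hC).const_mul t).integrableOn hD
        fun x hx => h2 x hx.2
    refine h3.trans ?_
    rw [integral_const_mul, setIntegral_birkhoffSum_indicator hf N hD hC]
    refine mul_le_mul_of_nonneg_left ?_ ht
    refine setIntegral_mono_on
      (integrable_transferSum hf N ((integrable_const (1 : ℝ)).indicator hD)).integrableOn
      (integrable_transferSum hf N ((integrable_const (1 : ℝ)).indicator hC)).integrableOn hC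
      fun x _ => transferSum_mono hf N ?_ x
    exact Set.indicator_le_indicator_of_subset Set.sdiff_subset fun _ => zero_le_one

/-- Averages that follow a widely spread density `q` rule out an invariant measure comparable to
Lebesgue measure on `A`. -/
theorem not_comparable_of_transferSum_bounds {μ : Measure UnitAddCircle}
    (hμ : MeasurePreserving f μ μ) {A : Set UnitAddCircle} (hA : MeasurableSet A)
    {a c : ℝ} (ha : volume.real A = a) (ha0 : 0 < a) (hc : 0 < c) (hμA : μ A ≠ ⊤)
    (hlow : ∀ S ⊆ A, MeasurableSet S → c * volume.real S ≤ μ.real S)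
    (hup : ∀ S ⊆ A, MeasurableSet S → μ.real S ≤ 2 * c * volume.real S)
    {φ q χ : UnitAddCircle → ℝ} (hφ : Measurable φ) (hφi : Integrable φ) (hφ0 : 0 ≤ φ)
    (hφA : ∫ x, |A.indicator (1 : UnitAddCircle → ℝ) x - φ x| ≤ 5 / 10 ^ 7 * a)
    (hqm : Measurable q) {s : ℝ} (hs : 0 < s) {N : ℕ} (hN : 0 < N)
    (hχ1 : χ ≤ 1) (hχs : ∀ x, s < q x → χ x = 0)
    (hQφ : ∀ x, transferSum hf N φ x ≤ 2 * N * a * q x)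
    (hQχ : ∀ x, N * a * q x / 20 ≤ transferSum hf N (φ * χ) x)
    (hB4 : a / 4 ≤ volume.real (A ∩ {x | 10 ^ 8 * s ≤ q x})) : False := by
  set Q := transferSum hf N with hQ
  have hN0 : (0 : ℝ) < N := by exact_mod_cast hN
  have hind : ∀ {S : Set UnitAddCircle}, MeasurableSet S →
      Integrable (S.indicator (1 : UnitAddCircle → ℝ)) := fun hS =>
    (integrable_const (1 : ℝ)).indicator hS
  have hmA : ∀ S ⊆ A, volume.real S ≤ a := fun S h => ha ▸ measureReal_mono h
  set e : UnitAddCircle → ℝ := fun x => |A.indicator (1 : UnitAddCircle → ℝ) x - φ x| with he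
  have hem : Measurable e := ((measurable_one.indicator hA).sub hφ).abs
  have hei : Integrable e := ((hind hA).sub hφi).abs
  -- Off `E₁` the error `e` has transfer sum at most `1 / 320` of that of `1_A`. Since `4 / 320 = 1
  -- / 80`, this error and the one from `R` below use up together half of the lower bound `N a q /
  -- 20`.
  obtain ⟨E₁, hE₁, hE₁m, hE₁Q⟩ := exists_maximal_transferSum_le hf N hem hei
    (fun x => abs_nonneg _) hA (β := 1 / 320)
  have hQA : ∀ x ∉ E₁, Q (A.indicator 1) x ≤ 4 * N * a * q x := fun x hx => by
    have h1 : Q (A.indicator 1) x ≤ Q (φ + e) x := transferSum_mono hf N (fun y => by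
      have := le_abs_self (A.indicator (1 : UnitAddCircle → ℝ) y - φ y)
      simp only [Pi.add_apply, he]
      linarith) x
    rw [map_add, Pi.add_apply] at h1
    have h2 := hE₁Q x hx
    have h3 := hQφ x
    have h4 : 0 ≤ Q φ x := by
      have := transferSum_mono hf N hφ0 x
      rwa [map_zero] at this
    linarith
  have hqs : MeasurableSet {x | q x ≤ s} := measurableSet_le hqm measurable_const
  set B := A ∩ {x | 10 ^ 8 * s ≤ q x} with hBdef
  have hB : MeasurableSet B := hA.inter (measurableSet_le measurable_const hqm)
  set C := (A \ E₁) ∩ {x | q x ≤ s} with hCdef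
  have hC : MeasurableSet C := (hA.diff hE₁).inter hqs
  have hBA : B ⊆ A := Set.inter_subset_left
  have hCA : C ⊆ A := fun x hx => hx.1.1
  -- The constant `10240` is large enough for the discarded part `C \ D` to stay negligible after a
  -- loss of `320`, and small enough against `10⁸`.
  obtain ⟨D, hD, hDC, hCD, hBD⟩ := setIntegral_transferSum_le_of_invariant hf hμ N hB hC
    (ne_top_of_le_ne_top hμA (measure_mono hBA)) (ne_top_of_le_ne_top hμA (measure_mono hCA))
    (t := 10240) (by norm_num)
  -- `R` is what the two maximal inequalities remove from the low part of `A`; a third one controls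
  -- its transfer sums off `E₃`.
  set R := (A ∩ {x | q x ≤ s}) \ D with hRdef
  have hR : MeasurableSet R := (hA.inter hqs).diff hD
  obtain ⟨E₃, hE₃, hE₃m, hE₃Q⟩ := exists_maximal_transferSum_le hf N (u := R.indicator 1)
    (measurable_one.indicator hR) (hind hR)
    (Set.indicator_nonneg fun _ _ => zero_le_one) hA (β := 1 / 320)
  rw [integral_indicator_one hR] at hE₃m
  -- Comparability on `A` is what turns the `μ`-bound on the discarded set into a Lebesgue bound;
  -- the factor `c` cancels.
  have hCD' : 10240 * volume.real (C \ D) ≤ 2 * a := by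
    have h1 := hlow (C \ D) (Set.sdiff_subset.trans hCA) (hC.diff hD)
    have h2 := hup B hBA hB
    have h3 := hmA B hBA
    have h4 : c * (10240 * volume.real (C \ D)) ≤ c * (2 * a) := by nlinarith
    exact le_of_mul_le_mul_left h4 hc
  have hRm : volume.real R ≤ volume.real (A ∩ E₁) + volume.real (C \ D) := by
    refine (measureReal_mono ?_).trans (measureReal_union_le _ _)
    rintro x ⟨⟨h1, h2⟩, h3⟩
    by_cases h : x ∈ E₁
    · exact Or.inl ⟨h1, h⟩
    · exact Or.inr ⟨⟨⟨h1, h⟩, h2⟩, h3⟩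
  set G := B \ (E₁ ∪ E₃) with hGdef
  have hG : MeasurableSet G := hB.diff (hE₁.union hE₃)
  have hGm : a / 8 ≤ volume.real G := by
    have h1 : volume.real B ≤ volume.real G + (volume.real (A ∩ E₁) + volume.real (A ∩ E₃)) := by
      refine (measureReal_mono (s₂ := G ∪ ((A ∩ E₁) ∪ (A ∩ E₃))) ?_).trans
        ((measureReal_union_le _ _).trans (add_le_add_right (measureReal_union_le _ _) _))
      intro x hx
      by_cases h : x ∈ E₁
      · exact Or.inr (Or.inl ⟨hBA hx, h⟩)
      by_cases h' : x ∈ E₃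
      · exact Or.inr (Or.inr ⟨hBA hx, h'⟩)
      · exact Or.inl ⟨hx, fun h'' => h''.elim h h'⟩
    have h2 := hE₁m.trans hφA
    linarith
  -- Since `χ` vanishes above `s`, the function `φ χ` lives on the low part of `A` up to `e`, so it
  -- is at most `1_D + 1_R + e`. The last two are negligible off `E₁ ∪ E₃`.
  have hQD : ∀ x ∈ G, N * a * (10 ^ 8 * s) / 40 ≤ Q (D.indicator 1) x := fun x hx => by
    have hx1 : x ∉ E₁ := fun h => hx.2 (Or.inl h)
    have hx3 : x ∉ E₃ := fun h => hx.2 (Or.inr h)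
    have h1 : Q (φ * χ) x ≤ Q (D.indicator 1 + R.indicator 1 + e) x :=
      transferSum_mono hf N (fun y => by
        have h0 := neg_abs_le (A.indicator (1 : UnitAddCircle → ℝ) y - φ y)
        have h2 : 0 ≤ e y := abs_nonneg _
        simp only [Pi.add_apply, Pi.mul_apply]
        have hD0 : 0 ≤ D.indicator (1 : UnitAddCircle → ℝ) y :=
          Set.indicator_nonneg (fun _ _ => zero_le_one) y
        have hR0 : 0 ≤ R.indicator (1 : UnitAddCircle → ℝ) y :=
          Set.indicator_nonneg (fun _ _ => zero_le_one) y
        by_cases hy : s < q y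
        · rw [hχs y hy, mul_zero]
          positivity
        · have h3 : φ y * χ y ≤ φ y := mul_le_of_le_one_right (hφ0 y) (hχ1 y)
          have h4 : A.indicator (1 : UnitAddCircle → ℝ) y ≤
              D.indicator (1 : UnitAddCircle → ℝ) y + R.indicator (1 : UnitAddCircle → ℝ) y := by
            by_cases hyA : y ∈ A
            · by_cases hyD : y ∈ D
              · rw [Set.indicator_of_mem hyA, Set.indicator_of_mem hyD]
                linarith
              · have hyR : y ∈ R := ⟨⟨hyA, not_lt.1 hy⟩, hyD⟩
                rw [Set.indicator_of_mem hyA, Set.indicator_of_mem hyR]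
                linarith
            · rw [Set.indicator_of_notMem hyA]
              linarith
          have h5 : φ y ≤ A.indicator (1 : UnitAddCircle → ℝ) y + e y := by
            have := neg_abs_le (A.indicator (1 : UnitAddCircle → ℝ) y - φ y)
            simp only [he]
            linarith
          linarith) x
    rw [map_add, map_add, Pi.add_apply, Pi.add_apply] at h1
    have h2 := hE₁Q x hx1
    have h3 := hE₃Q x hx3
    have h4 := hQA x hx1
    have h5 := hQχ x
    have h6 : N * a * (10 ^ 8 * s) ≤ N * a * q x :=
      mul_le_mul_of_nonneg_left hx.1.2 (by positivity)
    simp only [← hQ] at h2 h3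
    linarith
  have hL : N * a * (10 ^ 8 * s) / 40 * volume.real G ≤ ∫ x in B, Q (D.indicator 1) x := by
    have hi := integrable_transferSum hf N (hind hD)
    calc N * a * (10 ^ 8 * s) / 40 * volume.real G
        = ∫ x in G, N * a * (10 ^ 8 * s) / 40 := by
          rw [setIntegral_const, smul_eq_mul, mul_comm]
      _ ≤ ∫ x in G, Q (D.indicator 1) x :=
          setIntegral_mono_on (integrable_const _).integrableOn hi.integrableOn hG hQD
      _ ≤ ∫ x in B, Q (D.indicator 1) x := by
          refine setIntegral_mono_set hi.integrableOn (Eventually.of_forall fun x => ?_)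
            (LE.le.eventuallyLE Set.sdiff_subset)
          have := transferSum_mono hf N (u := 0) (v := D.indicator 1)
            (Set.indicator_nonneg fun _ _ => zero_le_one) x
          rwa [map_zero] at this
  have hU : ∫ x in C, Q (C.indicator 1) x ≤ 4 * N * a * s * a := by
    calc ∫ x in C, Q (C.indicator 1) x ≤ ∫ x in C, 4 * N * a * s := by
          refine setIntegral_mono_on (integrable_transferSum hf N (hind hC)).integrableOn
            (integrable_const _).integrableOn hC fun x hx => ?_
          refine (transferSum_mono hf N (Set.indicator_le_indicator_of_subset hCA
            fun _ => zero_le_one) x).trans ((hQA x hx.1.2).trans ?_)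
          exact mul_le_mul_of_nonneg_left hx.2 (by positivity)
      _ = 4 * N * a * s * volume.real C := by
          rw [setIntegral_const, smul_eq_mul, mul_comm]
      _ ≤ 4 * N * a * s * a := mul_le_mul_of_nonneg_left (hmA C hCA) (by positivity)
  -- In units of `N a² s` the left side is `312500` and the right side `40960`.
  have hfin : N * a * (10 ^ 8 * s) / 40 * (a / 8) ≤ 10240 * (4 * N * a * s * a) :=
    (mul_le_mul_of_nonneg_left hGm (by positivity)).trans (hL.trans (hBD.trans (by linarith)))
  have hp : 0 < N * a * s * a := by positivity
  nlinarith

end C1CircleMap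

/-! ### The residual set -/

/-- The Cesàro average of the iterates of the transfer operator. -/
noncomputable def transferAverage (f : expandingMapsFixingZero) (N : ℕ) (u : C(UnitAddCircle, ℝ)) :
    C(UnitAddCircle, ℝ) :=
  (N : ℝ)⁻¹ • ∑ n ∈ Finset.range N, (transferC f ^ n) u

theorem tendsto_transferAverage (f : expandingMapsFixingZero) (N : ℕ) (u : C(UnitAddCircle, ℝ)) :
    Tendsto (fun g => transferAverage g N u) (𝓝 f) (𝓝 (transferAverage f N u)) :=
  (tendsto_finsetSum _ fun n _ => tendsto_transferC_pow f u n).const_smul _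

theorem HasMixingDensity.tendsto_transferAverage {f : expandingMapsFixingZero}
    {ρ : C(UnitAddCircle, ℝ)} (h : HasMixingDensity f ρ) (u : C(UnitAddCircle, ℝ)) :
    Tendsto (fun N => transferAverage f N u) atTop (𝓝 ((∫ x, u x) • ρ)) :=
  (h.tendsto u).cesaro_smul

theorem ContinuousMap.isOpen_setOf_abs_sub_lt {X : Type*} [TopologicalSpace X] [CompactSpace X]
    (w r : C(X, ℝ)) : IsOpen {v : C(X, ℝ) | ∀ x, |v x - w x| < r x} := by
  have h : ∀ w r : C(X, ℝ), IsOpen {v : C(X, ℝ) | Set.MapsTo v Set.univ (Set.Iio 0)} := fun w r =>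
    ContinuousMap.isOpen_setOfPred_mapsTo isCompact_univ isOpen_Iio
  have h1 := (h w r).preimage (f := fun v : C(X, ℝ) => v - w - r) (by fun_prop)
  have h2 := (h w r).preimage (f := fun v : C(X, ℝ) => w - v - r) (by fun_prop)
  convert h1.inter h2 using 1
  ext v
  simp only [Set.mem_ofPred_eq, Set.mem_inter_iff, Set.mem_preimage, Set.MapsTo, Set.mem_univ,
    true_imp_iff, Set.mem_Iio, ContinuousMap.sub_apply, abs_lt]
  refine ⟨fun h => ⟨fun x => ?_, fun x => ?_⟩, fun h x => ⟨?_, ?_⟩⟩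
  · linarith [(h x).2]
  · linarith [(h x).1]
  · have := h.2 (x := x)
    linarith
  · have := h.1 (x := x)
    linarith

/-- A continuous cutoff, `1` where `q ≤ s` and `0` where `q ≥ 2 * s`. -/
noncomputable def sublevelCutoff (q : C(UnitAddCircle, ℝ)) (s : ℝ) : C(UnitAddCircle, ℝ) where
  toFun x := max 0 (min 1 (2 - q x / s))
  continuous_toFun := by fun_prop

theorem sublevelCutoff_nonneg (q : C(UnitAddCircle, ℝ)) (s : ℝ) (x : UnitAddCircle) :
    0 ≤ sublevelCutoff q s x := le_max_left _ _

theorem sublevelCutoff_le_one (q : C(UnitAddCircle, ℝ)) (s : ℝ) (x : UnitAddCircle) :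
    sublevelCutoff q s x ≤ 1 := max_le zero_le_one (min_le_left _ _)

theorem sublevelCutoff_eq_one {q : C(UnitAddCircle, ℝ)} {s : ℝ} (hs : 0 < s) {x : UnitAddCircle}
    (h : q x ≤ s) : sublevelCutoff q s x = 1 := by
  have h1 : q x / s ≤ 1 := (div_le_one hs).2 h
  change max 0 (min 1 (2 - q x / s)) = 1
  rw [min_eq_left (by linarith), max_eq_right zero_le_one]

theorem sublevelCutoff_eq_zero {q : C(UnitAddCircle, ℝ)} {s : ℝ} (hs : 0 < s) {x : UnitAddCircle}
    (h : 2 * s < q x) : sublevelCutoff q s x = 0 := by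
  have h1 : 2 ≤ q x / s := (le_div_iff₀ hs).2 h.le
  change max 0 (min 1 (2 - q x / s)) = 0
  exact max_eq_left ((min_le_right _ _).trans (by linarith))

/-- At some time, the transfer averages of the first test functions `φ l`, cut off at the dyadic
levels of a widely spread density `q`, are close to multiples of `q`. -/
def spreadAveragingMaps (φ : ℕ → C(UnitAddCircle, ℝ)) (Λ : ℝ) (k : ℕ) :
    Set expandingMapsFixingZero :=
  {f | ∃ (q : C(UnitAddCircle, ℝ)) (p : ℝ) (J N : ℕ), 0 < p ∧ (∀ x, p ≤ q x ∧ q x ≤ p * 2 ^ J) ∧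
    IsSpread q Λ (1 / ((k : ℝ) + 1)) ∧ 0 < N ∧ ∀ l ∈ Finset.range (k + 1),
    ∀ j ∈ Finset.range (J + 1), ∀ x,
      |transferAverage f N (φ l * sublevelCutoff q (p * 2 ^ j)) x -
        ((∫ y, (φ l * sublevelCutoff q (p * 2 ^ j)) y) • q) x| < ((1 / ((k : ℝ) + 1)) • q) x}

/-- The data `q`, `p`, `J`, `N` are kept for nearby maps. What remains are finitely many strict
inequalities between continuous functions on a compact space, for averages up to a fixed time. -/
theorem isOpen_spreadAveragingMaps (φ : ℕ → C(UnitAddCircle, ℝ)) (Λ : ℝ) (k : ℕ) :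
    IsOpen (spreadAveragingMaps φ Λ k) := by
  refine isOpen_iff_mem_nhds.2 fun f hf => ?_
  obtain ⟨q, p, J, N, hp, hpq, hq, hN, h⟩ := hf
  have h1 : ∀ᶠ g in 𝓝 f, ∀ l ∈ Finset.range (k + 1), ∀ j ∈ Finset.range (J + 1), ∀ x,
      |transferAverage g N (φ l * sublevelCutoff q (p * 2 ^ j)) x -
        ((∫ y, (φ l * sublevelCutoff q (p * 2 ^ j)) y) • q) x| < ((1 / ((k : ℝ) + 1)) • q) x := by
    rw [Filter.eventually_all_finset]
    intro l hl
    rw [Filter.eventually_all_finset]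
    intro j hj
    exact (tendsto_transferAverage f N _).eventually
      ((ContinuousMap.isOpen_setOf_abs_sub_lt _ _).mem_nhds (h l hl j hj))
  filter_upwards [h1] with g hg
  exact ⟨q, p, J, N, hp, hpq, hq, hN, hg⟩

theorem HasMixingDensity.mem_spreadAveragingMaps {f : expandingMapsFixingZero}
    {q : C(UnitAddCircle, ℝ)} (h : HasMixingDensity f q) (φ : ℕ → C(UnitAddCircle, ℝ)) {Λ : ℝ}
    {k : ℕ} (hq : IsSpread q Λ (1 / ((k : ℝ) + 1))) : f ∈ spreadAveragingMaps φ Λ k := by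
  obtain ⟨p, hp, hpq⟩ := h.exists_pos_le
  -- Finitely many dyadic levels exhaust the range of `q`, so mixing handles all the cut-off test
  -- functions at a common time.
  obtain ⟨J, hJ⟩ := pow_unbounded_of_one_lt (‖q‖ / p) (one_lt_two (α := ℝ))
  have h1 : ∀ᶠ N in atTop, 0 < N ∧ ∀ l ∈ Finset.range (k + 1), ∀ j ∈ Finset.range (J + 1), ∀ x,
      |transferAverage f N (φ l * sublevelCutoff q (p * 2 ^ j)) x -
        ((∫ y, (φ l * sublevelCutoff q (p * 2 ^ j)) y) • q) x| < ((1 / ((k : ℝ) + 1)) • q) x := by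
    refine (eventually_gt_atTop 0).and ?_
    rw [Filter.eventually_all_finset]
    intro l hl
    rw [Filter.eventually_all_finset]
    intro j hj
    refine (h.tendsto_transferAverage _).eventually
      ((ContinuousMap.isOpen_setOf_abs_sub_lt _ _).mem_nhds fun x => ?_)
    rw [sub_self, abs_zero]
    exact mul_pos (by positivity) (h.pos x)
  obtain ⟨N, hN, hN'⟩ := h1.exists
  refine ⟨q, p, J, N, hp, fun x => ⟨hpq x, ?_⟩, hq, hN, hN'⟩
  have h2 : q x ≤ ‖q‖ := (Real.le_norm_self _).trans (q.norm_coe_le_norm x)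
  have h3 := (div_lt_iff₀ hp).1 hJ
  linarith

theorem dense_spreadAveragingMaps (φ : ℕ → C(UnitAddCircle, ℝ)) {Λ : ℝ} (hΛ : 1 ≤ Λ) (k : ℕ) :
    Dense (spreadAveragingMaps φ Λ k) := fun f => by
  rw [isInducing_derivative.closure_eq_preimage_closure_image, Set.mem_preimage,
    Metric.mem_closure_iff]
  intro ε hε
  -- One perturbation produces a mixing density, the next spreads it.
  obtain ⟨g, G, d, c, hG, hg, hGc, hgf⟩ := exists_lipschitz_deriv_near f
    (show 0 < ε / 3 by positivity)
  obtain ⟨ρ, hρ⟩ := exists_hasMixingDensity hG hg hGc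
  obtain ⟨g', q, hq, hqs, hgg⟩ := hρ.exists_isSpread_near hΛ
    (show 0 < min (ε / 3) (1 / ((k : ℝ) + 1)) by positivity)
  refine ⟨_, ⟨g', hq.mem_spreadAveragingMaps φ (Λ := Λ) (k := k)
    fun s hs => (hqs s hs).trans (min_le_right _ _), rfl⟩, ?_⟩
  have h1 := hgg.trans (min_le_left _ _)
  rw [dist_comm]
  refine (dist_triangle _ _ _).trans_lt ((add_le_add h1 hgf).trans_lt ?_)
  linarith

/-! ### Excluding absolutely continuous invariant measures -/

theorem exists_comparable_of_absolutelyContinuous {X : Type*} [MeasurableSpace X]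
    {μ ν : Measure X} [SigmaFinite μ] [IsFiniteMeasure ν] (hμν : μ ≪ ν) (hμ : μ ≠ 0) :
    ∃ (A : Set X) (c : ℝ), MeasurableSet A ∧ 0 < c ∧ 0 < ν.real A ∧ μ A ≠ ⊤ ∧
      ∀ S ⊆ A, MeasurableSet S → c * ν.real S ≤ μ.real S ∧ μ.real S ≤ 2 * c * ν.real S := by
  set r := μ.rnDeriv ν with hr
  have hrm : Measurable r := Measure.measurable_rnDeriv μ ν
  have hd : ν.withDensity r = μ := Measure.withDensity_rnDeriv_eq μ ν hμν
  -- The dyadic layers of the Radon-Nikodym derivative exhaust its positive finite values. One layer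
  -- therefore has positive measure, and on it the two measures are proportional up to a factor `2`.
  have hex : ∃ n : ℤ, ν (r ⁻¹' Set.Ico (2 ^ n) (2 ^ (n + 1))) ≠ 0 := by
    by_contra! h
    apply hμ
    rw [← hd]
    refine withDensity_eq_zero_iff hrm.aemeasurable |>.2 ?_
    have h1 : ∀ᵐ x ∂ν, ∀ n : ℤ, x ∉ r ⁻¹' Set.Ico (2 ^ n) (2 ^ (n + 1)) :=
      ae_all_iff.2 fun n => measure_eq_zero_iff_ae_notMem.1 (h n)
    filter_upwards [h1, Measure.rnDeriv_lt_top μ ν] with x hx hx'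
    by_contra h0
    obtain ⟨n, hn⟩ := ENNReal.exists_mem_Ico_zpow h0 hx'.ne ENNReal.one_lt_two (by simp)
    exact hx n hn
  obtain ⟨n, hn⟩ := hex
  set A := r ⁻¹' Set.Ico (2 ^ n) (2 ^ (n + 1)) with hA
  have hAm : MeasurableSet A := hrm measurableSet_Ico
  have hc0 : (2 : ENNReal) ^ n ≠ 0 := (ENNReal.zpow_pos (by simp) (by simp) n).ne'
  have hct : (2 : ENNReal) ^ n ≠ ⊤ := (ENNReal.zpow_lt_top (by simp) (by simp) n).ne
  have hlow : ∀ S ⊆ A, MeasurableSet S → 2 ^ n * ν S ≤ μ S := fun S hS hSm => by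
    rw [← hd, withDensity_apply _ hSm, ← setLIntegral_const]
    exact setLIntegral_mono' hSm fun x hx => (hS hx).1
  have hup : ∀ S ⊆ A, MeasurableSet S → μ S ≤ 2 * 2 ^ n * ν S := fun S hS hSm => by
    rw [← hd, withDensity_apply _ hSm, ← setLIntegral_const]
    refine setLIntegral_mono' hSm fun x hx => (hS hx).2.le.trans ?_
    rw [ENNReal.zpow_add (by simp) (by simp), zpow_one, mul_comm]
  have hfin : ∀ S, 2 * 2 ^ n * ν S ≠ ⊤ := fun S =>
    ENNReal.mul_ne_top (ENNReal.mul_ne_top (by simp) hct) (measure_ne_top ν S)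
  have hμA : μ A ≠ ⊤ := ne_top_of_le_ne_top (hfin A) (hup A le_rfl hAm)
  refine ⟨A, (2 ^ n : ENNReal).toReal, hAm, ENNReal.toReal_pos hc0 hct,
    ENNReal.toReal_pos hn (measure_ne_top ν A), hμA, fun S hS hSm => ⟨?_, ?_⟩⟩
  · have := ENNReal.toReal_mono (ne_top_of_le_ne_top hμA (measure_mono hS)) (hlow S hS hSm)
    rwa [ENNReal.toReal_mul] at this
  · have := ENNReal.toReal_mono (hfin S) (hup S hS hSm)
    rwa [ENNReal.toReal_mul, ENNReal.toReal_mul, ENNReal.toReal_ofNat] at this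

theorem coe_transferC_pow (f : expandingMapsFixingZero) (n : ℕ) (u : C(UnitAddCircle, ℝ)) :
    (C1CircleMap.transferₗ f.2 ^ n) u = (transferC f ^ n) u := by
  induction n with
  | zero => rfl
  | succ n ih =>
    rw [pow_succ', pow_succ', Module.End.mul_apply, Module.End.mul_apply, ih]
    rfl

theorem transferSum_coe (f : expandingMapsFixingZero) {N : ℕ} (hN : 0 < N)
    (u : C(UnitAddCircle, ℝ)) (x : UnitAddCircle) :
    C1CircleMap.transferSum f.2 N u x = N * transferAverage f N u x := by
  have hN' : (N : ℝ) ≠ 0 := by exact_mod_cast hN.ne'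
  rw [C1CircleMap.transferSum_apply, transferAverage, ContinuousMap.smul_apply,
    ContinuousMap.sum_apply, smul_eq_mul, mul_inv_cancel_left₀ hN']
  simp only [coe_transferC_pow]

theorem exists_abs_denseSeq_approx {A : Set UnitAddCircle} (hA : MeasurableSet A) {ε : ℝ}
    (hε : 0 < ε) : ∃ l, ∫ x, |A.indicator (1 : UnitAddCircle → ℝ) x -
      |TopologicalSpace.denseSeq C(UnitAddCircle, ℝ) l| x| ≤ ε := by
  have hind : Integrable (A.indicator (1 : UnitAddCircle → ℝ)) :=
    (integrable_const (1 : ℝ)).indicator hA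
  obtain ⟨v, hv, -⟩ := hind.exists_boundedContinuous_integral_sub_le (half_pos hε)
  obtain ⟨l, hw⟩ := (TopologicalSpace.denseRange_denseSeq
    C(UnitAddCircle, ℝ)).exists_dist_lt v.toContinuousMap (half_pos hε)
  refine ⟨l, ?_⟩
  set w := TopologicalSpace.denseSeq C(UnitAddCircle, ℝ) l
  have hvi : Integrable v := UnitAddCircle.integrable_continuousMap v.toContinuousMap
  have hni : Integrable fun x => ‖A.indicator (1 : UnitAddCircle → ℝ) x - v x‖ :=
    (hind.sub hvi).norm
  have h1 : ∀ x, |A.indicator (1 : UnitAddCircle → ℝ) x - |w| x| ≤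
      ‖A.indicator (1 : UnitAddCircle → ℝ) x - v x‖ + ε / 2 := fun x => by
    have h2 : |v x - w x| ≤ ε / 2 := by
      have := (ContinuousMap.dist_apply_le_dist (f := v.toContinuousMap) (g := w) x).trans hw.le
      rwa [Real.dist_eq] at this
    have h3 : |A.indicator (1 : UnitAddCircle → ℝ) x - |w| x| ≤
        |A.indicator (1 : UnitAddCircle → ℝ) x - w x| := by
      have h4 : 0 ≤ A.indicator (1 : UnitAddCircle → ℝ) x :=
        Set.indicator_nonneg (fun _ _ => zero_le_one) x
      have h5 := abs_abs_sub_abs_le (A.indicator (1 : UnitAddCircle → ℝ) x) (w x)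
      rwa [abs_of_nonneg h4] at h5
    rw [Real.norm_eq_abs]
    exact h3.trans ((abs_sub_le _ (v x) _).trans (add_le_add_right h2 _))
  calc _ ≤ ∫ x, (‖A.indicator (1 : UnitAddCircle → ℝ) x - v x‖ + ε / 2) :=
        integral_mono (hind.sub (UnitAddCircle.integrable_continuousMap |w|)).abs
          (hni.add (integrable_const _)) h1
    _ ≤ ε := by
        rw [integral_add hni (integrable_const _), integral_const]
        simp only [probReal_univ, one_smul]
        linarith

/-- A map whose transfer averages follow arbitrarily spread densities has no absolutely continuous
invariant `σ`-finite measure. -/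
theorem not_isAciSigma_of_mem_spreadAveragingMaps {f : expandingMapsFixingZero}
    (hf : ∀ k, f ∈ spreadAveragingMaps
      (fun l => |TopologicalSpace.denseSeq C(UnitAddCircle, ℝ) l|) (4 * 10 ^ 8) k)
    (μ : Measure UnitAddCircle) : ¬ IsAciSigma (f : C1CircleMap) μ := by
  rintro ⟨hμ0, hσ, hac, hinv⟩
  obtain ⟨A, c, hA, hc, ha0, hμA, hcmp⟩ := exists_comparable_of_absolutelyContinuous hac hμ0
  obtain ⟨a, ha⟩ : ∃ a, volume.real A = a := ⟨_, rfl⟩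
  rw [ha] at ha0
  obtain ⟨l, hl⟩ := exists_abs_denseSeq_approx hA (show 0 < 5 / 10 ^ 7 * a by positivity)
  set φ : C(UnitAddCircle, ℝ) := |TopologicalSpace.denseSeq C(UnitAddCircle, ℝ) l| with hφ
  have hφ0 : ∀ x, 0 ≤ φ x := fun x => abs_nonneg _
  -- The index must be so large that the averaging error and the window measure are at most `a /
  -- 10`, and that the test function `l` is among those controlled.
  obtain ⟨k₀, hk₀⟩ := exists_nat_gt (10 / a)
  obtain ⟨q, p, J, N, hp, hpq, hq, hN, hav⟩ := hf (max k₀ l)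
  have hk : 1 / ((max k₀ l : ℕ) + 1 : ℝ) ≤ a / 10 := by
    have h1 : (k₀ : ℝ) ≤ (max k₀ l : ℕ) := by exact_mod_cast le_max_left _ _
    rw [div_le_iff₀ (by positivity)]
    rw [div_lt_iff₀ ha0] at hk₀
    nlinarith
  set κ : ℝ := 1 / ((max k₀ l : ℕ) + 1 : ℝ) with hκ
  have hN0 : (0 : ℝ) < N := by exact_mod_cast hN
  have hind : Integrable (A.indicator (1 : UnitAddCircle → ℝ)) :=
    (integrable_const (1 : ℝ)).indicator hA
  have hlk : l ∈ Finset.range (max k₀ l + 1) :=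
    Finset.mem_range.2 (Nat.lt_succ_of_le (le_max_right _ _))
  have hφi := UnitAddCircle.integrable_continuousMap φ
  have hlev : ∀ s, MeasurableSet {x | q x ≤ s} := fun s =>
    measurableSet_le q.continuous.measurable measurable_const
  have hfull : A ∩ {x | q x ≤ p * 2 ^ J} = A := Set.inter_eq_left.2 fun x _ => (hpq x).2
  have hei : Integrable fun x => |A.indicator (1 : UnitAddCircle → ℝ) x - φ x| :=
    (hind.sub hφi).abs
  classical
  have hex : ∃ j, a / 4 ≤ volume.real (A ∩ {x | q x ≤ p * 2 ^ j}) := ⟨J, by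
    rw [hfull, ha]
    linarith⟩
  -- The least dyadic level below which at least a quarter of `A` lies. By minimality at most a
  -- quarter lies below half that level.
  obtain ⟨j, hj, hjmin⟩ : ∃ j, a / 4 ≤ volume.real (A ∩ {x | q x ≤ p * 2 ^ j}) ∧
      ∀ i < j, volume.real (A ∩ {x | q x ≤ p * 2 ^ i}) < a / 4 :=
    ⟨Nat.find hex, Nat.find_spec hex, fun i hi => not_le.1 (Nat.find_min hex hi)⟩
  have hjJ : j ≤ J := by
    by_contra h
    have := hjmin J (not_le.1 h)
    rw [hfull, ha] at this
    linarith
  set s : ℝ := p * 2 ^ j with hs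
  have hs0 : 0 < s := by positivity
  have hhalf : volume.real (A ∩ {x | q x < s / 2}) ≤ a / 4 := by
    rcases j with _ | i
    · have : A ∩ {x | q x < s / 2} = ∅ := by
        refine Set.eq_empty_of_forall_notMem fun x hx => ?_
        have h1 := (hpq x).1
        have h2 : q x < s / 2 := hx.2
        rw [hs, pow_zero, mul_one] at h2
        linarith
      rw [this, measureReal_empty]
      positivity
    · refine le_trans (measureReal_mono ?_) (hjmin i (Nat.lt_succ_self i)).le
      refine Set.inter_subset_inter_right _ fun x hx => ?_
      have h2 : q x < s / 2 := hx
      have h3 : s = p * 2 ^ i * 2 := by rw [hs, pow_succ, mul_assoc]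
      rw [Set.mem_ofPred_eq]
      linarith
  have hφa : ∫ x, φ x ≤ a + 5 / 10 ^ 7 * a := by
    have h1 : ∫ x, φ x ≤ ∫ x, (A.indicator (1 : UnitAddCircle → ℝ) x +
        |A.indicator (1 : UnitAddCircle → ℝ) x - φ x|) :=
      integral_mono hφi (hind.add hei) fun x => by
        have := neg_abs_le (A.indicator (1 : UnitAddCircle → ℝ) x - φ x)
        linarith
    rw [integral_add hind hei, integral_indicator_one hA, ha] at h1
    linarith
  set χ := sublevelCutoff q s with hχ
  have hφχ : a / 4 - 5 / 10 ^ 7 * a ≤ ∫ x, (φ * χ) x := by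
    have hAs := hA.inter (hlev s)
    have hAsi : Integrable ((A ∩ {x | q x ≤ s}).indicator (1 : UnitAddCircle → ℝ)) :=
      (integrable_const (1 : ℝ)).indicator hAs
    have h1 : ∫ x, ((A ∩ {x | q x ≤ s}).indicator (1 : UnitAddCircle → ℝ) x -
        |A.indicator (1 : UnitAddCircle → ℝ) x - φ x|) ≤ ∫ x, (φ * χ) x :=
      integral_mono (hAsi.sub hei) (UnitAddCircle.integrable_continuousMap _)
        fun x => by
          have h2 := le_abs_self (A.indicator (1 : UnitAddCircle → ℝ) x - φ x)
          have h3 := abs_nonneg (A.indicator (1 : UnitAddCircle → ℝ) x - φ x)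
          have h4 := mul_nonneg (hφ0 x) (sublevelCutoff_nonneg q s x)
          rw [ContinuousMap.mul_apply]
          by_cases hx : x ∈ A ∩ {x | q x ≤ s}
          · rw [hχ, sublevelCutoff_eq_one hs0 hx.2, mul_one]
            simp only [Set.indicator_of_mem hx, Set.indicator_of_mem hx.1, Pi.one_apply] at h2 ⊢
            linarith
          · simp only [Set.indicator_of_notMem hx]
            linarith
    rw [integral_sub hAsi hei, integral_indicator_one hAs] at h1
    linarith
  -- The threshold is `2 * s` because the continuous cutoff vanishes only above twice its level.
  refine C1CircleMap.not_comparable_of_transferSum_bounds f.2 hinv hA ha ha0 hc hμA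
    (fun S hS hSm => (hcmp S hS hSm).1) (fun S hS hSm => (hcmp S hS hSm).2)
    (φ := φ) (q := q) (χ := χ) φ.continuous.measurable hφi hφ0 hl q.continuous.measurable
    (s := 2 * s) (by positivity) hN (sublevelCutoff_le_one q s)
    (fun x hx => sublevelCutoff_eq_zero hs0 hx) (fun x => ?_) (fun x => ?_) ?_
  · have h1 := (abs_lt.1 (hav l hlk J (Finset.self_mem_range_succ J) x)).2
    -- The top level `J` makes the cutoff trivial, so the uncut test function is covered by the same
    -- condition.
    have h2 : φ * sublevelCutoff q (p * 2 ^ J) = φ := by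
      ext y
      rw [ContinuousMap.mul_apply, sublevelCutoff_eq_one (by positivity) (hpq y).2, mul_one]
    simp only [← hφ, h2, ContinuousMap.smul_apply, smul_eq_mul] at h1
    rw [transferSum_coe f hN]
    have hq0 : 0 < q x := hp.trans_le (hpq x).1
    have h3 : (∫ y, φ y) * q x + κ * q x ≤ 2 * a * q x := by
      rw [← add_mul]
      exact mul_le_mul_of_nonneg_right (by linarith) hq0.le
    have h4 : transferAverage f N φ x ≤ 2 * a * q x := by linarith
    calc _ ≤ (N : ℝ) * (2 * a * q x) := mul_le_mul_of_nonneg_left h4 hN0.le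
      _ = _ := by ring
  · have h1 := (abs_lt.1 (hav l hlk j (Finset.mem_range.2 (Nat.lt_succ_of_le hjJ)) x)).1
    simp only [← hφ, ← hs, ← hχ, ContinuousMap.smul_apply, smul_eq_mul] at h1
    rw [← ContinuousMap.coe_mul, transferSum_coe f hN]
    have hq0 : 0 < q x := hp.trans_le (hpq x).1
    have h3 : a / 20 * q x ≤ (∫ y, (φ * χ) y) * q x - κ * q x := by
      rw [← sub_mul]
      exact mul_le_mul_of_nonneg_right (by linarith) hq0.le
    have h4 : a / 20 * q x ≤ transferAverage f N (φ * χ) x := by linarith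
    calc _ = (N : ℝ) * (a / 20 * q x) := by ring
      _ ≤ _ := mul_le_mul_of_nonneg_left h4 hN0.le
  -- The window from `s / 2` to `10⁸ · 2s` has ratio `4 · 10⁸`, which explains that constant.
  -- Removing it and the part of `A` below `s / 2` costs at most `a / 10 + a / 4`, so more than `a /
  -- 4` remains above.
  · have h1 := hq (s / 2) (by positivity)
    have h2 : volume.real A ≤ volume.real (A ∩ {x | 10 ^ 8 * (2 * s) ≤ q x}) +
        (volume.real (A ∩ {x | q x < s / 2}) +
          volume.real {x | s / 2 ≤ q x ∧ q x ≤ 4 * 10 ^ 8 * (s / 2)}) := by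
      refine (measureReal_mono ?_).trans ((measureReal_union_le _ _).trans
        (add_le_add_right (measureReal_union_le _ _) _))
      intro x hx
      by_cases h : q x < s / 2
      · exact Or.inr (Or.inl ⟨hx, h⟩)
      by_cases h' : 10 ^ 8 * (2 * s) ≤ q x
      · exact Or.inl ⟨hx, h'⟩
      · exact Or.inr (Or.inr ⟨not_lt.1 h, by linarith⟩)
    linarith

theorem theorem3 :
    ∃ R : Set expandingMapsFixingZero, R ∈ residual expandingMapsFixingZero ∧
      ∀ f ∈ R, ¬ ∃ μ : Measure UnitAddCircle, IsAciSigma (f : C1CircleMap) μ := by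
  refine ⟨⋂ k, spreadAveragingMaps
    (fun l => |TopologicalSpace.denseSeq C(UnitAddCircle, ℝ) l|) (4 * 10 ^ 8) k, ?_, ?_⟩
  · refine countable_iInter_mem.2 fun k => residual_of_dense_open
      (isOpen_spreadAveragingMaps _ _ k) (dense_spreadAveragingMaps _ (by norm_num) k)
  · rintro f hf ⟨μ, hμ⟩
    exact not_isAciSigma_of_mem_spreadAveragingMaps (Set.mem_iInter.1 hf) μ hμ
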